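/- Let $\gamma\subset\mathbb{R}^2$ be an analytic Jordan curve, i.e. the image of a real-analytic map $\mathbb{R}\to\mathbb{R}^2$ of period $1$, injective on $[0,1)$ and with nowhere vanishing derivative. Let $\gamma^{\mathrm{int}}$ and $\gamma^{\mathrm{ext}}$ be the sets of points off $\gamma$ that lie in a bounded, respectively unbounded, connected component of $\mathbb{R}^2\setminus\gamma$. By a tubular neighborhood of $\gamma$ we mean the image $\Omega=\Phi(\mathbb{R}/\mathbb{Z}\times(-1,1))$ of the open annulus under a map $\Phi$ which is real-analytic near the closed annulus $\mathbb{R}/\mathbb{Z}\times[-1,1]$, is injective and has invertible differential on the closed annulus, and is such that $\Phi(\cdot,0)$ is the given parametrization of $\gamma$; thus $\Omega$ is a bounded domain bounded by two disjoint analytic Jordan curves. Then there are a tubular neighborhood $\Omega$ of $\gamma$ and a function $\psi$, real-analytic in a neighborhood of $\overline\Omega$, such that $\psi$ is constant on $\partial\Omega$, $\psi\ge 0$ in $\Omega$, and $$\begin{cases}\Delta\psi=2+\psi^{5/2}&\text{in }\Omega\cap\gamma^{\mathrm{int}},\\ \Delta\psi=2-\psi^{5/2}&\text{in }\Omega\cap\gamma^{\mathrm{ext}},\end{cases}\qquad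 \psi=\frac{\partial\psi}{\partial n}=0\ \text{ on }\gamma,$$ where $n$ is the unit normal of $\gamma$. Moreover, $\psi$ is the stream function of a steady Euler flow in $\Omega$, i.e. $\nabla^\perp\psi\cdot\nabla\Delta\psi=0$ in $\Omega$, where $\nabla^\perp=(-\partial_2,\partial_1)$; the domain $\Omega$ is not simply connected; there is no function $F:\mathbb{R}\to\mathbb{R}$ with $\Delta\psi=F(\psi)$ in $\Omega$; and if $\gamma$ is not a circle, then $\psi$ is not radial in $\Omega$ about any point. Hence the statement that a real-analytic steady Euler stream function, constant on the boundary of a bounded analytic domain, is either radial or a solution of an equation $\Delta\psi=F(\psi)$, fails on multiply connected domains. -/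

import Mathlib

open Set

/-- The Euclidean plane `ℝ²`. -/
abbrev Plane : Type := EuclideanSpace ℝ (Fin 2)

/-- `γ` is a regular real-analytic parametrization, of period `1`, of an analytic Jordan curve;
the curve itself is the set `range γ`. -/
structure IsAnalyticJordanCurve (γ : ℝ → Plane) : Prop where
  analytic : AnalyticOnNhd ℝ γ univ
  periodic : Function.Periodic γ 1
  injOn : InjOn γ (Ico 0 1)
  regular : ∀ s, deriv γ s ≠ 0

/-- The unit normal of the parametrized curve `γ` at parameter `s`: the unit tangent
`γ' / |γ'|` rotated by a right angle. -/
noncomputable def unitNormal (γ : ℝ → Plane) (s : ℝ) : Plane :=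
  ‖deriv γ s‖⁻¹ • !₂[-(deriv γ s 1), deriv γ s 0]

/-- The interior of a Jordan curve `Γ`: the points off `Γ` lying in a bounded connected
component of the complement of `Γ`. -/
def jordanInterior (Γ : Set Plane) : Set Plane :=
  {x | x ∈ Γᶜ ∧ Bornology.IsBounded (connectedComponentIn Γᶜ x)}

/-- The exterior of a Jordan curve `Γ`: the points off `Γ` lying in an unbounded connected
component of the complement of `Γ`. -/
def jordanExterior (Γ : Set Plane) : Set Plane :=
  {x | x ∈ Γᶜ ∧ ¬ Bornology.IsBounded (connectedComponentIn Γᶜ x)}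

/-- `Ω` is a (regular, analytic) tubular neighborhood of the closed curve `γ` of period `1`:
there is an analytic embedding `Φ` of the closed annulus `ℝ/ℤ × [-1, 1]` into the plane
(analytic on a neighborhood of the closed annulus, with invertible differential there), which
restricts to `γ` on the zero section `t = 0` and maps the open annulus `ℝ/ℤ × (-1, 1)` onto `Ω`.
Thus `Ω` is a bounded domain whose boundary consists of the two disjoint analytic Jordan curves
`Φ (·, -1)` and `Φ (·, 1)`. -/
def IsTubularNeighborhood (γ : ℝ → Plane) (Ω : Set Plane) : Prop :=
  ∃ Φ : ℝ × ℝ → Plane,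
    AnalyticOnNhd ℝ Φ (univ ×ˢ Icc (-1) 1) ∧
    (∀ s, ∀ t ∈ Icc (-1 : ℝ) 1, Φ (s + 1, t) = Φ (s, t)) ∧
    InjOn Φ (Ico 0 1 ×ˢ Icc (-1) 1) ∧
    (∀ p ∈ (univ : Set ℝ) ×ˢ Icc (-1 : ℝ) 1, Function.Bijective (fderiv ℝ Φ p)) ∧
    (∀ s, Φ (s, 0) = γ s) ∧
    Φ '' (univ ×ˢ Ioo (-1) 1) = Ω

/-- The partial derivative `∂ᵢ f (x)`. -/
noncomputable def partialDeriv (i : Fin 2) (f : Plane → ℝ) (x : Plane) : ℝ :=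
  fderiv ℝ f x (EuclideanSpace.single i 1)

/-- The Poisson bracket `{f, g} = ∇^⊥ f · ∇ g`, where `∇^⊥ = (-∂₂, ∂₁)`. -/
noncomputable def poissonBracket (f g : Plane → ℝ) (x : Plane) : ℝ :=
  -(partialDeriv 1 f x) * partialDeriv 0 g x + partialDeriv 0 f x * partialDeriv 1 g x

/-- `ψ` is radial on `Ω` about some center: its value at `x ∈ Ω` depends only on the distance
from `x` to the center. -/
def IsRadialOn (ψ : Plane → ℝ) (Ω : Set Plane) : Prop :=
  ∃ c : Plane, ∀ x ∈ Ω, ∀ y ∈ Ω, dist x c = dist y c → ψ x = ψ y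

/-! The nonlinearity only looks non-analytic. If `y` vanishes to first order on the curve and `ψ =
y² v` with `v > 0`, then `ψ^{5/2} = |y|⁵ v^{5/2}`, and the change of sign between interior and
exterior turns `±|y|⁵` into `ε y⁵` with a single constant `ε = ±1`. The two equations merge into the
analytic equation `Δψ = 2 + ε y⁵ v^{5/2}` with zero Cauchy data on the curve.

This Cauchy problem is solved in conformal coordinates. The parametrization extends to a holomorphic
`G` on a strip, injective modulo `1` (`exists_isConformalStrip`), and `z = s + i y` is the
coordinate. With `z` and `w = conj z` made independent, the equation reads `4 ∂_z ∂_w ψ = m (2 + ε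
y⁵ v^{5/2})`, where `m` polarizes `|G'|²`. Two integrations starting on the diagonal `z = w` invert
`∂_z ∂_w` and produce the factor `(z - w)² = -4 y²`, so `v` is a fixed point of an integral
operator. On a thin strip the factor `y⁵` makes the operator a contraction, and `Re m > 0` keeps `v`
in the right half-plane, where the power `5/2` is holomorphic (`exists_complexified_solution`). The
sign `ε` records which side of the curve is bounded (`IsConformalStrip.bounded_side`); that the two
sides differ follows from the jump of the winding number.

The domain is cut out by the levels of `y √v`, in terms of which `ψ = κ² t²`
(`exists_level_coordinate`, `isTubularNeighborhood_of_level`); hence `ψ` is constant on the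
boundary. On either side `Δψ` is a function of `ψ`, and `∇ψ = 0` on the curve, so the flow is
steady. Equal values of `ψ` on opposite sides have different Laplacians, so no global `F` exists.
The function `exp (2πi z)` has no logarithm on the domain, and a radial `ψ` would force the curve
onto a circle because `Δψ = 2` there. -/

section

open Filter Topology MeasureTheory Complex

/-! ### Holomorphic functions with values in `C(K, ℂ)`, and parameter integrals -/

/-- A jointly continuous function on `s × K`, `K` compact, is a continuous family of elements
of `C(K, ℂ)`. -/
theorem exists_continuousOn_curry {X K : Type*} [TopologicalSpace X] [TopologicalSpace K]
    {s : Set X} {h : X → K → ℂ}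
    (hh : ContinuousOn (Function.uncurry h) (s ×ˢ univ)) :
    ∃ F : X → C(K, ℂ), ContinuousOn F s ∧ ∀ x ∈ s, ∀ k, F x k = h x k := by
  classical
  have hc : Continuous fun p : s × K => h p.1 p.2 :=
    hh.comp_continuous (f := fun p : s × K => ((p.1 : X), p.2)) (by fun_prop) (fun p => by simp)
  let g : C(s × K, ℂ) := ⟨_, hc⟩
  refine ⟨fun x => if hx : x ∈ s then g.curry ⟨x, hx⟩ else 0, ?_, ?_⟩
  · rw [continuousOn_iff_continuous_domRestrict]
    convert g.curry.continuous using 1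
    ext x
    simp [Set.domRestrict]
  · intro x hx k
    simp [hx, g]

/-- The Banach-valued Cauchy integral of `F` has a power series, and evaluation at `k` commutes with
the integral, so the scalar Cauchy formula identifies this integral with `F`. Analyticity in the sup
norm is what later lets integrals over `K` be treated as compositions with a bounded functional. -/
theorem analyticOnNhd_continuousMap {K : Type*} [TopologicalSpace K] [CompactSpace K]
    {U : Set ℂ} (hU : IsOpen U) {F : ℂ → C(K, ℂ)} (hF : ContinuousOn F U)
    (hd : ∀ k, DifferentiableOn ℂ (fun z => F z k) U) : AnalyticOnNhd ℂ F U := by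
  intro c hc
  obtain ⟨ρ, hρ, hsub⟩ := Metric.nhds_basis_closedBall.mem_iff.1 (hU.mem_nhds hc)
  lift ρ to NNReal using hρ.le
  have hci : CircleIntegrable F c ρ :=
    (hF.mono (Metric.sphere_subset_closedBall.trans hsub)).circleIntegrable hρ.le
  have hps := hasFPowerSeriesOn_cauchy_integral hci (by exact_mod_cast hρ)
  refine ((hps.congr ?_).analyticAt)
  intro w hw
  have hw' : w ∈ Metric.ball c (ρ : ℝ) := by simpa using hw
  ext k
  have hk := ((hd k).mono hsub).diffContOnCl_ball (c := c) (R := ρ) Subset.rfl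
  have := hk.two_pi_i_inv_smul_circleIntegral_sub_inv_smul hw'
  simp only
  rw [ContinuousMap.smul_apply, ← this]
  congr 1
  have hcont : ContinuousOn (fun z => (z - w)⁻¹ • F z) (Metric.sphere c ρ) := by
    refine ContinuousOn.smul (ContinuousOn.inv₀ (f := fun z => z - w) (by fun_prop) ?_)
      (hF.mono (Metric.sphere_subset_closedBall.trans hsub))
    intro z hz h0
    rw [sub_eq_zero] at h0
    subst h0
    simp only [Metric.mem_sphere, Metric.mem_ball] at hz hw'
    linarith
  have hint := hcont.circleIntegrable hρ.le
  have := ContinuousLinearMap.intervalIntegral_comp_comm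
    ((ContinuousMap.evalCLM ℂ k).restrictScalars ℝ) hint.out
  simp only [circleIntegral]
  refine Eq.trans this.symm ?_
  simp

theorem exists_integral_clm (a b : ℝ) (hab : a ≤ b) :
    ∃ L : C(Icc a b, ℂ) →L[ℂ] ℂ, ∀ (F : C(Icc a b, ℂ)) (h : ℝ → ℂ),
      (∀ t : Icc a b, F t = h t) → L F = ∫ t in a..b, h t := by
  have hint : ∀ F : C(Icc a b, ℂ), IntervalIntegrable (IccExtend hab F) volume a b :=
    fun F => F.continuous.Icc_extend'.intervalIntegrable a b
  let l : C(Icc a b, ℂ) →ₗ[ℂ] ℂ :=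
    { toFun := fun F => ∫ t in a..b, IccExtend hab F t
      map_add' := fun F G => intervalIntegral.integral_add (hint F) (hint G)
      map_smul' := fun c F => intervalIntegral.integral_const_mul c _ }
  refine ⟨l.mkContinuous |b - a| ?_, ?_⟩
  · intro F
    rw [mul_comm]
    exact intervalIntegral.norm_integral_le_of_norm_le_const fun t _ => F.norm_coe_le_norm _
  · intro F h hh
    change ∫ t in a..b, IccExtend hab F t = _
    refine intervalIntegral.integral_congr fun t ht => ?_
    rw [uIcc_of_le hab] at ht
    simp only [IccExtend_of_mem hab F ht]
    exact hh ⟨t, ht⟩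

theorem differentiableOn_intervalIntegral {U : Set ℂ} (hU : IsOpen U) {h : ℂ → ℝ → ℂ} {a b : ℝ}
    (hab : a ≤ b) (hc : ContinuousOn (Function.uncurry h) (U ×ˢ Icc a b))
    (hd : ∀ t ∈ Icc a b, DifferentiableOn ℂ (fun z => h z t) U) :
    DifferentiableOn ℂ (fun z => ∫ t in a..b, h z t) U := by
  obtain ⟨L, hL⟩ := exists_integral_clm a b hab
  obtain ⟨F, hF, hFh⟩ := exists_continuousOn_curry (s := U) (h := fun z (t : Icc a b) => h z t)
    (hc.comp (f := fun p : ℂ × Icc a b => (p.1, (p.2 : ℝ))) (by fun_prop)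
      fun p hp => ⟨hp.1, p.2.2⟩)
  have hFa := analyticOnNhd_continuousMap hU hF
    fun k => (hd k k.2).congr fun z hz => hFh z hz k
  have : DifferentiableOn ℂ (fun z => L (F z)) U :=
    L.differentiable.comp_differentiableOn hFa.differentiableOn
  exact this.congr fun z hz => (hL (F z) (h z) (hFh z hz)).symm

theorem continuousOn_intervalIntegral {X : Type*} [TopologicalSpace X] {U : Set X}
    {h : X → ℝ → ℂ} {a b : ℝ}
    (hab : a ≤ b) (hc : ContinuousOn (Function.uncurry h) (U ×ˢ Icc a b)) :
    ContinuousOn (fun z => ∫ t in a..b, h z t) U := by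
  obtain ⟨L, hL⟩ := exists_integral_clm a b hab
  obtain ⟨F, hF, hFh⟩ := exists_continuousOn_curry (s := U) (h := fun z (t : Icc a b) => h z t)
    (hc.comp (f := fun p : X × Icc a b => (p.1, (p.2 : ℝ))) (by fun_prop)
      fun p hp => ⟨hp.1, p.2.2⟩)
  exact (L.continuous.comp_continuousOn hF).congr fun z hz => (hL (F z) (h z) (hFh z hz)).symm

/-- Osgood's lemma: a continuous, separately holomorphic function of two variables is
analytic. -/
theorem analyticOnNhd_of_separately {D : Set (ℂ × ℂ)} (hD : IsOpen D) {f : ℂ × ℂ → ℂ}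
    (hf : ContinuousOn f D) (h1 : ∀ p ∈ D, DifferentiableAt ℂ (fun z => f (z, p.2)) p.1)
    (h2 : ∀ p ∈ D, DifferentiableAt ℂ (fun w => f (p.1, w)) p.2) : AnalyticOnNhd ℂ f D := by
  rintro ⟨z₀, w₀⟩ hp
  obtain ⟨ρ, hρ, hsub⟩ := Metric.nhds_basis_closedBall.mem_iff.1 (hD.mem_nhds hp)
  rw [← closedBall_prod_same] at hsub
  have h2π : (0 : ℝ) ≤ 2 * Real.pi := by positivity
  have hz₀ : z₀ ∈ Metric.ball z₀ ρ := Metric.mem_ball_self hρ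
  have hw₀ : w₀ ∈ Metric.ball w₀ ρ := Metric.mem_ball_self hρ
  obtain ⟨L, hL⟩ := exists_integral_clm 0 (2 * Real.pi) h2π
  have hcirc : ∀ t : ℝ, circleMap z₀ ρ t ∈ Metric.closedBall z₀ ρ :=
    fun t => circleMap_mem_closedBall z₀ hρ.le t
  have hne : ∀ z ∈ Metric.ball z₀ ρ, ∀ t : ℝ, circleMap z₀ ρ t - z ≠ 0 := fun z hz t h0 =>
    circleMap_ne_mem_ball hz t (sub_eq_zero.1 h0)
  obtain ⟨F, hF, hFh⟩ := exists_continuousOn_curry (s := Metric.ball w₀ ρ)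
    (h := fun w (t : Icc 0 (2 * Real.pi)) => f (circleMap z₀ ρ t, w))
    (hf.comp (f := fun p : ℂ × Icc 0 (2 * Real.pi) => (circleMap z₀ ρ p.2, p.1))
      (by
        have := continuous_circleMap z₀ ρ
        fun_prop)
      fun p hp => hsub ⟨hcirc _, Metric.ball_subset_closedBall hp.1⟩)
  have hFa := analyticOnNhd_continuousMap Metric.isOpen_ball hF
    fun k => (show DifferentiableOn ℂ (fun w => f (circleMap z₀ ρ k, w)) (Metric.ball w₀ ρ) from
      fun w hw =>
      (h2 (circleMap z₀ ρ k, w) (hsub ⟨hcirc k, Metric.ball_subset_closedBall hw⟩)).differentiableWithinAt).congr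
        fun w hw => hFh w hw k
  obtain ⟨k, hk, hkh⟩ := exists_continuousOn_curry (s := Metric.ball z₀ ρ)
    (h := fun z (t : Icc 0 (2 * Real.pi)) =>
      (2 * Real.pi * I : ℂ)⁻¹ * (deriv (circleMap z₀ ρ) t * (circleMap z₀ ρ t - z)⁻¹))
    (by
      have := continuous_circleMap z₀ ρ
      simp only [deriv_circleMap]
      have := continuous_circleMap 0 ρ
      refine ContinuousOn.mul (by fun_prop) (ContinuousOn.mul (by fun_prop)
        (ContinuousOn.inv₀ (by fun_prop) fun p hp => hne _ hp.1 _)))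
  have hka := analyticOnNhd_continuousMap Metric.isOpen_ball hk
    fun t => (show DifferentiableOn ℂ (fun z => (2 * Real.pi * I : ℂ)⁻¹ *
        (deriv (circleMap z₀ ρ) t * (circleMap z₀ ρ t - z)⁻¹)) (Metric.ball z₀ ρ) from
      ((DifferentiableOn.inv (by fun_prop) fun z hz => hne z hz t).const_mul _).const_mul _).congr
        fun w hw => hkh w hw t
  -- The Cauchy formula in the first variable reads `f (z, w) = L (k z * F w)`, with `k` the Cauchy
  -- kernel and `F` the values of `f` on the circle. The product in the Banach algebra `C([0, 2π],
  -- ℂ)` separates the variables, so joint analyticity is immediate.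
  have hprod : AnalyticAt ℂ (fun p : ℂ × ℂ => L (k p.1 * F p.2)) (z₀, w₀) := by
    refine (L.analyticAt _).comp ?_
    exact ((hka z₀ hz₀).comp (f := fun p : ℂ × ℂ => p.1) (x := (z₀, w₀)) analyticAt_fst).mul
      ((hFa w₀ hw₀).comp (f := fun p : ℂ × ℂ => p.2) (x := (z₀, w₀)) analyticAt_snd)
  refine hprod.congr ?_
  filter_upwards [prod_mem_nhds (Metric.ball_mem_nhds z₀ hρ) (Metric.ball_mem_nhds w₀ hρ)]
  rintro ⟨z, w⟩ ⟨hz, hw⟩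
  simp only at hz hw ⊢
  have hd : DiffContOnCl ℂ (fun z => f (z, w)) (Metric.ball z₀ ρ) :=
    DifferentiableOn.diffContOnCl_ball (U := Metric.closedBall z₀ ρ) (fun z' hz' =>
      (h1 (z', w) (hsub ⟨hz', Metric.ball_subset_closedBall hw⟩)).differentiableWithinAt)
      Subset.rfl
  have hC := hd.two_pi_i_inv_smul_circleIntegral_sub_inv_smul hz
  rw [← hC, circleIntegral, ← intervalIntegral.integral_smul]
  refine hL _ _ fun t => ?_
  simp only [ContinuousMap.mul_apply, hFh w hw, hkh z hz, smul_eq_mul]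
  ring

theorem analyticOnNhd_intervalIntegral {D : Set (ℂ × ℂ)} (hD : IsOpen D)
    {h : ℂ × ℂ → ℝ → ℂ} {a b : ℝ} (hab : a ≤ b)
    (hc : ContinuousOn (Function.uncurry h) (D ×ˢ Icc a b))
    (hd : ∀ t ∈ Icc a b, DifferentiableOn ℂ (fun z => h z t) D) :
    AnalyticOnNhd ℂ (fun z => ∫ t in a..b, h z t) D := by
  refine analyticOnNhd_of_separately hD (continuousOn_intervalIntegral hab hc) ?_ ?_
  · rintro ⟨z₀, w₀⟩ hp
    have hmaps : ContinuousOn (fun z : ℂ => (z, w₀)) univ := by fun_prop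
    have hU : IsOpen ((fun z : ℂ => (z, w₀)) ⁻¹' D) := hD.preimage (by fun_prop)
    refine (differentiableOn_intervalIntegral hU (h := fun z => h (z, w₀)) hab
      (hc.comp (f := fun p : ℂ × ℝ => ((p.1, w₀), p.2)) (by fun_prop) fun p hp => hp)
      fun t ht => ?_).differentiableAt (hU.mem_nhds hp)
    exact (hd t ht).comp (f := fun z : ℂ => (z, w₀)) (by fun_prop) fun z hz => hz
  · rintro ⟨z₀, w₀⟩ hp
    have hU : IsOpen ((fun w : ℂ => (z₀, w)) ⁻¹' D) := hD.preimage (by fun_prop)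
    refine (differentiableOn_intervalIntegral hU (h := fun w => h (z₀, w)) hab
      (hc.comp (f := fun p : ℂ × ℝ => ((z₀, p.1), p.2)) (by fun_prop) fun p hp => hp)
      fun t ht => ?_).differentiableAt (hU.mem_nhds hp)
    exact (hd t ht).comp (f := fun w : ℂ => (z₀, w)) (by fun_prop) fun z hz => hz

/-- A primitive of a holomorphic function on a star-shaped open set, by integration along
rays. -/
theorem hasDerivAt_rayIntegral {U : Set ℂ} (hU : IsOpen U) {c : ℂ} (hc : c ∈ U)
    (hstar : ∀ z ∈ U, ∀ t ∈ Icc (0 : ℝ) 1, c + t * (z - c) ∈ U) {g : ℂ → ℂ}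
    (hg : DifferentiableOn ℂ g U) {z : ℂ} (hz : z ∈ U) :
    HasDerivAt (fun w => ∫ t in (0 : ℝ)..1, (w - c) * g (c + t * (w - c))) (g z) z := by
  simp only [intervalIntegral.integral_const_mul]
  set A : ℂ → ℂ := fun w => ∫ t in (0 : ℝ)..1, g (c + t * (w - c)) with hA
  have hAd : DifferentiableOn ℂ A U := by
    refine differentiableOn_intervalIntegral hU zero_le_one ?_ ?_
    · exact hg.continuousOn.comp (f := fun p : ℂ × ℝ => c + p.2 * (p.1 - c)) (by fun_prop)
        fun p hp => hstar p.1 hp.1 p.2 hp.2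
    · intro t ht
      exact hg.comp (f := fun w : ℂ => c + t * (w - c)) (by fun_prop) fun w hw => hstar w hw t ht
  have hAz : HasDerivAt A (deriv A z) z := (hAd.differentiableAt (hU.mem_nhds hz)).hasDerivAt
  have hF : HasDerivAt (fun w => (w - c) * A w) (1 * A z + (z - c) * deriv A z) z :=
    ((hasDerivAt_id z).sub_const c).mul hAz
  -- The product rule gives the derivative as an expression in `A`. It is compared with `g z` along
  -- the ray from `c`: by substitution, `(w - c) * A w` at `w = c + t (z - c)` is `z - c` times an
  -- integral of `g` up to `t`, and the fundamental theorem of calculus applies at `t = 1`.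
  have key : 1 * A z + (z - c) * deriv A z = g z := by
    by_cases hzc : z = c
    · subst hzc
      simp [hA]
    · have hzc' : z - c ≠ 0 := sub_ne_zero.2 hzc
      have hray : HasDerivAt (fun t : ℝ => c + t * (z - c)) (z - c) 1 := by
        simpa using ((ofRealCLM.hasDerivAt (x := (1 : ℝ))).mul_const (z - c)).const_add c
      have h1 : HasDerivAt (fun t : ℝ => (c + t * (z - c) - c) * A (c + t * (z - c)))
          ((1 * A z + (z - c) * deriv A z) * (z - c)) 1 := by
        have hz1 : z = c + ((1 : ℝ) : ℂ) * (z - c) := by simp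
        have hF' := hF
        rw [hz1] at hF'
        have := HasDerivAt.comp (1 : ℝ) hF' hray
        simpa [Function.comp_def] using this
      have hcont : ContinuousOn (fun t : ℝ => g (c + t * (z - c))) (Icc 0 1) :=
        hg.continuousOn.comp (by fun_prop) fun t ht => hstar z hz t ht
      have hV : IsOpen {t : ℝ | c + t * (z - c) ∈ U} := hU.preimage (by fun_prop)
      have hcontV : ContinuousOn (fun t : ℝ => g (c + t * (z - c))) {t : ℝ | c + t * (z - c) ∈ U} :=
        hg.continuousOn.comp (by fun_prop) fun t ht => ht
      have h1V : (1 : ℝ) ∈ {t : ℝ | c + t * (z - c) ∈ U} := by simpa using hz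
      have h2 : HasDerivAt (fun t : ℝ => ∫ σ in (0 : ℝ)..t, g (c + σ * (z - c)))
          (g (c + (1 : ℝ) * (z - c))) 1 := by
        refine intervalIntegral.integral_hasDerivAt_right ?_ ?_ ?_
        · exact ContinuousOn.intervalIntegrable (by rwa [uIcc_of_le zero_le_one])
        · exact hcontV.stronglyMeasurableAtFilter hV _ h1V
        · exact hcontV.continuousAt (hV.mem_nhds h1V)
      have h3 : (fun t : ℝ => (c + t * (z - c) - c) * A (c + t * (z - c))) =
          fun t : ℝ => (z - c) * ∫ σ in (0 : ℝ)..t, g (c + σ * (z - c)) := by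
        funext t
        have := intervalIntegral.smul_integral_comp_mul_left
          (fun σ : ℝ => g (c + σ * (z - c))) t (a := 0) (b := 1)
        simp only [mul_zero, mul_one] at this
        rw [← this, hA, Complex.real_smul]
        simp only [add_sub_cancel_left, ofReal_mul, mul_assoc]
        rw [mul_left_comm]
        simp only [mul_left_comm]
      rw [h3] at h1
      have h4 := h1.unique (h2.const_mul (z - c))
      have : (z - c) * (1 * A z + (z - c) * deriv A z) = (z - c) * g z := by
        rw [mul_comm, h4]; simp
      exact mul_left_cancel₀ hzc' this
  rw [← key]
  exact hF

/-! ### Integration from the diagonal: averages over segments -/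

/-- A neighborhood of the real diagonal in `ℂ × ℂ`, invariant under `(z, w) ↦ (z + 1, w + 1)`. -/
def diagStrip (r : ℝ) : Set (ℂ × ℂ) :=
  {p | |p.1.im| < r ∧ |p.2.im| < r ∧ |p.1.re - p.2.re| < r}

theorem isOpen_diagStrip (r : ℝ) : IsOpen (diagStrip r) := by
  have h1 : Continuous fun p : ℂ × ℂ => |p.1.im| := (continuous_im.comp continuous_fst).abs
  have h2 : Continuous fun p : ℂ × ℂ => |p.2.im| := (continuous_im.comp continuous_snd).abs
  have h3 : Continuous fun p : ℂ × ℂ => |p.1.re - p.2.re| :=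
    ((continuous_re.comp continuous_fst).sub (continuous_re.comp continuous_snd)).abs
  exact (isOpen_lt h1 continuous_const).inter ((isOpen_lt h2 continuous_const).inter
    (isOpen_lt h3 continuous_const))

theorem diagStrip_mono {r r' : ℝ} (h : r ≤ r') : diagStrip r ⊆ diagStrip r' :=
  fun _ hp => ⟨hp.1.trans_le h, hp.2.1.trans_le h, hp.2.2.trans_le h⟩

theorem diagStrip_left {r : ℝ} {p : ℂ × ℂ} (hp : p ∈ diagStrip r) : (p.1, p.1) ∈ diagStrip r :=
  ⟨hp.1, hp.1, by simpa using (abs_nonneg _).trans_lt hp.1⟩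

theorem diagStrip_right {r : ℝ} {p : ℂ × ℂ} (hp : p ∈ diagStrip r) : (p.2, p.2) ∈ diagStrip r :=
  ⟨hp.2.1, hp.2.1, by simpa using (abs_nonneg _).trans_lt hp.2.1⟩

theorem diagStrip_conj {r : ℝ} {p : ℂ × ℂ} (hp : p ∈ diagStrip r) :
    (starRingEnd ℂ p.2, starRingEnd ℂ p.1) ∈ diagStrip r := by
  refine ⟨?_, ?_, ?_⟩
  · simpa using hp.2.1
  · simpa using hp.1
  · simpa [abs_sub_comm] using hp.2.2

theorem convex_diagStrip (r : ℝ) : Convex ℝ (diagStrip r) := by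
  have h : ∀ L : ℂ × ℂ →ₗ[ℝ] ℝ, Convex ℝ {p | |L p| < r} := fun L => by
    have : {p | |L p| < r} = L ⁻¹' Metric.ball 0 r := by
      ext p; simp
    rw [this]
    exact (convex_ball _ _).linear_preimage L
  exact (h (imLm.comp (LinearMap.fst ℝ ℂ ℂ))).inter ((h (imLm.comp (LinearMap.snd ℝ ℂ ℂ))).inter
    (h (reLm.comp (LinearMap.fst ℝ ℂ ℂ) - reLm.comp (LinearMap.snd ℝ ℂ ℂ))))

theorem diagStrip_segment_snd {r : ℝ} {p : ℂ × ℂ} (hp : p ∈ diagStrip r) {t : ℝ}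
    (ht : t ∈ Icc (0 : ℝ) 1) : (p.1, p.1 + t * (p.2 - p.1)) ∈ diagStrip r := by
  have := (convex_diagStrip r) (diagStrip_left hp) hp (sub_nonneg.2 ht.2) ht.1 (by ring)
  convert this using 1
  ext1 <;> simp <;> ring

theorem diagStrip_segment_fst {r : ℝ} {p : ℂ × ℂ} (hp : p ∈ diagStrip r) {t : ℝ}
    (ht : t ∈ Icc (0 : ℝ) 1) : (p.2 + t * (p.1 - p.2), p.2) ∈ diagStrip r := by
  have := (convex_diagStrip r) (diagStrip_right hp) hp (sub_nonneg.2 ht.2) ht.1 (by ring)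
  convert this using 1
  ext1 <;> simp <;> ring

/-- The average of `u (z, ·)` over the segment from `z` to `w`. -/
noncomputable def sndAverage (u : ℂ × ℂ → ℂ) (p : ℂ × ℂ) : ℂ :=
  ∫ t in (0 : ℝ)..1, u (p.1, p.1 + t * (p.2 - p.1))

/-- The average of `f (·, w)`, weighted by the distance to `w`, over the segment from `w`
to `z`. -/
noncomputable def fstAverage (f : ℂ × ℂ → ℂ) (p : ℂ × ℂ) : ℂ :=
  ∫ t in (0 : ℝ)..1, (t : ℂ) * f (p.2 + t * (p.1 - p.2), p.2)

section averages
variable {r : ℝ} {u f : ℂ × ℂ → ℂ}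

theorem continuousOn_sndAverage_integrand (hu : ContinuousOn u (diagStrip r)) :
    ContinuousOn (Function.uncurry fun (p : ℂ × ℂ) (t : ℝ) => u (p.1, p.1 + t * (p.2 - p.1)))
      (diagStrip r ×ˢ Icc 0 1) :=
  hu.comp (f := fun q : (ℂ × ℂ) × ℝ => (q.1.1, q.1.1 + q.2 * (q.1.2 - q.1.1))) (by fun_prop)
    fun _ hq => diagStrip_segment_snd hq.1 hq.2

theorem continuousOn_fstAverage_integrand (hf : ContinuousOn f (diagStrip r)) :
    ContinuousOn (Function.uncurry fun (p : ℂ × ℂ) (t : ℝ) =>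
      (t : ℂ) * f (p.2 + t * (p.1 - p.2), p.2)) (diagStrip r ×ˢ Icc 0 1) :=
  ContinuousOn.mul (by fun_prop)
    (hf.comp (f := fun q : (ℂ × ℂ) × ℝ => (q.1.2 + q.2 * (q.1.1 - q.1.2), q.1.2)) (by fun_prop)
      fun _ hq => diagStrip_segment_fst hq.1 hq.2)

theorem analyticOnNhd_sndAverage (hu : AnalyticOnNhd ℂ u (diagStrip r)) :
    AnalyticOnNhd ℂ (sndAverage u) (diagStrip r) := by
  refine analyticOnNhd_intervalIntegral (isOpen_diagStrip r) zero_le_one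
    (continuousOn_sndAverage_integrand hu.continuousOn) fun t ht => ?_
  exact hu.differentiableOn.comp (f := fun p : ℂ × ℂ => (p.1, p.1 + t * (p.2 - p.1)))
    (by fun_prop) fun p hp => diagStrip_segment_snd hp ht

theorem analyticOnNhd_fstAverage (hf : AnalyticOnNhd ℂ f (diagStrip r)) :
    AnalyticOnNhd ℂ (fstAverage f) (diagStrip r) := by
  refine analyticOnNhd_intervalIntegral (isOpen_diagStrip r) zero_le_one
    (continuousOn_fstAverage_integrand hf.continuousOn) fun t ht => ?_
  exact (hf.differentiableOn.comp (f := fun p : ℂ × ℂ => (p.2 + t * (p.1 - p.2), p.2))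
    (by fun_prop) fun p hp => diagStrip_segment_fst hp ht).const_mul _

theorem intervalIntegrable_sndAverage (hu : ContinuousOn u (diagStrip r)) {p : ℂ × ℂ}
    (hp : p ∈ diagStrip r) :
    IntervalIntegrable (fun t : ℝ => u (p.1, p.1 + t * (p.2 - p.1))) volume 0 1 := by
  refine ContinuousOn.intervalIntegrable ?_
  rw [uIcc_of_le zero_le_one]
  exact (continuousOn_sndAverage_integrand hu).comp (f := fun t : ℝ => (p, t)) (by fun_prop)
    fun t ht => ⟨hp, ht⟩

theorem intervalIntegrable_fstAverage (hf : ContinuousOn f (diagStrip r)) {p : ℂ × ℂ}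
    (hp : p ∈ diagStrip r) :
    IntervalIntegrable (fun t : ℝ => (t : ℂ) * f (p.2 + t * (p.1 - p.2), p.2)) volume 0 1 := by
  refine ContinuousOn.intervalIntegrable ?_
  rw [uIcc_of_le zero_le_one]
  exact (continuousOn_fstAverage_integrand hf).comp (f := fun t : ℝ => (p, t)) (by fun_prop)
    fun t ht => ⟨hp, ht⟩

theorem norm_sndAverage_le {C : ℝ} (hC : ∀ p ∈ diagStrip r, ‖u p‖ ≤ C) {p : ℂ × ℂ}
    (hp : p ∈ diagStrip r) : ‖sndAverage u p‖ ≤ C := by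
  have := intervalIntegral.norm_integral_le_of_norm_le_const (a := (0 : ℝ)) (b := 1) (C := C)
    (f := fun t : ℝ => u (p.1, p.1 + t * (p.2 - p.1))) (by
      intro t ht
      rw [uIoc_of_le zero_le_one] at ht
      exact hC _ (diagStrip_segment_snd hp ⟨ht.1.le, ht.2⟩))
  simpa [sndAverage] using this

theorem norm_fstAverage_le {C : ℝ} (hC : ∀ p ∈ diagStrip r, ‖f p‖ ≤ C) {p : ℂ × ℂ}
    (hp : p ∈ diagStrip r) : ‖fstAverage f p‖ ≤ C := by
  have hC0 : 0 ≤ C := (norm_nonneg _).trans (hC p hp)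
  have := intervalIntegral.norm_integral_le_of_norm_le_const (a := (0 : ℝ)) (b := 1) (C := C)
    (f := fun t : ℝ => (t : ℂ) * f (p.2 + t * (p.1 - p.2), p.2)) (by
      intro t ht
      rw [uIoc_of_le zero_le_one] at ht
      rw [norm_mul, norm_real, Real.norm_of_nonneg ht.1.le]
      calc t * _ ≤ 1 * C := mul_le_mul ht.2 (hC _ (diagStrip_segment_fst hp ⟨ht.1.le, ht.2⟩))
            (norm_nonneg _) zero_le_one
        _ = C := one_mul C)
  simpa [fstAverage] using this

theorem le_re_sndAverage {c : ℝ} (hu : ContinuousOn u (diagStrip r))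
    (hc : ∀ p ∈ diagStrip r, c ≤ (u p).re) {p : ℂ × ℂ} (hp : p ∈ diagStrip r) :
    c ≤ (sndAverage u p).re := by
  have hi := intervalIntegrable_sndAverage hu hp
  have h1 := reCLM.intervalIntegral_comp_comm hi
  have h2 : ∫ t in (0 : ℝ)..1, c ≤ ∫ t in (0 : ℝ)..1, reCLM (u (p.1, p.1 + t * (p.2 - p.1))) :=
    intervalIntegral.integral_mono_on zero_le_one (by simp)
      ⟨reCLM.integrable_comp hi.1, reCLM.integrable_comp hi.2⟩ fun t ht => hc _ (diagStrip_segment_snd hp ht)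
  rw [h1] at h2
  simpa [sndAverage] using h2

theorem le_re_fstAverage {c : ℝ} (hf : ContinuousOn f (diagStrip r))
    (hc : ∀ p ∈ diagStrip r, c ≤ (f p).re) {p : ℂ × ℂ} (hp : p ∈ diagStrip r) :
    c / 2 ≤ (fstAverage f p).re := by
  have hi := intervalIntegrable_fstAverage hf hp
  have h1 := reCLM.intervalIntegral_comp_comm hi
  have h2 : ∫ t in (0 : ℝ)..1, t * c ≤
      ∫ t in (0 : ℝ)..1, reCLM ((t : ℂ) * f (p.2 + t * (p.1 - p.2), p.2)) :=
    intervalIntegral.integral_mono_on zero_le_one (Continuous.intervalIntegrable (by fun_prop) _ _)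
      ⟨reCLM.integrable_comp hi.1, reCLM.integrable_comp hi.2⟩ fun t ht => by
        simpa using mul_le_mul_of_nonneg_left (hc _ (diagStrip_segment_fst hp ht)) ht.1
  rw [h1] at h2
  have h3 : ∫ t in (0 : ℝ)..1, t * c = c / 2 := by
    rw [intervalIntegral.integral_mul_const, integral_id]; ring
  rw [h3] at h2
  simpa [fstAverage] using h2

theorem sndAverage_sub {u' : ℂ × ℂ → ℂ} (hu : ContinuousOn u (diagStrip r))
    (hu' : ContinuousOn u' (diagStrip r)) {p : ℂ × ℂ} (hp : p ∈ diagStrip r) :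
    sndAverage (u - u') p = sndAverage u p - sndAverage u' p :=
  intervalIntegral.integral_sub (intervalIntegrable_sndAverage hu hp)
    (intervalIntegrable_sndAverage hu' hp)

theorem fstAverage_sub {f' : ℂ × ℂ → ℂ} (hf : ContinuousOn f (diagStrip r))
    (hf' : ContinuousOn f' (diagStrip r)) {p : ℂ × ℂ} (hp : p ∈ diagStrip r) :
    fstAverage f p - fstAverage f' p = fstAverage (f - f') p := by
  rw [fstAverage, fstAverage, ← intervalIntegral.integral_sub (intervalIntegrable_fstAverage hf hp)
    (intervalIntegrable_fstAverage hf' hp)]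
  simp [fstAverage, mul_sub]

theorem fstAverage_congr (h : EqOn u f (diagStrip r)) {p : ℂ × ℂ} (hp : p ∈ diagStrip r) :
    fstAverage u p = fstAverage f p :=
  intervalIntegral.integral_congr fun t ht => by
    rw [uIcc_of_le zero_le_one] at ht
    simp only [h (diagStrip_segment_fst hp ht)]

theorem hasDerivAt_sndAverage (hu : AnalyticOnNhd ℂ u (diagStrip r)) {p : ℂ × ℂ}
    (hp : p ∈ diagStrip r) :
    HasDerivAt (fun w => -(p.1 - w) * sndAverage u (p.1, w)) (u p) p.2 := by
  have hU : IsOpen ((fun w : ℂ => (p.1, w)) ⁻¹' diagStrip r) :=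
    (isOpen_diagStrip r).preimage (by fun_prop)
  have := hasDerivAt_rayIntegral hU (c := p.1) (diagStrip_left hp)
    (fun w hw t ht => diagStrip_segment_snd (p := (p.1, w)) hw ht)
    (g := fun w => u (p.1, w))
    (hu.differentiableOn.comp (by fun_prop) fun w hw => hw) (z := p.2) hp
  convert this using 1
  funext w
  rw [intervalIntegral.integral_const_mul, neg_sub]
  rfl

/-- Taken with `f = sndAverage u` and combined with `hasDerivAt_sndAverage`, this shows that `-(z -
w)² * fstAverage (sndAverage u)` has mixed derivative `u`. The factor `-(z - w)² = 4 y²` stands out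
explicitly, so the quotient by `y²` requires no division. -/
theorem hasDerivAt_fstAverage (hf : AnalyticOnNhd ℂ f (diagStrip r)) {p : ℂ × ℂ}
    (hp : p ∈ diagStrip r) :
    HasDerivAt (fun z => -(z - p.2) ^ 2 * fstAverage f (z, p.2)) (-(p.1 - p.2) * f p) p.1 := by
  have hU : IsOpen ((fun z : ℂ => (z, p.2)) ⁻¹' diagStrip r) :=
    (isOpen_diagStrip r).preimage (by fun_prop)
  have := hasDerivAt_rayIntegral hU (c := p.2) (diagStrip_right hp)
    (fun w hw t ht => diagStrip_segment_fst (p := (w, p.2)) hw ht)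
    (g := fun z => -(z - p.2) * f (z, p.2))
    (DifferentiableOn.mul (by fun_prop)
      (hf.differentiableOn.comp (by fun_prop) fun w hw => hw)) (z := p.1) hp
  convert this using 1
  funext z
  simp only [fstAverage]
  rw [intervalIntegral.integral_const_mul, pow_two, ← neg_mul, mul_comm (-(z - p.2)), mul_assoc,
    ← intervalIntegral.integral_const_mul]
  congr 1
  refine intervalIntegral.integral_congr fun t _ => ?_
  simp only [add_sub_cancel_left]
  ring

end averages

theorem sndAverage_add_one {r : ℝ} {u : ℂ × ℂ → ℂ}
    (hu : ∀ p ∈ diagStrip r, u (p + (1, 1)) = u p) {p : ℂ × ℂ} (hp : p ∈ diagStrip r) :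
    sndAverage u (p + (1, 1)) = sndAverage u p :=
  intervalIntegral.integral_congr fun t ht => by
    rw [uIcc_of_le zero_le_one] at ht
    simp only [← hu _ (diagStrip_segment_snd hp ht)]
    congr 1
    ext1 <;> simp; ring

theorem fstAverage_add_one {r : ℝ} {f : ℂ × ℂ → ℂ}
    (hf : ∀ p ∈ diagStrip r, f (p + (1, 1)) = f p) {p : ℂ × ℂ} (hp : p ∈ diagStrip r) :
    fstAverage f (p + (1, 1)) = fstAverage f p :=
  intervalIntegral.integral_congr fun t ht => by
    rw [uIcc_of_le zero_le_one] at ht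
    simp only [← hf _ (diagStrip_segment_fst hp ht)]
    congr 2
    ext1 <;> simp; ring

theorem norm_sub_le_of_mem_diagStrip {r : ℝ} {p : ℂ × ℂ} (hp : p ∈ diagStrip r) :
    ‖(p.1 - p.2) / (2 * I)‖ ≤ 2 * r := by
  have h := Complex.norm_le_abs_re_add_abs_im (p.1 - p.2)
  have h1 : |(p.1 - p.2).im| ≤ |p.1.im| + |p.2.im| := by
    rw [sub_im]; exact abs_sub _ _
  have h2 := hp.1
  have h3 := hp.2.1
  have h4 := hp.2.2
  rw [← sub_re] at h4
  have : (0 : ℝ) ≤ |p.1.im| := abs_nonneg _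
  rw [norm_div]
  simp
  linarith

theorem diagStrip_add_one {r : ℝ} {p : ℂ × ℂ} (hp : p ∈ diagStrip r) :
    p + (1, 1) ∈ diagStrip r := by
  refine ⟨?_, ?_, ?_⟩
  · simpa using hp.1
  · simpa using hp.2.1
  · simpa using hp.2.2

/-! ### Picard iteration for the complexified equation -/

/-- The right half of a disc, on which the power `5 / 2` is Lipschitz. -/
def halfDisc (c M : ℝ) : Set ℂ := {z | ‖z‖ ≤ M ∧ c ≤ z.re}

theorem convex_halfDisc (c M : ℝ) : Convex ℝ (halfDisc c M) := by
  have h1 : Convex ℝ {z : ℂ | ‖z‖ ≤ M} := by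
    have : {z : ℂ | ‖z‖ ≤ M} = Metric.closedBall 0 M := by ext; simp
    rw [this]; exact convex_closedBall _ _
  exact h1.inter ((convex_Ici c).linear_preimage reLm)

theorem mem_slitPlane_of_mem_halfDisc {c M : ℝ} (hc : 0 < c) {z : ℂ} (hz : z ∈ halfDisc c M) :
    z ∈ slitPlane := Or.inl (hc.trans_le hz.2)

theorem norm_cpow_le_of_mem_halfDisc {c M : ℝ} (x : ℝ) (hx : 0 ≤ x) {z : ℂ}
    (hz : z ∈ halfDisc c M) : ‖z ^ (x : ℂ)‖ ≤ M ^ x := by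
  rw [norm_cpow_real]
  exact Real.rpow_le_rpow (norm_nonneg _) hz.1 hx

theorem norm_cpow_sub_le_of_mem_halfDisc {c M : ℝ} (hc : 0 < c) {z w : ℂ}
    (hz : z ∈ halfDisc c M) (hw : w ∈ halfDisc c M) :
    ‖w ^ ((5 / 2 : ℝ) : ℂ) - z ^ ((5 / 2 : ℝ) : ℂ)‖ ≤ 5 / 2 * M ^ (3 / 2 : ℝ) * ‖w - z‖ := by
  refine (convex_halfDisc c M).norm_image_sub_le_of_norm_hasDerivWithin_le
    (f := fun z : ℂ => z ^ ((5 / 2 : ℝ) : ℂ))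
    (f' := fun z : ℂ => ((5 / 2 : ℝ) : ℂ) * z ^ ((3 / 2 : ℝ) : ℂ)) ?_ ?_ hz hw
  · intro x hx
    have := (hasStrictDerivAt_cpow_const (x := x) (c := ((5 / 2 : ℝ) : ℂ))
      (mem_slitPlane_of_mem_halfDisc hc hx)).hasDerivAt.hasDerivWithinAt (s := halfDisc c M)
    convert this using 3
    push_cast
    norm_num
  · intro x hx
    rw [norm_mul, norm_real]
    have := norm_cpow_le_of_mem_halfDisc (3 / 2) (by norm_num) hx
    have h5 : ‖(5 / 2 : ℝ)‖ = 5 / 2 := by norm_num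
    rw [h5]
    gcongr

/-- The complexification of `(Δ ψ) / 4` for `ψ = y² v`, in the coordinates `z = s + i y`,
`w = s - i y` and for the conformal factor `m`. -/
noncomputable def sourceTerm (m : ℂ × ℂ → ℂ) (ε : ℝ) (v : ℂ × ℂ → ℂ) (p : ℂ × ℂ) : ℂ :=
  1 / 4 * m p * (2 + ε * ((p.1 - p.2) / (2 * I)) ^ 5 * v p ^ ((5 / 2 : ℝ) : ℂ))

/-- The quotient by `y²` of the solution with zero Cauchy data on the diagonal of
`∂_z ∂_w ψ = u`. -/
noncomputable def cauchyQuotient (u : ℂ × ℂ → ℂ) (p : ℂ × ℂ) : ℂ :=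
  4 * fstAverage (sndAverage u) p

/-- One step of the Picard iteration, symmetrized so that real functions go to real
functions. -/
noncomputable def picardStep (m : ℂ × ℂ → ℂ) (ε : ℝ) (v : ℂ × ℂ → ℂ) (p : ℂ × ℂ) : ℂ :=
  1 / 2 * (cauchyQuotient (sourceTerm m ε v) p +
    starRingEnd ℂ (cauchyQuotient (sourceTerm m ε v) (starRingEnd ℂ p.2, starRingEnd ℂ p.1)))

/-- The functions on `diagStrip r` among which the Picard iteration runs. -/
structure IsPicardAdmissible (r c M : ℝ) (v : ℂ × ℂ → ℂ) : Prop where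
  analytic : AnalyticOnNhd ℂ v (diagStrip r)
  mem : ∀ p ∈ diagStrip r, v p ∈ halfDisc c M
  periodic : ∀ p ∈ diagStrip r, v (p + (1, 1)) = v p
  symm : ∀ p ∈ diagStrip r, v (starRingEnd ℂ p.2, starRingEnd ℂ p.1) = starRingEnd ℂ (v p)

section
variable {r c M B ε : ℝ} {m u u' v v' : ℂ × ℂ → ℂ}

theorem analyticOnNhd_sourceTerm (hm : AnalyticOnNhd ℂ m (diagStrip r)) (hc : 0 < c)
    (hv : IsPicardAdmissible r c M v) : AnalyticOnNhd ℂ (sourceTerm m ε v) (diagStrip r) := by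
  intro p hp
  have h1 : AnalyticAt ℂ (fun p : ℂ × ℂ => (p.1 - p.2) / (2 * I)) p :=
    (analyticAt_fst.sub analyticAt_snd).div_const
  have h2 : AnalyticAt ℂ (fun p => v p ^ ((5 / 2 : ℝ) : ℂ)) p :=
    (hv.analytic p hp).cpow analyticAt_const (mem_slitPlane_of_mem_halfDisc hc (hv.mem p hp))
  exact (analyticAt_const.mul (hm p hp)).mul
    (analyticAt_const.add ((analyticAt_const.mul (h1.pow 5)).mul h2))

theorem analyticOnNhd_cauchyQuotient (hu : AnalyticOnNhd ℂ u (diagStrip r)) :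
    AnalyticOnNhd ℂ (cauchyQuotient u) (diagStrip r) :=
  analyticOnNhd_const.mul (analyticOnNhd_fstAverage (analyticOnNhd_sndAverage hu))

theorem cauchyQuotient_sub (hu : AnalyticOnNhd ℂ u (diagStrip r))
    (hu' : AnalyticOnNhd ℂ u' (diagStrip r)) {p : ℂ × ℂ} (hp : p ∈ diagStrip r) :
    cauchyQuotient u p - cauchyQuotient u' p = cauchyQuotient (u - u') p := by
  rw [cauchyQuotient, cauchyQuotient, cauchyQuotient, ← mul_sub,
    fstAverage_sub (analyticOnNhd_sndAverage hu).continuousOn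
      (analyticOnNhd_sndAverage hu').continuousOn hp]
  congr 1
  exact fstAverage_congr (fun q hq => (sndAverage_sub hu.continuousOn hu'.continuousOn hq).symm) hp

theorem norm_cauchyQuotient_le {C : ℝ} (hC : ∀ p ∈ diagStrip r, ‖u p‖ ≤ C) {p : ℂ × ℂ}
    (hp : p ∈ diagStrip r) : ‖cauchyQuotient u p‖ ≤ 4 * C := by
  rw [cauchyQuotient, norm_mul]
  have := norm_fstAverage_le (fun q hq => norm_sndAverage_le hC hq) hp
  norm_num
  exact this

theorem le_re_cauchyQuotient (hu : AnalyticOnNhd ℂ u (diagStrip r))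
    (hc : ∀ p ∈ diagStrip r, c ≤ (u p).re) {p : ℂ × ℂ}
    (hp : p ∈ diagStrip r) : 2 * c ≤ (cauchyQuotient u p).re := by
  have := le_re_fstAverage (analyticOnNhd_sndAverage hu).continuousOn
    (fun q hq => le_re_sndAverage hu.continuousOn hc hq) hp
  rw [cauchyQuotient, show (4 : ℂ) = ((4 : ℝ) : ℂ) by norm_num, re_ofReal_mul]
  linarith

theorem differentiableAt_conj_slice_snd {V : ℂ × ℂ → ℂ} {p : ℂ × ℂ}
    (h : DifferentiableAt ℂ V (starRingEnd ℂ p.2, starRingEnd ℂ p.1)) :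
    DifferentiableAt ℂ (fun z => starRingEnd ℂ (V (starRingEnd ℂ p.2, starRingEnd ℂ z))) p.1 := by
  have : DifferentiableAt ℂ (fun z => V (starRingEnd ℂ p.2, z)) (starRingEnd ℂ p.1) :=
    DifferentiableAt.comp (g := V) (starRingEnd ℂ p.1) h (by fun_prop)
  simpa [Function.comp_def] using this.conj_conj

theorem differentiableAt_conj_slice_fst {V : ℂ × ℂ → ℂ} {p : ℂ × ℂ}
    (h : DifferentiableAt ℂ V (starRingEnd ℂ p.2, starRingEnd ℂ p.1)) :
    DifferentiableAt ℂ (fun w => starRingEnd ℂ (V (starRingEnd ℂ w, starRingEnd ℂ p.1))) p.2 := by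
  have : DifferentiableAt ℂ (fun z => V (z, starRingEnd ℂ p.1)) (starRingEnd ℂ p.2) :=
    DifferentiableAt.comp (g := V) (starRingEnd ℂ p.2) h (by fun_prop)
  simpa [Function.comp_def] using this.conj_conj

/-- The two conjugations cancel in each variable separately; continuity and Osgood's lemma do the
rest. -/
theorem analyticOnNhd_conj_swap {V : ℂ × ℂ → ℂ} (hV : AnalyticOnNhd ℂ V (diagStrip r)) :
    AnalyticOnNhd ℂ (fun p => starRingEnd ℂ (V (starRingEnd ℂ p.2, starRingEnd ℂ p.1)))
      (diagStrip r) := by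
  refine analyticOnNhd_of_separately (isOpen_diagStrip r) ?_ ?_ ?_
  · exact continuous_conj.comp_continuousOn
      (hV.continuousOn.comp (by fun_prop) fun p hp => diagStrip_conj hp)
  · exact fun p hp =>
      differentiableAt_conj_slice_snd (hV _ (diagStrip_conj hp)).differentiableAt
  · exact fun p hp =>
      differentiableAt_conj_slice_fst (hV _ (diagStrip_conj hp)).differentiableAt

/-- All smallness comes from here: `|y| ≤ 2 r ≤ 1` gives `|y|⁵ ≤ 2 r`. The case `b = 0` compares the
source with its leading part `m / 2`, the general case yields the contraction estimate. -/
theorem norm_sourceTerm_sub_le (hmM : ∀ p ∈ diagStrip r, ‖m p‖ ≤ M) (hε : |ε| ≤ 1) (hr : 2 * r ≤ 1)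
    {p : ℂ × ℂ} (hp : p ∈ diagStrip r) {a b : ℂ} {δ : ℝ}
    (hab : ‖a - b‖ ≤ δ) :
    ‖1 / 4 * m p * (2 + ε * ((p.1 - p.2) / (2 * I)) ^ 5 * a) -
      1 / 4 * m p * (2 + ε * ((p.1 - p.2) / (2 * I)) ^ 5 * b)‖ ≤ 1 / 4 * (M * (2 * r) * δ) := by
  have h1 : 1 / 4 * m p * (2 + ε * ((p.1 - p.2) / (2 * I)) ^ 5 * a) -
      1 / 4 * m p * (2 + ε * ((p.1 - p.2) / (2 * I)) ^ 5 * b) =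
      1 / 4 * (m p * (ε * ((p.1 - p.2) / (2 * I)) ^ 5) * (a - b)) := by ring
  have hy := norm_sub_le_of_mem_diagStrip hp
  have h5 : ‖(p.1 - p.2) / (2 * I)‖ ^ 5 ≤ 2 * r :=
    (pow_le_of_le_one (norm_nonneg _) (hy.trans hr) (by norm_num)).trans hy
  have hM : 0 ≤ M := (norm_nonneg _).trans (hmM p hp)
  have h6 : ‖(ε : ℂ) * ((p.1 - p.2) / (2 * I)) ^ 5‖ ≤ 2 * r := by
    rw [norm_mul, norm_pow, norm_real, Real.norm_eq_abs]
    calc |ε| * _ ≤ 1 * (2 * r) := mul_le_mul hε h5 (by positivity) zero_le_one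
      _ = 2 * r := one_mul _
  have h7 : ‖(1 / 4 : ℂ)‖ = 1 / 4 := by norm_num
  rw [h1, norm_mul, h7, norm_mul, norm_mul]
  have := hmM p hp
  have h2r : 0 ≤ 2 * r := (norm_nonneg _).trans h6
  gcongr

theorem sourceTerm_add_one (hv : IsPicardAdmissible r c M v)
    (hm : ∀ p ∈ diagStrip r, m (p + (1, 1)) = m p) {p : ℂ × ℂ} (hp : p ∈ diagStrip r) :
    sourceTerm m ε v (p + (1, 1)) = sourceTerm m ε v p := by
  simp [sourceTerm, hm p hp, hv.periodic p hp]

theorem cauchyQuotient_add_one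
    (hu : ∀ p ∈ diagStrip r, u (p + (1, 1)) = u p) {p : ℂ × ℂ} (hp : p ∈ diagStrip r) :
    cauchyQuotient u (p + (1, 1)) = cauchyQuotient u p := by
  rw [cauchyQuotient, cauchyQuotient,
    fstAverage_add_one (fun q hq => sndAverage_add_one hu hq) hp]

/-- The leading source `m / 2` contributes a quotient of norm at most `2 M` and real part at least
`2 c`. The `y⁵` term changes it by at most `c ≤ M`, which leaves norm at most `3 M` and real part at
least `c`. Since `halfDisc` is convex and invariant under conjugation, the symmetrization preserves
these bounds. -/
theorem picardStep_admissible (hc : 0 < c) (hm : IsPicardAdmissible r (2 * c) M m)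
    (hε : |ε| ≤ 1) (hr : 2 * r ≤ 1) (hcM : c ≤ M)
    (hsmall : M * (2 * r) * (3 * M) ^ (5 / 2 : ℝ) ≤ c)
    (hv : IsPicardAdmissible r c (3 * M) v) :
    IsPicardAdmissible r c (3 * M) (picardStep m ε v) := by
  have hu := analyticOnNhd_sourceTerm (ε := ε) hm.analytic hc hv
  have hV := analyticOnNhd_cauchyQuotient hu
  have hu0 : AnalyticOnNhd ℂ (fun p => 1 / 4 * m p * 2) (diagStrip r) :=
    (analyticOnNhd_const.mul hm.analytic).mul analyticOnNhd_const
  have hmem : ∀ p ∈ diagStrip r, cauchyQuotient (sourceTerm m ε v) p ∈ halfDisc c (3 * M) := by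
    intro p hp
    have hdiff : ‖cauchyQuotient (sourceTerm m ε v) p -
        cauchyQuotient (fun p => 1 / 4 * m p * 2) p‖ ≤ c := by
      rw [cauchyQuotient_sub hu hu0 hp]
      refine (norm_cauchyQuotient_le
        (C := 1 / 4 * (M * (2 * r) * (3 * M) ^ (5 / 2 : ℝ))) (fun q hq => ?_) hp).trans ?_
      · have := norm_sourceTerm_sub_le (ε := ε) (fun p hp => (hm.mem p hp).1) hε hr hq
          (a := v q ^ ((5 / 2 : ℝ) : ℂ)) (b := 0) (δ := (3 * M) ^ (5 / 2 : ℝ))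
          (by rw [sub_zero]; exact norm_cpow_le_of_mem_halfDisc _ (by norm_num) (hv.mem q hq))
        simpa [sourceTerm] using this
      · linarith
    have h0n : ‖cauchyQuotient (fun p => 1 / 4 * m p * 2) p‖ ≤ 4 * (1 / 2 * M) := by
      refine norm_cauchyQuotient_le (fun q hq => ?_) hp
      have := (hm.mem q hq).1
      simp only [norm_mul]
      norm_num
      linarith
    have h0r : 2 * c ≤ (cauchyQuotient (fun p => 1 / 4 * m p * 2) p).re := by
      refine le_re_cauchyQuotient hu0 (fun q hq => ?_) hp
      have := (hm.mem q hq).2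
      rw [show 1 / 4 * m q * 2 = ((1 / 2 : ℝ) : ℂ) * m q by push_cast; ring, re_ofReal_mul]
      linarith
    refine ⟨?_, ?_⟩
    · have := norm_le_norm_add_norm_sub' (cauchyQuotient (sourceTerm m ε v) p)
        (cauchyQuotient (fun p => 1 / 4 * m p * 2) p)
      linarith
    · have := (abs_le.1 ((abs_re_le_norm _).trans hdiff)).1
      rw [sub_re] at this
      linarith
  refine ⟨analyticOnNhd_const.mul (hV.add (analyticOnNhd_conj_swap hV)), ?_, ?_, ?_⟩
  · intro p hp
    have h1 := hmem p hp
    have h2 := hmem _ (diagStrip_conj hp)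
    have h3 : starRingEnd ℂ (cauchyQuotient (sourceTerm m ε v)
        (starRingEnd ℂ p.2, starRingEnd ℂ p.1)) ∈ halfDisc c (3 * M) :=
      ⟨by simpa using h2.1, by simpa using h2.2⟩
    have := convex_halfDisc c (3 * M) h1 h3 (a := 1 / 2) (b := 1 / 2) (by norm_num) (by norm_num)
      (by norm_num)
    convert this using 1
    rw [picardStep, mul_add]
    simp [Complex.real_smul]
  · intro p hp
    have h1 := fun q hq => cauchyQuotient_add_one (u := sourceTerm m ε v)
      (fun p hp => sourceTerm_add_one hv hm.periodic hp) (p := q) hq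
    have h2 := h1 _ (diagStrip_conj hp)
    simp only [picardStep, h1 p hp]
    simp only [Prod.mk_add_mk] at h2
    simp [h2]
  · intro p hp
    simp only [picardStep, map_mul, map_add, conj_conj, map_div₀, map_one, Complex.conj_ofNat]
    rw [add_comm]

theorem norm_picardStep_sub_le (hc : 0 < c) (hm : IsPicardAdmissible r (2 * c) M m)
    (hε : |ε| ≤ 1) (hr : 2 * r ≤ 1)
    (hsmall : M * (2 * r) * (5 / 2 * (3 * M) ^ (3 / 2 : ℝ)) ≤ 1 / 2)
    (hv : IsPicardAdmissible r c (3 * M) v) (hv' : IsPicardAdmissible r c (3 * M) v') {δ : ℝ}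
    (hδ : ∀ p ∈ diagStrip r, ‖v p - v' p‖ ≤ δ) {p : ℂ × ℂ} (hp : p ∈ diagStrip r) :
    ‖picardStep m ε v p - picardStep m ε v' p‖ ≤ δ / 2 := by
  have hu := analyticOnNhd_sourceTerm (ε := ε) hm.analytic hc hv
  have hu' := analyticOnNhd_sourceTerm (ε := ε) hm.analytic hc hv'
  have hδ0 : 0 ≤ δ := (norm_nonneg _).trans (hδ p hp)
  have key : ∀ q ∈ diagStrip r, ‖cauchyQuotient (sourceTerm m ε v) q -
      cauchyQuotient (sourceTerm m ε v') q‖ ≤ δ / 2 := by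
    intro q hq
    rw [cauchyQuotient_sub hu hu' hq]
    refine (norm_cauchyQuotient_le
      (C := 1 / 4 * (M * (2 * r) * (5 / 2 * (3 * M) ^ (3 / 2 : ℝ) * δ)))
      (fun x hx => ?_) hq).trans ?_
    · refine norm_sourceTerm_sub_le (ε := ε) (fun p hp => (hm.mem p hp).1) hε hr hx ?_
      refine (norm_cpow_sub_le_of_mem_halfDisc hc (hv'.mem x hx) (hv.mem x hx)).trans ?_
      have h0 : 0 ≤ 3 * M := (norm_nonneg _).trans (hv.mem x hx).1
      have := hδ x hx
      gcongr
    · have := mul_le_mul_of_nonneg_right hsmall hδ0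
      linarith
  have h1 := key p hp
  have h2 := key _ (diagStrip_conj hp)
  rw [picardStep, picardStep, ← mul_sub, add_sub_add_comm, ← map_sub, norm_mul]
  have h3 : ‖(1 / 2 : ℂ)‖ = 1 / 2 := by norm_num
  rw [h3]
  have h4 := norm_add_le (cauchyQuotient (sourceTerm m ε v) p - cauchyQuotient (sourceTerm m ε v') p)
    (starRingEnd ℂ (cauchyQuotient (sourceTerm m ε v) (starRingEnd ℂ p.2, starRingEnd ℂ p.1) -
      cauchyQuotient (sourceTerm m ε v') (starRingEnd ℂ p.2, starRingEnd ℂ p.1)))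
  rw [RCLike.norm_conj] at h4
  linarith

/-- Analyticity passes to the limit one variable at a time by Weierstrass' theorem, then jointly by
Osgood's lemma; the other conditions are closed. -/
theorem IsPicardAdmissible.of_tendstoUniformlyOn {v : ℕ → ℂ × ℂ → ℂ} {w : ℂ × ℂ → ℂ}
    (hv : ∀ n, IsPicardAdmissible r c M (v n))
    (hlim : TendstoUniformlyOn v w atTop (diagStrip r)) : IsPicardAdmissible r c M w := by
  have hpt : ∀ p ∈ diagStrip r, Tendsto (fun n => v n p) atTop (𝓝 (w p)) :=
    fun p hp => hlim.tendsto_at hp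
  refine ⟨?_, ?_, ?_, ?_⟩
  · refine analyticOnNhd_of_separately (isOpen_diagStrip r)
      (hlim.continuousOn (Frequently.of_forall fun n => (hv n).analytic.continuousOn)) ?_ ?_
    · rintro ⟨z₀, w₀⟩ hp
      have hU : IsOpen ((fun z : ℂ => (z, w₀)) ⁻¹' diagStrip r) :=
        (isOpen_diagStrip r).preimage (by fun_prop)
      have h := (hlim.comp (fun z : ℂ => (z, w₀))).tendstoLocallyUniformlyOn
      refine (h.differentiableOn (Eventually.of_forall fun n => ?_) hU).differentiableAt
        (hU.mem_nhds hp)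
      exact (hv n).analytic.differentiableOn.comp (by fun_prop) fun z hz => hz
    · rintro ⟨z₀, w₀⟩ hp
      have hU : IsOpen ((fun w : ℂ => (z₀, w)) ⁻¹' diagStrip r) :=
        (isOpen_diagStrip r).preimage (by fun_prop)
      have h := (hlim.comp (fun w : ℂ => (z₀, w))).tendstoLocallyUniformlyOn
      refine (h.differentiableOn (Eventually.of_forall fun n => ?_) hU).differentiableAt
        (hU.mem_nhds hp)
      exact (hv n).analytic.differentiableOn.comp (by fun_prop) fun z hz => hz
  · intro p hp
    exact ⟨le_of_tendsto' (hpt p hp).norm fun n => ((hv n).mem p hp).1,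
      ge_of_tendsto' ((continuous_re.tendsto _).comp (hpt p hp)) fun n => ((hv n).mem p hp).2⟩
  · intro p hp
    refine tendsto_nhds_unique (hpt _ (diagStrip_add_one hp)) ?_
    simpa only [(hv _).periodic p hp] using hpt p hp
  · intro p hp
    refine tendsto_nhds_unique (hpt _ (diagStrip_conj hp)) ?_
    simp only [(hv _).symm p hp]
    exact (continuous_conj.tendsto _).comp (hpt p hp)

theorem exists_fixedPoint_picardStep (hc : 0 < c) (hr0 : 0 < r)
    (hm : IsPicardAdmissible r (2 * c) M m) (hε : |ε| ≤ 1) (hr : 2 * r ≤ 1)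
    (hsmall : M * (2 * r) * (3 * M) ^ (5 / 2 : ℝ) ≤ c)
    (hsmall' : M * (2 * r) * (5 / 2 * (3 * M) ^ (3 / 2 : ℝ)) ≤ 1 / 2) :
    ∃ v, IsPicardAdmissible r c (3 * M) v ∧ ∀ p ∈ diagStrip r, picardStep m ε v p = v p := by
  have h00 : (0, 0) ∈ diagStrip r := ⟨by simpa, by simpa, by simpa⟩
  have hcM : 2 * c ≤ M := (hm.mem _ h00).2.trans ((re_le_norm _).trans (hm.mem _ h00).1)
  let v : ℕ → ℂ × ℂ → ℂ := fun n => (picardStep m ε)^[n] m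
  have hvs : ∀ n, v (n + 1) = picardStep m ε (v n) := fun n =>
    Function.iterate_succ_apply' _ _ _
  have hv : ∀ n, IsPicardAdmissible r c (3 * M) (v n) := by
    intro n
    induction n with
    | zero =>
      exact ⟨hm.analytic, fun p hp => ⟨(hm.mem p hp).1.trans (by linarith),
        le_trans (by linarith) (hm.mem p hp).2⟩, hm.periodic, hm.symm⟩
    | succ n ih =>
      rw [hvs]
      exact picardStep_admissible hc hm hε hr (by linarith) hsmall ih
  -- Two admissible functions differ by at most `3 M + 3 M`, written as `12 * M / 2` to fit the
  -- geometric-series criterion with ratio `1 / 2`.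
  have hstep : ∀ n, ∀ p ∈ diagStrip r, ‖v n p - v (n + 1) p‖ ≤ 12 * M / 2 / 2 ^ n := by
    intro n
    induction n with
    | zero =>
      intro p hp
      have := norm_sub_le (v 0 p) (v (0 + 1) p)
      have h1 := ((hv 0).mem p hp).1
      have h2 := ((hv (0 + 1)).mem p hp).1
      rw [pow_zero]
      linarith
    | succ n ih =>
      intro p hp
      rw [hvs n, hvs (n + 1)]
      rw [hvs n] at ih
      have := norm_picardStep_sub_le hc hm hε hr hsmall' (hv n)
        (picardStep_admissible hc hm hε hr (by linarith) hsmall (hv n)) ih hp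
      rw [hvs n]
      rw [pow_succ]
      refine this.trans (le_of_eq ?_)
      ring
  have hex : ∀ p, ∃ a, p ∈ diagStrip r → Tendsto (fun n => v n p) atTop (𝓝 a) := by
    intro p
    by_cases hp : p ∈ diagStrip r
    · obtain ⟨a, ha⟩ := cauchySeq_tendsto_of_complete
        (cauchySeq_of_le_geometric_two (C := 12 * M) (f := fun n => v n p) (fun n => by
          rw [dist_eq_norm]; exact hstep n p hp))
      exact ⟨a, fun _ => ha⟩
    · exact ⟨0, fun h => absurd h hp⟩
  choose w hw using hex
  have hdist : ∀ n, ∀ p ∈ diagStrip r, ‖v n p - w p‖ ≤ 12 * M / 2 ^ n := by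
    intro n p hp
    rw [← dist_eq_norm]
    exact dist_le_of_le_geometric_two_of_tendsto (fun n => by
      rw [dist_eq_norm]; exact hstep n p hp) (hw p hp) n
  have hgeo : Tendsto (fun n : ℕ => 12 * M / 2 ^ n) atTop (𝓝 0) := by
    have := (tendsto_pow_atTop_nhds_zero_of_lt_one (r := (1 / 2 : ℝ)) (by norm_num)
      (by norm_num)).const_mul (12 * M)
    rw [mul_zero] at this
    refine this.congr fun n => ?_
    rw [one_div, inv_pow]; rfl
  have hlim : TendstoUniformlyOn v w atTop (diagStrip r) := by
    rw [Metric.tendstoUniformlyOn_iff]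
    intro e he
    filter_upwards [hgeo.eventually (gt_mem_nhds he)] with n hn p hp
    rw [dist_comm, dist_eq_norm]
    exact (hdist n p hp).trans_lt hn
  have hwadm := IsPicardAdmissible.of_tendstoUniformlyOn hv hlim
  refine ⟨w, hwadm, fun p hp => ?_⟩
  refine tendsto_nhds_unique (f := fun n => v (n + 1) p) (l := atTop) ?_
    ((hw p hp).comp (tendsto_add_atTop_nat 1))
  rw [tendsto_iff_norm_sub_tendsto_zero]
  refine squeeze_zero (fun n => norm_nonneg _) (fun n => ?_) hgeo
  rw [hvs]
  refine (norm_picardStep_sub_le hc hm hε hr hsmall' (hv n) hwadm (hdist n) hp).trans ?_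
  have : 0 ≤ 12 * M / 2 ^ n := (norm_nonneg _).trans (hdist n p hp)
  linarith

/-- Solution of the complexified problem `4 ∂_z ∂_w ψ = m (2 + ε y⁵ v^{5/2})`, `ψ = y² v`, near
the diagonal. On the real plane `w = conj z` the real part of `ψ` is `y² v`. -/
theorem exists_complexified_solution {r₀ : ℝ} (hc : 0 < c) (hr₀ : 0 < r₀)
    (hm : IsPicardAdmissible r₀ (2 * c) M m) (hε : |ε| ≤ 1) :
    ∃ r, 0 < r ∧ r ≤ r₀ ∧ ∃ v ψ ψ' : ℂ × ℂ → ℂ, IsPicardAdmissible r c (3 * M) v ∧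
      AnalyticOnNhd ℂ ψ (diagStrip r) ∧
      (∀ p ∈ diagStrip r, HasDerivAt (fun z => ψ (z, p.2)) (ψ' p) p.1) ∧
      (∀ p ∈ diagStrip r, HasDerivAt (fun w => ψ' (p.1, w)) (sourceTerm m ε v p) p.2) ∧
      (∀ z : ℂ, |z.im| < r → (ψ (z, starRingEnd ℂ z)).re =
        z.im ^ 2 * (v (z, starRingEnd ℂ z)).re) := by
  have h00 : (0, 0) ∈ diagStrip r₀ := ⟨by simpa, by simpa, by simpa⟩
  have hcM : 2 * c ≤ M := (hm.mem _ h00).2.trans ((re_le_norm _).trans (hm.mem _ h00).1)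
  have hM : 0 < M := by linarith
  set B := M * (3 * M) ^ (5 / 2 : ℝ) with hB
  set L := M * (5 / 2 * (3 * M) ^ (3 / 2 : ℝ)) with hL
  have hBpos : 0 < B := by positivity
  have hLpos : 0 < L := by positivity
  obtain ⟨r, hr, hrr₀, hr1, hrB, hrL⟩ : ∃ r, 0 < r ∧ r ≤ r₀ ∧ 2 * r ≤ 1 ∧ 2 * r * B ≤ c ∧
      2 * r * L ≤ 1 / 2 := by
    have hpos : 0 < min (min r₀ (1 / 2)) (min (c / (2 * B)) (1 / (4 * L))) := by positivity
    refine ⟨_, hpos, (min_le_left _ _).trans (min_le_left _ _), ?_, ?_, ?_⟩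
    · have := (min_le_left (min r₀ (1 / 2)) (min (c / (2 * B)) (1 / (4 * L)))).trans
        (min_le_right _ _)
      linarith
    · have := (min_le_right (min r₀ (1 / 2)) (min (c / (2 * B)) (1 / (4 * L)))).trans
        (min_le_left _ _)
      rw [le_div_iff₀ (by positivity)] at this
      linarith
    · have := (min_le_right (min r₀ (1 / 2)) (min (c / (2 * B)) (1 / (4 * L)))).trans
        (min_le_right _ _)
      rw [le_div_iff₀ (by positivity)] at this
      linarith
  have hmr : IsPicardAdmissible r (2 * c) M m :=
    ⟨hm.analytic.mono (diagStrip_mono hrr₀), fun p hp => hm.mem p (diagStrip_mono hrr₀ hp),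
      fun p hp => hm.periodic p (diagStrip_mono hrr₀ hp),
      fun p hp => hm.symm p (diagStrip_mono hrr₀ hp)⟩
  obtain ⟨v, hv, hfix⟩ := exists_fixedPoint_picardStep hc hr hmr hε hr1
    (by rw [hB] at hrB; linarith) (by rw [hL] at hrL; linarith)
  have hu := analyticOnNhd_sourceTerm (ε := ε) hmr.analytic hc hv
  have hQ := analyticOnNhd_sndAverage hu
  refine ⟨r, hr, hrr₀, v,
    fun p => -(p.1 - p.2) ^ 2 * fstAverage (sndAverage (sourceTerm m ε v)) p,
    fun p => -(p.1 - p.2) * sndAverage (sourceTerm m ε v) p, hv, ?_, ?_, ?_, ?_⟩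
  · exact ((analyticOnNhd_fst.sub analyticOnNhd_snd).pow 2).neg.mul (analyticOnNhd_fstAverage hQ)
  · exact fun p hp => hasDerivAt_fstAverage hQ hp
  · exact fun p hp => hasDerivAt_sndAverage hu hp
  · intro z hz
    have hp : (z, starRingEnd ℂ z) ∈ diagStrip r := ⟨hz, by simpa, by simpa⟩
    have h := hfix _ hp
    -- The involution `(z, w) ↦ (conj w, conj z)` fixes the graph `w = conj z`. There the
    -- symmetrized fixed point is the real part of the quotient, so `Re ψ = y² v` needs no
    -- uniqueness argument for the Cauchy problem.
    rw [picardStep, conj_conj, ← h, cauchyQuotient] at *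
    simp only
    rw [add_conj, sub_conj]
    rw [show -(((2 * z.im : ℝ) : ℂ) * I) ^ 2 = ((4 * z.im ^ 2 : ℝ) : ℂ) by
      rw [mul_pow, I_sq]; push_cast; ring]
    rw [re_ofReal_mul, show (4 : ℂ) = ((4 : ℝ) : ℂ) by norm_num, re_ofReal_mul,
      show (1 / 2 : ℂ) = ((1 / 2 : ℝ) : ℂ) by norm_num, re_ofReal_mul, ofReal_re]
    ring

end

/-! ### Holomorphic extension of the curve to a conformal strip -/

/-- The real Taylor coefficients, read as coefficients of a complex power series, have the same
norms and hence the same radius of convergence. -/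
theorem exists_analyticAt_complexification {γ : ℝ → ℂ} {s₀ : ℝ} (hγ : AnalyticAt ℝ γ s₀) :
    ∃ f : ℂ → ℂ, AnalyticAt ℂ f s₀ ∧ ∀ᶠ s : ℝ in 𝓝 s₀, f s = γ s := by
  obtain ⟨p, hp⟩ := hγ
  have hrad := hp.radius_pos
  set q : FormalMultilinearSeries ℂ ℂ ℂ := FormalMultilinearSeries.ofScalars ℂ p.coeff with hq
  have hnorm : ∀ n, ‖q n‖ = ‖p n‖ := by
    intro n
    rw [hq, FormalMultilinearSeries.ofScalars_norm, p.norm_apply_eq_norm_coef]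
  have hqrad : 0 < q.radius := by
    have : q.radius = p.radius := by
      simp only [FormalMultilinearSeries.radius, hnorm]
    rwa [this]
  have hqf := (q.hasFPowerSeriesOnBall hqrad).comp_sub (s₀ : ℂ)
  rw [zero_add] at hqf
  refine ⟨_, hqf.analyticAt, ?_⟩
  have h1 := hasFPowerSeriesAt_iff'.1 hp
  have h2 : ∀ᶠ s : ℝ in 𝓝 s₀, (s : ℂ) ∈ Metric.eball (s₀ : ℂ) q.radius :=
    (continuous_ofReal.tendsto s₀).eventually (Metric.eball_mem_nhds _ hqrad)
  filter_upwards [h1, h2] with s hs hs'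
  have h3 := hqf.hasSum_sub hs'
  refine h3.unique ?_
  convert hs using 2 with n
  rw [hq, FormalMultilinearSeries.ofScalars_apply_eq, smul_eq_mul, mul_comm, Complex.real_smul]
  push_cast
  rfl

theorem iteratedDeriv_ofReal_eq {γ : ℝ → ℂ} {f : ℂ → ℂ} {V : Set ℝ} (hV : IsOpen V)
    (hf : ∀ s ∈ V, AnalyticAt ℂ f s) (hfγ : ∀ s ∈ V, f s = γ s) (n : ℕ) :
    ∀ s ∈ V, iteratedDeriv n f (s : ℂ) = iteratedDeriv n γ s := by
  induction n with
  | zero => simpa using hfγ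
  | succ n ih =>
    intro s hs
    have h1 : HasDerivAt (iteratedDeriv n f) (iteratedDeriv (n + 1) f s) s := by
      rw [iteratedDeriv_succ, iteratedDeriv_eq_iterate]
      exact ((hf s hs).iterated_deriv n).differentiableAt.hasDerivAt
    rw [iteratedDeriv_succ (f := γ)]
    refine (HasDerivAt.deriv ?_).symm
    refine h1.comp_ofReal.congr_of_eventuallyEq ?_
    filter_upwards [hV.mem_nhds hs] with t ht using (ih t ht).symm

/-- The holomorphic extension of a real-analytic function of a real variable to a neighborhood
of the real line. -/
noncomputable def holomorphicExtension (γ : ℝ → ℂ) (z : ℂ) : ℂ :=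
  ∑' n : ℕ, (n.factorial : ℂ)⁻¹ • (z - z.re) ^ n • iteratedDeriv n γ z.re

/-- Near `s₀` the defining series is the Taylor series about `Re z` of any local holomorphic
extension `f`, since `f` and `γ` have the same derivatives at real points. The radii `ρ / 3` and `ρ
/ 2` work because `1/3 + 1/2 < 1`: the disc of radius `ρ / 2` about `Re z` contains `z` and stays
where `f` is holomorphic. -/
theorem analyticAt_holomorphicExtension {γ : ℝ → ℂ} (hγ : AnalyticOnNhd ℝ γ univ) (s₀ : ℝ) :
    AnalyticAt ℂ (holomorphicExtension γ) s₀ := by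
  obtain ⟨f, hf, hfγ⟩ := exists_analyticAt_complexification (hγ s₀ (mem_univ _))
  obtain ⟨R, hR, hball⟩ := Metric.eventually_nhds_iff_ball.1 hf.eventually_analyticAt
  obtain ⟨R', hR', hball'⟩ := Metric.eventually_nhds_iff_ball.1 hfγ
  set ρ := min R R'
  have hρ : 0 < ρ := lt_min hR hR'
  have hV : ∀ s ∈ Metric.ball s₀ ρ, AnalyticAt ℂ f (s : ℂ) := by
    intro s hs
    refine hball _ ?_
    rw [Metric.mem_ball, Complex.dist_of_im_eq (by simp)]
    simpa using (Metric.mem_ball.1 hs).trans_le (min_le_left _ _)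
  have hV' : ∀ s ∈ Metric.ball s₀ ρ, f s = γ s := fun s hs =>
    hball' _ ((Metric.mem_ball.1 hs).trans_le (min_le_right _ _))
  refine hf.congr ?_
  filter_upwards [Metric.ball_mem_nhds (s₀ : ℂ) (show 0 < ρ / 3 by positivity)] with z hz
  rw [Metric.mem_ball, dist_eq_norm] at hz
  have hre : |z.re - s₀| < ρ / 3 := by
    have := (abs_re_le_norm (z - s₀)).trans_lt hz
    simpa using this
  have him : ‖z - z.re‖ < ρ / 2 := by
    have h1 : z - z.re = (z.im : ℂ) * I := by
      nth_rewrite 1 [← re_add_im z]; ring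
    have h2 := (abs_im_le_norm (z - s₀)).trans_lt hz
    rw [h1, norm_mul, norm_I, mul_one, norm_real, Real.norm_eq_abs]
    simp only [sub_im, ofReal_im, sub_zero] at h2
    linarith
  have hsub : Metric.ball (z.re : ℂ) (ρ / 2) ⊆ Metric.ball (s₀ : ℂ) R := by
    refine (Metric.ball_subset_ball' ?_).trans (Metric.ball_subset_ball (min_le_left R R'))
    rw [Complex.dist_of_im_eq (by simp), Real.dist_eq]
    simp only [ofReal_re]
    linarith
  have hT := taylorSeries_eq_on_ball (f := f) (c := (z.re : ℂ)) (z := z) (r := ρ / 2)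
    (fun w hw => (hball w (hsub hw)).differentiableAt.differentiableWithinAt)
    (by rwa [Metric.mem_ball, dist_eq_norm])
  rw [holomorphicExtension, ← hT]
  congr 1
  funext n
  rw [iteratedDeriv_ofReal_eq Metric.isOpen_ball hV hV' n z.re]
  rw [Metric.mem_ball, Real.dist_eq]
  linarith

theorem holomorphicExtension_ofReal (γ : ℝ → ℂ) (s : ℝ) : holomorphicExtension γ s = γ s := by
  rw [holomorphicExtension, tsum_eq_single 0]
  · simp
  · intro n hn
    simp [hn]

theorem holomorphicExtension_add_one {γ : ℝ → ℂ} (hγ : Function.Periodic γ 1) (z : ℂ) :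
    holomorphicExtension γ (z + 1) = holomorphicExtension γ z := by
  have h : ∀ n, iteratedDeriv n γ (z.re + 1) = iteratedDeriv n γ z.re := by
    intro n
    have h1 := iteratedDeriv_comp_add_const n γ 1
    have h2 : (fun x => γ (x + 1)) = γ := funext hγ
    rw [h2] at h1
    exact (congrFun h1 z.re).symm
  rw [holomorphicExtension, holomorphicExtension]
  congr 1
  funext n
  simp [h n]

theorem deriv_holomorphicExtension_ofReal {γ : ℝ → ℂ} (hγ : AnalyticOnNhd ℝ γ univ) (s : ℝ) :
    deriv (holomorphicExtension γ) s = deriv γ s := by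
  have h := iteratedDeriv_ofReal_eq isOpen_univ
    (fun s _ => analyticAt_holomorphicExtension hγ s)
    (fun s _ => holomorphicExtension_ofReal γ s) 1 s (mem_univ s)
  simpa using h

/-- A property of pairs that holds near all real pairs at distance at most `B` and is invariant
under the diagonal translation holds on a uniform neighborhood. -/
theorem exists_strip_of_eventually {B : ℝ} (hB : 0 ≤ B) {P : ℂ × ℂ → Prop}
    (hper : Function.Periodic P (1, 1))
    (h : ∀ a b : ℝ, |a - b| ≤ B → ∀ᶠ p in 𝓝 ((a : ℂ), (b : ℂ)), P p) :
    ∃ r > 0, ∀ p : ℂ × ℂ, |p.1.im| < r → |p.2.im| < r → |p.1.re - p.2.re| < B + r → P p := by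
  set K : Set (ℂ × ℂ) := (fun q : ℝ × ℝ => ((q.1 : ℂ), ((q.1 + q.2 : ℝ) : ℂ))) ''
    (Icc 0 1 ×ˢ Icc (-B) B)
  have hK : IsCompact K := (isCompact_Icc.prod isCompact_Icc).image (by fun_prop)
  have hPK : {p | P p} ∈ 𝓝ˢ K := by
    rw [mem_nhdsSet_iff_forall]
    rintro _ ⟨q, hq, rfl⟩
    refine h _ _ ?_
    rw [sub_add_cancel_left, abs_neg, abs_le]
    exact hq.2
  obtain ⟨δ, hδ, hsub⟩ := (Metric.hasBasis_nhdsSet_thickening hK).mem_iff.1 hPK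
  refine ⟨δ / 2, by positivity, fun p h1 h2 h3 => ?_⟩
  set n := ⌊p.1.re⌋
  have hpn : P (p - n • ((1 : ℂ), (1 : ℂ))) = P p := hper.sub_zsmul_eq n
  rw [← hpn]
  refine hsub (Metric.mem_thickening_iff.2 ?_)
  set d := p.2.re - p.1.re
  -- `c` is the projection of `d` to `[-B, B]`. After translation by `-n` it gives a point of the
  -- compact set `K` within `δ` of the pair.
  set c := max (-B) (min B d)
  have hcB : c ∈ Icc (-B) B := ⟨le_max_left _ _, max_le (by linarith) (min_le_left _ _)⟩
  have hcd : |d - c| < δ / 2 := by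
    rw [abs_sub_comm] at h3
    have h3' := abs_lt.1 h3
    rw [abs_lt]
    rcases le_total d (-B) with hd | hd
    · have : c = -B := by
        simp only [c]; rw [min_eq_right (by linarith), max_eq_left hd]
      rw [this]; constructor <;> linarith [h3'.1]
    · rcases le_total d B with hd' | hd'
      · have : c = d := by
          simp only [c]; rw [min_eq_right hd', max_eq_right hd]
        rw [this]; constructor <;> linarith
      · have : c = B := by
          simp only [c]; rw [min_eq_left hd', max_eq_right (by linarith)]
        rw [this]; constructor <;> linarith [h3'.2]
  refine ⟨_, ⟨(p.1.re - n, c), ⟨⟨?_, ?_⟩, hcB⟩, rfl⟩, ?_⟩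
  · have := Int.floor_le p.1.re
    simp only [n]; linarith
  · have := Int.lt_floor_add_one p.1.re
    simp only [n]; linarith
  · rw [Prod.dist_eq, max_lt_iff]
    have hz : ∀ w : ℂ, |w.re| < δ / 2 → |w.im| < δ / 2 → ‖w‖ < δ := fun w hw hw' => by
      have := Complex.norm_le_abs_re_add_abs_im w
      linarith
    refine ⟨?_, ?_⟩
    · rw [dist_eq_norm]
      refine hz _ ?_ ?_
      · simpa using hδ
      · simpa using h1
    · rw [dist_eq_norm]
      refine hz _ ?_ ?_
      · convert hcd using 2
        simp [d]; ring
      · simpa using h2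

theorem exists_strip_of_eventually_diag {P : ℂ × ℂ → Prop}
    (hper : Function.Periodic P (1, 1))
    (h : ∀ a : ℝ, ∀ᶠ p in 𝓝 ((a : ℂ), (a : ℂ)), P p) :
    ∃ r > 0, ∀ p ∈ diagStrip r, P p := by
  obtain ⟨r, hr, hP⟩ := exists_strip_of_eventually le_rfl hper fun a b hab => by
    have : a = b := by
      rwa [abs_nonpos_iff, sub_eq_zero] at hab
    rw [← this]; exact h a
  exact ⟨r, hr, fun p hp => hP p hp.1 hp.2.1 (by simpa using hp.2.2)⟩

theorem exists_strip_of_eventually_single {P : ℂ → Prop}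
    (hper : ∀ z, P (z + 1) = P z)
    (h : ∀ a : ℝ, ∀ᶠ z in 𝓝 (a : ℂ), P z) :
    ∃ r > 0, ∀ z : ℂ, |z.im| < r → P z := by
  obtain ⟨r, hr, hP⟩ := exists_strip_of_eventually_diag (P := fun p => P p.1)
    (fun p => hper p.1) fun a => continuousAt_fst.eventually (h a)
  exact ⟨r, hr, fun z hz => hP (z, z) ⟨hz, hz, by simpa using hr⟩⟩

/-- A holomorphic function on the strip `|Im z| < r` which is the universal cover of a conformal
parametrization of a neighborhood of a closed curve. -/
structure IsConformalStrip (G : ℂ → ℂ) (r : ℝ) : Prop where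
  pos : 0 < r
  analytic : ∀ z : ℂ, |z.im| < r → AnalyticAt ℂ G z
  periodic : ∀ z, G (z + 1) = G z
  deriv_ne : ∀ z : ℂ, |z.im| < r → deriv G z ≠ 0
  inj : ∀ z w : ℂ, |z.im| < r → |w.im| < r → G z = G w → ∃ n : ℤ, z = w + n

/-- The polarization of the conformal factor `|G'|²`. -/
noncomputable def conformalFactor (G : ℂ → ℂ) (p : ℂ × ℂ) : ℂ :=
  deriv G p.1 * starRingEnd ℂ (deriv G (starRingEnd ℂ p.2))

theorem IsConformalStrip.mono {G : ℂ → ℂ} {r r' : ℝ} (h : IsConformalStrip G r) (hr' : 0 < r')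
    (hle : r' ≤ r) : IsConformalStrip G r' :=
  ⟨hr', fun z hz => h.analytic z (hz.trans_le hle), h.periodic,
    fun z hz => h.deriv_ne z (hz.trans_le hle),
    fun z w hz hw => h.inj z w (hz.trans_le hle) (hw.trans_le hle)⟩

theorem deriv_add_one_of_periodic {G : ℂ → ℂ} (h : ∀ z, G (z + 1) = G z) (z : ℂ) :
    deriv G (z + 1) = deriv G z := by
  rw [← deriv_comp_add_const]
  congr 1
  exact funext h

/-- Regularity extends from the real line by periodicity and compactness. For injectivity only pairs
with real parts at distance at most `1 / 2` matter, since rounding the difference of the real parts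
brings any pair to this form. Near a real diagonal pair `G` is locally injective by the inverse
function theorem; near another such real pair its two values are distinct by injectivity of `γ` on a
period. -/
theorem exists_isConformalStrip {γ : ℝ → ℂ} (hγ : AnalyticOnNhd ℝ γ univ)
    (hper : Function.Periodic γ 1) (hinj : InjOn γ (Ico 0 1)) (hreg : ∀ s, deriv γ s ≠ 0) :
    ∃ r, IsConformalStrip (holomorphicExtension γ) r := by
  set G := holomorphicExtension γ
  have hG : ∀ a : ℝ, AnalyticAt ℂ G a := analyticAt_holomorphicExtension hγ
  have hGper := holomorphicExtension_add_one hper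
  have hG' : ∀ a : ℝ, deriv G a ≠ 0 := fun a => by
    rw [deriv_holomorphicExtension_ofReal hγ]; exact hreg a
  obtain ⟨r₁, hr₁, h₁⟩ := exists_strip_of_eventually_single
    (P := fun z => AnalyticAt ℂ G z ∧ deriv G z ≠ 0)
    (fun z => by
      rw [deriv_add_one_of_periodic hGper]
      congr 1
      refine propext ⟨fun h => ?_, fun h => ?_⟩
      · have := AnalyticAt.fun_comp (f := fun w => w + 1) (x := z) h (by fun_prop)
        simpa only [hGper, G] using! this
      · have h' : AnalyticAt ℂ G ((z + 1) + (-1)) := by simpa using h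
        have := AnalyticAt.fun_comp (f := fun w : ℂ => w + (-1)) (x := z + 1) h' (by fun_prop)
        refine this.congr (Eventually.of_forall fun w => ?_)
        have := hGper (w + (-1))
        simp only [neg_add_cancel_right] at this
        exact this.symm)
    (fun a => (hG a).eventually_analyticAt.and
      ((hG a).deriv.continuousAt.eventually_ne (hG' a)))
  obtain ⟨r₂, hr₂, h₂⟩ := exists_strip_of_eventually (B := 1 / 2) (by norm_num)
    (P := fun p => G p.1 = G p.2 → p.1 = p.2)
    (fun p => by simp [hGper, G])
    (fun a b hab => by
      by_cases h : a = b
      · subst h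
        have hs := ((hG a).hasStrictDerivAt).hasStrictFDerivAt_equiv (hG' a)
        have hsrc := (hs.toOpenPartialHomeomorph G).open_source.mem_nhds
          hs.mem_toOpenPartialHomeomorph_source
        filter_upwards [prod_mem_nhds hsrc hsrc] with p hp heq
        exact (hs.toOpenPartialHomeomorph G).injOn hp.1 hp.2 heq
      · have hne : G a ≠ G b := by
          simp only [G, holomorphicExtension_ofReal]
          intro heq
          have h1 : γ (Int.fract a) = γ (Int.fract b) := by
            have e : ∀ x : ℝ, γ (Int.fract x) = γ x := fun x => by
              have := hper.sub_zsmul_eq (x := x) ⌊x⌋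
              rwa [zsmul_one, Int.self_sub_floor] at this
            rw [e, e, heq]
          have h2 := hinj ⟨Int.fract_nonneg a, Int.fract_lt_one a⟩
            ⟨Int.fract_nonneg b, Int.fract_lt_one b⟩ h1
          obtain ⟨n, hn⟩ := Int.fract_eq_fract.1 h2
          rw [hn] at hab
          have hn0 : n ≠ 0 := by
            rintro rfl
            simp only [Int.cast_zero, sub_eq_zero] at hn
            exact h hn
          have : (1 : ℝ) ≤ |(n : ℝ)| := by exact_mod_cast Int.one_le_abs hn0
          linarith
        have hc : ContinuousAt (fun p : ℂ × ℂ => G p.1 - G p.2) ((a : ℂ), (b : ℂ)) :=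
          ((hG a).continuousAt.comp (f := fun p : ℂ × ℂ => p.1) (x := ((a : ℂ), (b : ℂ)))
            continuousAt_fst).sub ((hG b).continuousAt.comp (f := fun p : ℂ × ℂ => p.2)
            (x := ((a : ℂ), (b : ℂ))) continuousAt_snd)
        filter_upwards [hc.eventually_ne (sub_ne_zero.2 hne)] with p hp heq
        exact absurd heq (sub_ne_zero.1 hp))
  refine ⟨min r₁ r₂, lt_min hr₁ hr₂, fun z hz => (h₁ z (hz.trans_le (min_le_left _ _))).1, hGper,
    fun z hz => (h₁ z (hz.trans_le (min_le_left _ _))).2, fun z w hz hw heq => ?_⟩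
  have hGn : ∀ n : ℤ, G (w + n) = G w := fun n => by
    have := Function.Periodic.sub_zsmul_eq (f := G) (c := 1) hGper (x := w) (-n)
    simpa using this
  refine ⟨round (z.re - w.re), h₂ (z, w + (round (z.re - w.re) : ℤ))
    (hz.trans_le (min_le_right _ _)) (by simpa using hw.trans_le (min_le_right _ _)) ?_ ?_⟩
  · have := abs_sub_round (z.re - w.re)
    simp only [add_re, intCast_re]
    rw [← sub_sub]
    linarith
  · simp only [hGn, heq]

/-- On the real diagonal the factor is `|G'|² > 0`, with a positive minimum and a finite maximum
over a period. Halving the minimum and adding `1` to the maximum leaves room for a uniform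
neighborhood. -/
theorem IsConformalStrip.exists_isPicardAdmissible {G : ℂ → ℂ} {r : ℝ}
    (h : IsConformalStrip G r) :
    ∃ r', 0 < r' ∧ r' ≤ r ∧ ∃ c M : ℝ, 0 < c ∧
      IsPicardAdmissible r' (2 * c) M (conformalFactor G) := by
  have hreal : ∀ a : ℝ, |(a : ℂ).im| < r := fun a => by simpa using h.pos
  have hdiag : ∀ a : ℝ, conformalFactor G (a, a) = ((‖deriv G a‖ ^ 2 : ℝ) : ℂ) := fun a => by
    rw [conformalFactor, conj_ofReal, mul_conj, normSq_eq_norm_sq]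
  have hV : AnalyticOnNhd ℂ (fun p : ℂ × ℂ => deriv G p.1) (diagStrip r) := fun p hp =>
    (h.analytic _ hp.1).deriv.comp (f := fun p : ℂ × ℂ => p.1) analyticAt_fst
  have hm : AnalyticOnNhd ℂ (conformalFactor G) (diagStrip r) :=
    hV.mul (analyticOnNhd_conj_swap hV)
  have hmem : ∀ a : ℝ, ((a : ℂ), (a : ℂ)) ∈ diagStrip r := fun a =>
    ⟨hreal a, hreal a, by simpa using h.pos⟩
  have hper : ∀ p, conformalFactor G (p + (1, 1)) = conformalFactor G p := fun p => by
    simp [conformalFactor, deriv_add_one_of_periodic h.periodic]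
  set g : ℝ → ℝ := fun a => ‖deriv G a‖ ^ 2
  have hg : Continuous g := by
    rw [continuous_iff_continuousAt]
    intro a
    exact (((h.analytic _ (hreal a)).deriv.continuousAt.comp
      (f := fun a : ℝ => (a : ℂ)) (by fun_prop)).norm).pow 2
  have hgper : Function.Periodic g 1 := fun a => by
    simp [g, deriv_add_one_of_periodic h.periodic]
  obtain ⟨a₀, -, ha₀⟩ := (isCompact_Icc (a := (0 : ℝ)) (b := 1)).exists_isMinOn ⟨0, by simp⟩
    hg.continuousOn
  obtain ⟨a₁, -, ha₁⟩ := (isCompact_Icc (a := (0 : ℝ)) (b := 1)).exists_isMaxOn ⟨0, by simp⟩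
    hg.continuousOn
  have hmin : ∀ a, g a₀ ≤ g a := fun a => by
    obtain ⟨b, hb, hab⟩ := hgper.exists_mem_Ico₀ one_pos a
    rw [hab]; exact ha₀ ⟨hb.1, hb.2.le⟩
  have hmax : ∀ a, g a ≤ g a₁ := fun a => by
    obtain ⟨b, hb, hab⟩ := hgper.exists_mem_Ico₀ one_pos a
    rw [hab]; exact ha₁ ⟨hb.1, hb.2.le⟩
  have hpos : 0 < g a₀ := by
    have := norm_pos_iff.2 (h.deriv_ne _ (hreal a₀))
    positivity
  obtain ⟨r₁, hr₁, hP⟩ := exists_strip_of_eventually_diag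
    (P := fun p => ‖conformalFactor G p‖ < g a₁ + 1 ∧ g a₀ / 2 < (conformalFactor G p).re)
    (fun p => by simp only [hper])
    (fun a => by
      have hc := (hm _ (hmem a)).continuousAt
      refine (hc.norm.eventually_lt_const ?_).and
        ((continuous_re.continuousAt.comp hc).eventually_const_lt ?_)
      · simp only
        rw [hdiag, norm_real, Real.norm_of_nonneg (by positivity)]
        linarith [hmax a]
      · simp only [Function.comp_apply, hdiag, ofReal_re]
        linarith [hmin a])
  refine ⟨min r r₁, lt_min h.pos hr₁, min_le_left _ _, g a₀ / 4, g a₁ + 1, by positivity,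
    hm.mono (diagStrip_mono (min_le_left _ _)), fun p hp => ?_, fun p _ => hper p, fun p _ => ?_⟩
  · obtain ⟨h1, h2⟩ := hP p (diagStrip_mono (min_le_right _ _) hp)
    exact ⟨h1.le, by linarith⟩
  · simp only [conformalFactor, map_mul, conj_conj]
    ring

/-! ### The Laplacian in complexified conformal coordinates -/

/-- The standard identification of the Euclidean plane with `ℂ`. -/
noncomputable def planeToComplex : Plane ≃ₗᵢ[ℝ] ℂ := Complex.orthonormalBasisOneI.repr.symm

theorem planeToComplex_single_zero : planeToComplex (EuclideanSpace.single 0 1) = 1 := by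
  simp [planeToComplex]

theorem planeToComplex_single_one : planeToComplex (EuclideanSpace.single 1 1) = I := by
  simp [planeToComplex]

/-- The embedding of the plane in `ℂ × ℂ` as the graph of the conjugation. -/
noncomputable def conjGraph : Plane →L[ℝ] ℂ × ℂ :=
  (planeToComplex.toContinuousLinearEquiv : Plane →L[ℝ] ℂ).prod
    ((conjCLE : ℂ →L[ℝ] ℂ).comp (planeToComplex.toContinuousLinearEquiv : Plane →L[ℝ] ℂ))

theorem conjGraph_apply (x : Plane) :
    conjGraph x = (planeToComplex x, starRingEnd ℂ (planeToComplex x)) := rfl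

theorem AnalyticAt.re_comp_conjGraph {K : ℂ × ℂ → ℂ} {x : Plane}
    (hK : AnalyticAt ℂ K (conjGraph x)) :
    AnalyticAt ℝ (fun y => (K (conjGraph y)).re) x :=
  (reCLM.analyticAt _).comp ((hK.restrictScalars (𝕜 := ℝ)).comp (conjGraph.analyticAt x))

/-- The Laplacian of the restriction of a holomorphic function of two variables to the graph of
the conjugation is four times its mixed derivative. -/
theorem laplacian_re_comp_conjGraph {K K' : ℂ × ℂ → ℂ} {k : ℂ} {x : Plane}
    (hK : AnalyticAt ℂ K (conjGraph x))
    (h1 : ∀ᶠ p in 𝓝 (conjGraph x), HasDerivAt (fun z => K (z, p.2)) (K' p) p.1)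
    (h2 : HasDerivAt (fun w => K' ((conjGraph x).1, w)) k (conjGraph x).2) :
    Laplacian.laplacian (fun y => (K (conjGraph y)).re) x = 4 * k.re := by
  set f : Plane → ℝ := fun y => (K (conjGraph y)).re with hf
  set p := conjGraph x with hp
  have hfx : AnalyticAt ℝ f x := hK.re_comp_conjGraph
  set B := fderiv ℂ (fderiv ℂ K) p with hB
  have hKd : ∀ᶠ q in 𝓝 p, HasFDerivAt K (fderiv ℂ K q) q :=
    hK.eventually_analyticAt.mono fun q hq => hq.differentiableAt.hasFDerivAt
  have hB' : HasFDerivAt (fderiv ℂ K) B p := hK.fderiv.differentiableAt.hasFDerivAt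
  have hsymm : ∀ a b, B a b = B b a := fun a b =>
    (hK.contDiffAt (n := ⊤)).isSymmSndFDerivAt_of_omega a b
  have hsecond : ∀ v, fderiv ℝ (fderiv ℝ f) x v v = (B (conjGraph v) (conjGraph v)).re := by
    intro v
    have e1 : (fun y => fderiv ℝ f y v) =ᶠ[𝓝 x]
        fun y => (fderiv ℂ K (conjGraph y) (conjGraph v)).re := by
      filter_upwards [conjGraph.continuous.continuousAt.eventually hKd] with y hy
      have := (reCLM.hasFDerivAt.comp y ((hy.restrictScalars ℝ).comp y conjGraph.hasFDerivAt))
      rw [show f = reCLM ∘ K ∘ conjGraph from rfl, this.fderiv]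
      simp
    have e2 : HasFDerivAt (fun y => fderiv ℝ f y v)
        ((ContinuousLinearMap.apply ℝ ℝ v).comp (fderiv ℝ (fderiv ℝ f) x)) x :=
      (ContinuousLinearMap.apply ℝ ℝ v).hasFDerivAt.comp x hfx.fderiv.differentiableAt.hasFDerivAt
    let ev : (ℂ × ℂ →L[ℂ] ℂ) →L[ℂ] ℂ := ContinuousLinearMap.apply ℂ ℂ (conjGraph v)
    have e3 : HasFDerivAt (fun y => (fderiv ℂ K (conjGraph y) (conjGraph v)).re)
        (reCLM.comp (((ev.comp B).restrictScalars ℝ).comp conjGraph)) x := by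
      have h3 : HasFDerivAt (fun q => fderiv ℂ K q (conjGraph v)) (ev.comp B) p :=
        ev.hasFDerivAt.comp p hB'
      have h4 : HasFDerivAt (fun y => fderiv ℂ K (conjGraph y) (conjGraph v))
          (((ev.comp B).restrictScalars ℝ).comp conjGraph) x :=
        HasFDerivAt.comp (g := fun q => fderiv ℂ K q (conjGraph v)) x (h3.restrictScalars ℝ)
          conjGraph.hasFDerivAt
      exact reCLM.hasFDerivAt.comp x h4
    have := (e2.congr_of_eventuallyEq e1.symm).unique e3
    have := congrArg (fun L => L v) this
    simpa [ev] using this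
  have hmixed : B (0, 1) (1, 0) = k := by
    have hK' : ∀ᶠ q in 𝓝 p, fderiv ℂ K q (1, 0) = K' q := by
      filter_upwards [h1, hKd] with q hq hq'
      have h3 : HasDerivAt (fun z : ℂ => (z, q.2)) ((1 : ℂ), (0 : ℂ)) q.1 :=
        (hasDerivAt_id q.1).prodMk (hasDerivAt_const q.1 q.2)
      have h4 : HasDerivAt (fun z => K (z, q.2)) (fderiv ℂ K q (1, 0)) q.1 :=
        HasFDerivAt.comp_hasDerivAt (f := fun z : ℂ => (z, q.2)) q.1 hq' h3
      exact h4.unique hq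
    have h3 : HasDerivAt (fun w : ℂ => (p.1, w)) ((0 : ℂ), (1 : ℂ)) p.2 :=
      (hasDerivAt_const p.2 p.1).prodMk (hasDerivAt_id p.2)
    have h4 : HasDerivAt (fun w => fderiv ℂ K (p.1, w)) (B (0, 1)) p.2 :=
      HasFDerivAt.comp_hasDerivAt (f := fun w : ℂ => (p.1, w)) p.2 hB' h3
    have h5 := h4.clm_apply (hasDerivAt_const p.2 ((1 : ℂ), (0 : ℂ)))
    have h6 : (fun w => fderiv ℂ K (p.1, w) (1, 0)) =ᶠ[𝓝 p.2] fun w => K' (p.1, w) :=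
      (show ContinuousAt (fun w : ℂ => (p.1, w)) p.2 by fun_prop).eventually hK'
    have h7 := (h5.congr_of_eventuallyEq h6.symm).unique h2
    simpa using h7
  rw [InnerProductSpace.laplacian_eq_iteratedFDeriv_orthonormalBasis f
    (EuclideanSpace.basisFun (Fin 2) ℝ)]
  simp only [Fin.sum_univ_two, iteratedFDeriv_two_apply, Matrix.cons_val_zero, Matrix.cons_val_one,
    EuclideanSpace.basisFun_apply, hsecond]
  rw [conjGraph_apply, conjGraph_apply, planeToComplex_single_zero, planeToComplex_single_one]
  -- The coordinate vectors of the plane become `(1, 1)` and `(i, -i)`. When the second derivatives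
  -- along them are added, the pure derivatives cancel and the mixed one survives with factor `4`.
  have e0 : ((1 : ℂ), starRingEnd ℂ (1 : ℂ)) = ((1 : ℂ), (0 : ℂ)) + ((0 : ℂ), (1 : ℂ)) := by simp
  have e1 : (I, starRingEnd ℂ I) = I • ((1 : ℂ), (0 : ℂ)) - I • ((0 : ℂ), (1 : ℂ)) := by simp
  rw [e0, e1, ← add_re]
  have hs := hsymm (1, 0) (0, 1)
  rw [hmixed] at hs
  simp only [map_add, map_sub, map_smul, add_apply,
    sub_apply, smul_apply, hmixed, hs, smul_eq_mul]
  rw [show (4 : ℝ) * k.re = ((4 : ℝ) * k : ℂ).re by rw [re_ofReal_mul]]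
  congr 1
  push_cast
  linear_combination (B (1, 0) (1, 0) + B (0, 1) (0, 1) - 2 * k) * I_mul_I

theorem AnalyticAt.conj_conj {g : ℂ → ℂ} {z : ℂ} (hg : AnalyticAt ℂ g z) :
    AnalyticAt ℂ (fun w => starRingEnd ℂ (g (starRingEnd ℂ w))) (starRingEnd ℂ z) := by
  rw [analyticAt_iff_eventually_differentiableAt] at hg ⊢
  have hc : Tendsto (starRingEnd ℂ) (𝓝 (starRingEnd ℂ z)) (𝓝 z) := by
    simpa using continuous_conj.tendsto (starRingEnd ℂ z)
  filter_upwards [hc.eventually hg] with w hw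
  simpa [Function.comp_def] using hw.conj_conj

/-- Analyticity and Laplacian of a function on the plane given in conformal coordinates by a
holomorphic function on the complexification. -/
theorem laplacian_of_conformal {G : ℂ → ℂ} {r : ℝ} (hG : IsConformalStrip G r)
    {ψ ψ' u : ℂ × ℂ → ℂ} (hψ : AnalyticOnNhd ℂ ψ (diagStrip r))
    (h1 : ∀ p ∈ diagStrip r, HasDerivAt (fun z => ψ (z, p.2)) (ψ' p) p.1)
    (h2 : ∀ p ∈ diagStrip r, HasDerivAt (fun w => ψ' (p.1, w)) (u p) p.2) {f : Plane → ℝ}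
    (hf : ∀ z : ℂ, |z.im| < r →
      f (planeToComplex.symm (G z)) = (ψ (z, starRingEnd ℂ z)).re)
    {z : ℂ} (hz : |z.im| < r) :
    AnalyticAt ℝ f (planeToComplex.symm (G z)) ∧
      Laplacian.laplacian f (planeToComplex.symm (G z)) =
        4 * (u (z, starRingEnd ℂ z) / conformalFactor G (z, starRingEnd ℂ z)).re := by
  have hGz := hG.analytic z hz
  have hne := hG.deriv_ne z hz
  set x := planeToComplex.symm (G z) with hx
  have hpx : planeToComplex x = G z := by simp [hx]
  set g := hGz.hasStrictDerivAt.localInverse G _ z hne with hgdef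
  have hga : AnalyticAt ℂ g (G z) := hGz.analyticAt_localInverse hne
  have hgz : g (G z) = z :=
    (hGz.hasStrictDerivAt.hasStrictFDerivAt_equiv hne).localInverse_apply_image
  have hright : ∀ᶠ y in 𝓝 (G z), G (g y) = y :=
    (hGz.hasStrictDerivAt.hasStrictFDerivAt_equiv hne).eventually_right_inverse
  have hzr : ∀ᶠ w in 𝓝 (z : ℂ), |w.im| < r :=
    (continuous_im.abs.tendsto z).eventually_lt_const hz
  have hgr : ∀ᶠ y in 𝓝 (G z), |(g y).im| < r := by
    have := hga.continuousAt.tendsto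
    rw [hgz] at this
    exact this.eventually hzr
  have hga' := hga.conj_conj
  -- With `g` a local inverse of `G` and `g'` its reflection, `(g, g')` maps the graph of
  -- conjugation to itself. Thus `f` is locally the real part of the holomorphic function `ψ (g p.1,
  -- g' p.2)` on that graph, and the chain rule contributes `1 / (G' · conj G')`.
  set g' : ℂ → ℂ := fun w => starRingEnd ℂ (g (starRingEnd ℂ w)) with hg'
  have hg'z : g' (starRingEnd ℂ (G z)) = starRingEnd ℂ z := by simp [hg', hgz]
  set q : ℂ × ℂ := (G z, starRingEnd ℂ (G z)) with hq
  have hqx : conjGraph x = q := by rw [conjGraph_apply, hpx]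
  have hdg : deriv g (G z) = (deriv G z)⁻¹ := by
    have e1 : HasDerivAt g (deriv g (G z)) (G z) := hga.differentiableAt.hasDerivAt
    have e2 : HasDerivAt G (deriv G z) (g (G z)) := by
      rw [hgz]; exact hGz.differentiableAt.hasDerivAt
    have e3 := (e2.comp (G z) e1).congr_of_eventuallyEq (f₁ := fun y => y)
      (hright.mono fun y hy => hy.symm)
    have e4 := e3.unique (hasDerivAt_id (G z))
    exact eq_inv_of_mul_eq_one_right e4
  have hdg' : deriv g' (starRingEnd ℂ (G z)) = starRingEnd ℂ (deriv g (G z)) := by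
    have := (hga.differentiableAt.hasDerivAt).conj_conj.deriv
    simpa [hg', Function.comp_def] using this
  have hzz : (z, starRingEnd ℂ z) ∈ diagStrip r := ⟨hz, by simpa, by simpa using hG.pos⟩
  have hgq : ContinuousAt (fun p : ℂ × ℂ => (g p.1, g' p.2)) q :=
    (hga.continuousAt.comp (f := fun p : ℂ × ℂ => p.1) (x := q) continuousAt_fst).prodMk
      (hga'.continuousAt.comp (f := fun p : ℂ × ℂ => p.2) (x := q) continuousAt_snd)
  have hqval : (g q.1, g' q.2) = (z, starRingEnd ℂ z) := by simp [hq, hgz, hg'z]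
  have hnear : ∀ᶠ p in 𝓝 q, (g p.1, g' p.2) ∈ diagStrip r := by
    refine hgq.eventually ((isOpen_diagStrip r).mem_nhds ?_)
    change (g q.1, g' q.2) ∈ _
    rw [hqval]; exact hzz
  have hK : AnalyticAt ℂ (fun p : ℂ × ℂ => ψ (g p.1, g' p.2)) q := by
    refine AnalyticAt.comp₂ (by rw [hqval]; exact hψ _ hzz) ?_ ?_
    · exact hga.comp (f := fun p : ℂ × ℂ => p.1) (x := q) analyticAt_fst
    · exact hga'.comp (f := fun p : ℂ × ℂ => p.2) (x := q) analyticAt_snd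
  have hfx : f =ᶠ[𝓝 x] fun y => ((fun p : ℂ × ℂ => ψ (g p.1, g' p.2)) (conjGraph y)).re := by
    have hcont : Tendsto planeToComplex (𝓝 x) (𝓝 (G z)) := by
      rw [← hpx]; exact planeToComplex.continuous.tendsto x
    filter_upwards [hcont.eventually hright, hcont.eventually hgr] with y hy hy'
    have := hf _ hy'
    rw [hy, LinearIsometryEquiv.symm_apply_apply] at this
    rw [this, conjGraph_apply]
    simp [hg']
  refine ⟨(AnalyticAt.re_comp_conjGraph (by rw [hqx]; exact hK)).congr hfx.symm, ?_⟩
  rw [InnerProductSpace.laplacian_congr_nhds hfx |>.eq_of_nhds]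
  have hder : ∀ᶠ p in 𝓝 q, HasDerivAt (fun w => ψ (g w, g' p.2))
      (ψ' (g p.1, g' p.2) * deriv g p.1) p.1 := by
    filter_upwards [hnear, (continuousAt_fst (p := q)).eventually hga.eventually_analyticAt]
      with p hp hp'
    exact HasDerivAt.comp (h₂ := fun w => ψ (w, g' p.2)) p.1 (h1 _ hp)
      hp'.differentiableAt.hasDerivAt
  have hk : HasDerivAt (fun w => ψ' (g q.1, g' w) * deriv g q.1)
      (u (z, starRingEnd ℂ z) * deriv g' q.2 * deriv g q.1) q.2 := by
    have e1 : HasDerivAt (fun w => ψ' (z, w)) (u (z, starRingEnd ℂ z)) (g' q.2) := by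
      rw [show g' q.2 = starRingEnd ℂ z from hg'z]
      exact h2 _ hzz
    rw [show g q.1 = z from hgz]
    exact (HasDerivAt.comp (h₂ := fun w => ψ' (z, w)) q.2 e1
      hga'.differentiableAt.hasDerivAt).mul_const _
  rw [← hqx] at hder hk hK
  rw [laplacian_re_comp_conjGraph (K' := fun p => ψ' (g p.1, g' p.2) * deriv g p.1) hK hder hk,
    hqx, hdg', hdg, conformalFactor]
  congr 2
  simp only [Complex.conj_conj, map_inv₀]
  rw [div_eq_mul_inv, mul_inv]
  ring

/-! ### Winding numbers and the two sides of the curve -/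

theorem hasDerivAt_intervalIntegral {U : Set ℂ} (hU : IsOpen U) {h : ℂ → ℝ → ℂ} {h' : ℝ → ℂ}
    {a b : ℝ} (hab : a ≤ b) (hc : ContinuousOn (Function.uncurry h) (U ×ˢ Icc a b))
    (hd : ∀ t ∈ Icc a b, DifferentiableOn ℂ (fun z => h z t) U) {z : ℂ} (hz : z ∈ U)
    (hh' : ∀ t ∈ Icc a b, HasDerivAt (fun w => h w t) (h' t) z) :
    HasDerivAt (fun w => ∫ t in a..b, h w t) (∫ t in a..b, h' t) z := by
  obtain ⟨L, hL⟩ := exists_integral_clm a b hab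
  obtain ⟨F, hF, hFh⟩ := exists_continuousOn_curry (s := U) (h := fun z (t : Icc a b) => h z t)
    (hc.comp (f := fun p : ℂ × Icc a b => (p.1, (p.2 : ℝ))) (by fun_prop)
      fun p hp => ⟨hp.1, p.2.2⟩)
  have hFa := analyticOnNhd_continuousMap hU hF
    fun k => (hd k k.2).congr fun z hz => hFh z hz k
  have hFd := (hFa z hz).differentiableAt.hasDerivAt
  have hF' : ∀ t : Icc a b, deriv F z t = h' t := fun t => by
    have h1 : HasDerivAt (fun w => F w t) (deriv F z t) z :=
      ((ContinuousMap.evalCLM ℂ t : C(Icc a b, ℂ) →L[ℂ] ℂ).hasFDerivAt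
        (x := F z)).comp_hasDerivAt z hFd
    refine h1.unique ((hh' t t.2).congr_of_eventuallyEq ?_)
    filter_upwards [hU.mem_nhds hz] with w hw using hFh w hw t
  rw [← hL _ _ hF']
  refine (L.hasFDerivAt.comp_hasDerivAt z hFd).congr_of_eventuallyEq ?_
  filter_upwards [hU.mem_nhds hz] with w hw using (hL (F w) (h w) (hFh w hw)).symm

namespace IsConformalStrip
variable {G : ℂ → ℂ} {r : ℝ}

theorem abs_im_ofReal_lt (hG : IsConformalStrip G r) (t : ℝ) : |(t : ℂ).im| < r := by
  simpa using hG.pos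

theorem hasDerivAt_ofReal (hG : IsConformalStrip G r) (t : ℝ) :
    HasDerivAt (fun s : ℝ => G s) (deriv G t) t :=
  (hG.analytic _ (hG.abs_im_ofReal_lt t)).differentiableAt.hasDerivAt.comp_ofReal

theorem continuous_curve (hG : IsConformalStrip G r) : Continuous fun s : ℝ => G s :=
  continuous_iff_continuousAt.2 fun t => (hG.hasDerivAt_ofReal t).continuousAt

theorem continuous_deriv_curve (hG : IsConformalStrip G r) :
    Continuous fun s : ℝ => deriv G s :=
  continuous_iff_continuousAt.2 fun t =>
    (hG.analytic _ (hG.abs_im_ofReal_lt t)).deriv.continuousAt.comp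
      (f := fun s : ℝ => (s : ℂ)) (by fun_prop)

theorem periodic_curve (hG : IsConformalStrip G r) : Function.Periodic (fun s : ℝ => G s) 1 :=
  fun s => by simpa using hG.periodic s

theorem isCompact_range (hG : IsConformalStrip G r) : IsCompact (range fun s : ℝ => G s) := by
  have h := hG.periodic_curve.image_Icc one_pos 0
  rw [← h]
  exact isCompact_Icc.image hG.continuous_curve

theorem notMem_range_iff (hG : IsConformalStrip G r) {z : ℂ} (hz : |z.im| < r) :
    G z ∉ range (fun s : ℝ => G s) ↔ z.im ≠ 0 := by
  rw [not_iff_not]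
  constructor
  · rintro ⟨s, hs⟩
    obtain ⟨n, hn⟩ := hG.inj _ _ hz (hG.abs_im_ofReal_lt s) hs.symm
    rw [hn]; simp
  · intro h
    refine ⟨z.re, ?_⟩
    simp only
    congr 1
    exact Complex.ext (by simp) (by simp [h])

end IsConformalStrip

/-- `2 π i` times the winding number about `w` of the curve `G (t)`, `t ∈ ℝ`, of period `1`. -/
noncomputable def windingIntegral (G : ℂ → ℂ) (w : ℂ) : ℂ :=
  ∫ t in (-(1 / 2) : ℝ)..1 / 2, deriv G t * (G t - w)⁻¹

namespace IsConformalStrip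
variable {G : ℂ → ℂ} {r : ℝ}

/-- The derivative of the integrand in `w` is `G' / (G - w)²`, the `t`-derivative of the periodic
function `-(G - w)⁻¹`; its integral over a period vanishes. -/
theorem hasDerivAt_windingIntegral (hG : IsConformalStrip G r) {w : ℂ}
    (hw : w ∈ (range fun s : ℝ => G s)ᶜ) : HasDerivAt (windingIntegral G) 0 w := by
  have hU : IsOpen (range fun s : ℝ => G s)ᶜ := hG.isCompact_range.isClosed.isOpen_compl
  have hne : ∀ z ∈ (range fun s : ℝ => G s)ᶜ, ∀ t : ℝ, G t - z ≠ 0 := fun z hz t h =>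
    hz ⟨t, sub_eq_zero.1 h⟩
  have hc := hG.continuous_curve
  have hc' := hG.continuous_deriv_curve
  have hd : ∀ (t : ℝ), ∀ z ∈ (range fun s : ℝ => G s)ᶜ,
      HasDerivAt (fun z => deriv G t * (G t - z)⁻¹) (deriv G t / (G t - z) ^ 2) z := by
    intro t z hz
    have h1 : HasDerivAt (fun z => G t - z) (-1) z := by
      simpa using (hasDerivAt_id z).const_sub (G t)
    have := (h1.fun_inv (hne z hz t)).const_mul (deriv G t)
    refine this.congr_deriv ?_
    ring
  have key := hasDerivAt_intervalIntegral hU (h := fun z t => deriv G t * (G t - z)⁻¹)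
    (h' := fun t => deriv G t / (G t - w) ^ 2) (a := -(1 / 2)) (b := 1 / 2) (by norm_num)
    (by
      refine ContinuousOn.mul (f := fun p : ℂ × ℝ => deriv G p.2)
        (g := fun p : ℂ × ℝ => (G p.2 - p.1)⁻¹)
        (hc'.comp continuous_snd).continuousOn
        (ContinuousOn.inv₀ ((hc.comp continuous_snd).sub continuous_fst).continuousOn
          fun p hp => hne _ hp.1 _))
    (fun t _ z hz => (hd t z hz).differentiableAt.differentiableWithinAt) hw
    (fun t _ => hd t w hw)
  have hint : ∫ t in (-(1 / 2) : ℝ)..1 / 2, deriv G t / (G t - w) ^ 2 = 0 := by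
    rw [intervalIntegral.integral_eq_sub_of_hasDerivAt (f := fun t : ℝ => -(G t - w)⁻¹)]
    · have h1 := hG.periodic (-(1 / 2))
      rw [show (-(1 / 2) : ℂ) + 1 = 1 / 2 by norm_num] at h1
      push_cast
      rw [h1]; ring
    · intro t _
      have := (((hG.hasDerivAt_ofReal t).sub_const w).fun_inv (hne w hw t)).fun_neg
      refine this.congr_deriv ?_
      ring
    · refine Continuous.intervalIntegrable ?_ _ _
      exact hc'.div ((hc.sub continuous_const).pow 2) fun t => pow_ne_zero 2 (hne w hw t)
  rwa [hint] at key

theorem windingIntegral_eq_of_mem (hG : IsConformalStrip G r) {w w' : ℂ}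
    (hw : w ∈ (range fun s : ℝ => G s)ᶜ)
    (hw' : w' ∈ connectedComponentIn (range fun s : ℝ => G s)ᶜ w) :
    windingIntegral G w' = windingIntegral G w := by
  have hU : IsOpen (range fun s : ℝ => G s)ᶜ := hG.isCompact_range.isClosed.isOpen_compl
  have hd : ∀ z ∈ connectedComponentIn (range fun s : ℝ => G s)ᶜ w,
      HasDerivAt (windingIntegral G) 0 z := fun z hz =>
    hG.hasDerivAt_windingIntegral (connectedComponentIn_subset _ _ hz)
  exact hU.connectedComponentIn.is_const_of_deriv_eq_zero isPreconnected_connectedComponentIn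
    (fun z hz => (hd z hz).differentiableAt.differentiableWithinAt) (fun z hz => (hd z hz).deriv)
    hw' (mem_connectedComponentIn hw)

/-- An unbounded component contains points `w'` arbitrarily far from the curve, where the integral
is arbitrarily small, while it is constant on the component. The distance `L / e + 1` is chosen so
that the bound `L / (L / e + 1)` is below `e`. -/
theorem windingIntegral_eq_zero (hG : IsConformalStrip G r) {w : ℂ}
    (hw : w ∈ (range fun s : ℝ => G s)ᶜ)
    (hunb : ¬ Bornology.IsBounded (connectedComponentIn (range fun s : ℝ => G s)ᶜ w)) :
    windingIntegral G w = 0 := by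
  obtain ⟨R, hR⟩ := hG.isCompact_range.isBounded.exists_norm_le
  obtain ⟨L, hL⟩ := (isCompact_Icc (a := (-(1 / 2) : ℝ)) (b := 1 / 2)).exists_bound_of_continuousOn
    hG.continuous_deriv_curve.continuousOn
  have hL0 : 0 ≤ L := (norm_nonneg _).trans (hL 0 (by norm_num))
  rw [← norm_le_zero_iff]
  refine le_of_forall_pos_le_add fun e he => ?_
  rw [zero_add]
  obtain ⟨w', hw', hlarge⟩ : ∃ w' ∈ connectedComponentIn (range fun s : ℝ => G s)ᶜ w,
      R + (L / e + 1) < ‖w'‖ := by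
    by_contra! hcon
    exact hunb (isBounded_iff_forall_norm_le.2 ⟨_, hcon⟩)
  rw [← hG.windingIntegral_eq_of_mem hw hw']
  have hq : 0 < L / e + 1 := by positivity
  have := intervalIntegral.norm_integral_le_of_norm_le_const (a := (-(1 / 2) : ℝ)) (b := 1 / 2)
    (f := fun t : ℝ => deriv G t * (G t - w')⁻¹) (C := L * (L / e + 1)⁻¹) (by
      intro t ht
      rw [uIoc_of_le (by norm_num)] at ht
      rw [norm_mul, norm_inv]
      have h1 := hL t ⟨ht.1.le, ht.2⟩
      have h2 : L / e + 1 ≤ ‖G t - w'‖ := by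
        have h3 := norm_sub_norm_le w' (G t)
        rw [norm_sub_rev] at h3
        have h4 := hR _ (mem_range_self t)
        linarith
      gcongr)
  refine this.trans ?_
  norm_num
  rw [← div_eq_mul_inv, div_le_iff₀ hq]
  have : L = e * (L / e) := by field_simp
  nlinarith

/-- The divided difference of `G` at `z`, `w`. -/
noncomputable def dividedDifference (G : ℂ → ℂ) (p : ℂ × ℂ) : ℂ :=
  ∫ τ in (0 : ℝ)..1, deriv G (p.1 + τ * (p.2 - p.1))

/-- The divided difference of `w ↦ dividedDifference G (z, w) * (w - z)` to second order. -/
noncomputable def dividedRemainder (G : ℂ → ℂ) (p : ℂ × ℂ) : ℂ :=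
  ∫ τ in (0 : ℝ)..1, (τ : ℂ) * deriv (deriv G) (p.1 + τ * (p.2 - p.1))

theorem segment_mem_strip {z w : ℂ} (hz : |z.im| < r) (hw : |w.im| < r) {τ : ℝ}
    (hτ : τ ∈ Icc (0 : ℝ) 1) : |(z + τ * (w - z)).im| < r := by
  have h1 : (z + τ * (w - z)).im = (1 - τ) * z.im + τ * w.im := by simp; ring
  rw [h1, abs_lt]
  rw [abs_lt] at hz hw
  have h2 := hτ.1
  have h3 := hτ.2
  constructor <;> rcases h2.eq_or_lt with h | h <;> first | (subst h; linarith) | nlinarith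

theorem continuousOn_segment {F : ℂ → ℂ}
    (hF : ∀ z : ℂ, |z.im| < r → ContinuousAt F z) :
    ContinuousOn (Function.uncurry fun (p : ℂ × ℂ) (τ : ℝ) => F (p.1 + τ * (p.2 - p.1)))
      ({p : ℂ × ℂ | |p.1.im| < r ∧ |p.2.im| < r} ×ˢ Icc 0 1) := by
  have hF' : ContinuousOn F {z | |z.im| < r} := fun z hz => (hF z hz).continuousWithinAt
  exact hF'.comp (f := fun q : (ℂ × ℂ) × ℝ => q.1.1 + q.2 * (q.1.2 - q.1.1)) (by fun_prop)
    fun q hq => segment_mem_strip hq.1.1 hq.1.2 hq.2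

theorem continuousOn_dividedDifference (hG : IsConformalStrip G r) :
    ContinuousOn (dividedDifference G) {p : ℂ × ℂ | |p.1.im| < r ∧ |p.2.im| < r} :=
  continuousOn_intervalIntegral zero_le_one
    (continuousOn_segment fun z hz => (hG.analytic z hz).deriv.continuousAt)

theorem continuousOn_dividedRemainder (hG : IsConformalStrip G r) :
    ContinuousOn (dividedRemainder G) {p : ℂ × ℂ | |p.1.im| < r ∧ |p.2.im| < r} :=
  continuousOn_intervalIntegral zero_le_one
    (ContinuousOn.mul (f := fun q : (ℂ × ℂ) × ℝ => (q.2 : ℂ)) (by fun_prop)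
      (continuousOn_segment fun z hz => (hG.analytic z hz).deriv.deriv.continuousAt))

theorem hasDerivAt_segment {F : ℂ → ℂ} {z w : ℂ} {τ : ℝ} {F' : ℂ}
    (hF : HasDerivAt F F' (z + τ * (w - z))) :
    HasDerivAt (fun σ : ℝ => F (z + σ * (w - z))) (F' * (w - z)) τ := by
  have h1 : HasDerivAt (fun σ : ℝ => z + σ * (w - z)) (w - z) τ := by
    simpa using ((ofRealCLM.hasDerivAt (x := τ)).mul_const (w - z)).const_add z
  exact hF.comp τ h1

theorem continuousOn_segment_uIcc {F : ℂ → ℂ}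
    (hF : ∀ z : ℂ, |z.im| < r → ContinuousAt F z) {z w : ℂ} (hz : |z.im| < r) (hw : |w.im| < r) :
    ContinuousOn (fun τ : ℝ => F (z + τ * (w - z))) (uIcc 0 1) := by
  rw [uIcc_of_le zero_le_one]
  exact (continuousOn_segment hF).comp (f := fun τ : ℝ => ((z, w), τ)) (by fun_prop)
    fun τ hτ => ⟨⟨hz, hw⟩, hτ⟩

theorem sub_mul_dividedDifference (hG : IsConformalStrip G r) {z w : ℂ} (hz : |z.im| < r)
    (hw : |w.im| < r) : dividedDifference G (z, w) * (w - z) = G w - G z := by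
  rw [dividedDifference, ← intervalIntegral.integral_mul_const]
  rw [intervalIntegral.integral_eq_sub_of_hasDerivAt (f := fun τ : ℝ => G (z + τ * (w - z)))]
  · simp
  · intro τ hτ
    rw [uIcc_of_le zero_le_one] at hτ
    exact hasDerivAt_segment
      (hG.analytic _ (segment_mem_strip hz hw hτ)).differentiableAt.hasDerivAt
  · exact ((continuousOn_segment_uIcc (fun z hz => (hG.analytic z hz).deriv.continuousAt)
      hz hw).mul continuousOn_const).intervalIntegrable

theorem sub_mul_dividedRemainder (hG : IsConformalStrip G r) {z w : ℂ} (hz : |z.im| < r)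
    (hw : |w.im| < r) :
    dividedRemainder G (z, w) * (w - z) = deriv G w - dividedDifference G (z, w) := by
  have c1 := continuousOn_segment_uIcc (fun z hz => (hG.analytic z hz).deriv.continuousAt)
    hz hw
  have c2 := continuousOn_segment_uIcc (fun z hz => (hG.analytic z hz).deriv.deriv.continuousAt)
    hz hw
  have c3 : ContinuousOn (fun τ : ℝ => (τ : ℂ) * deriv (deriv G) (z + τ * (w - z)) * (w - z))
      (uIcc 0 1) :=
    (ContinuousOn.mul (by fun_prop) c2).mul continuousOn_const
  rw [eq_sub_iff_add_eq, dividedRemainder, dividedDifference,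
    ← intervalIntegral.integral_mul_const, ← intervalIntegral.integral_add c3.intervalIntegrable
    c1.intervalIntegrable]
  rw [intervalIntegral.integral_eq_sub_of_hasDerivAt
    (f := fun τ : ℝ => (τ : ℂ) * deriv G (z + τ * (w - z)))]
  · simp
  · intro τ hτ
    rw [uIcc_of_le zero_le_one] at hτ
    have h1 := hasDerivAt_segment
      (hG.analytic _ (segment_mem_strip hz hw hτ)).deriv.differentiableAt.hasDerivAt
    have h2 := (ofRealCLM.hasDerivAt (x := τ)).fun_mul h1
    refine h2.congr_deriv ?_
    simp only [ofRealCLM_apply, ofReal_one]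
    ring
  · exact (c3.add c1).intervalIntegrable

/-- A zero would give `G t = G (i y)` with `t ≠ i y`, or `G' = 0`. The period is centred at `0`, and
its length excludes every nonzero integer translate. -/
theorem dividedDifference_ne_zero (hG : IsConformalStrip G r) {y t : ℝ} (hy : |y| < r)
    (ht : t ∈ Icc (-(1 / 2) : ℝ) (1 / 2)) : dividedDifference G (y * I, t) ≠ 0 := by
  have hz : |((y : ℂ) * I).im| < r := by simpa using hy
  by_cases h : (t : ℂ) = y * I
  · have h2 : y = 0 := by simpa using (congrArg Complex.im h).symm
    rw [← h, dividedDifference]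
    simpa using hG.deriv_ne _ (hG.abs_im_ofReal_lt t)
  · intro h0
    have h1 := hG.sub_mul_dividedDifference hz (hG.abs_im_ofReal_lt t)
    rw [h0, zero_mul, eq_comm, sub_eq_zero] at h1
    obtain ⟨n, hn⟩ := hG.inj _ _ (hG.abs_im_ofReal_lt t) hz h1
    have hre : t = n := by simpa using congrArg Complex.re hn
    have him : y = 0 := by simpa using (congrArg Complex.im hn).symm
    have hn0 : n = 0 := by
      rw [hre] at ht
      have h1 : (-1 : ℝ) < n := by linarith [ht.1]
      have h2 : (n : ℝ) < 1 := by linarith [ht.2]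
      have h3 : -1 < n := by exact_mod_cast h1
      have h4 : n < 1 := by exact_mod_cast h2
      omega
    apply h
    rw [hre, him, hn0]; simp

theorem add_mul_I_mem_slitPlane (y : ℝ) {t : ℝ} (ht : t ≠ 0) : (y : ℂ) + t * I ∈ slitPlane :=
  Or.inr (by simpa using ht)

/-- The primitive `log (y + i t)` keeps its argument in the right half-plane when `y > 0`, so no
branch cut is crossed. Negative heights are reduced to this case by `t ↦ -t`. -/
theorem integral_inv_sub_mul_I {y : ℝ} (hy : 0 < y) :
    ∫ t in (-(1 / 2) : ℝ)..1 / 2, ((t : ℂ) - y * I)⁻¹ =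
      log (y + (1 / 2 : ℝ) * I) - log (y + (-(1 / 2) : ℝ) * I) := by
  have hne : ∀ t : ℝ, (t : ℂ) - y * I ≠ 0 := fun t h => hy.ne' <| by
    simpa using congrArg Complex.im h
  rw [intervalIntegral.integral_eq_sub_of_hasDerivAt (f := fun t : ℝ => log (y + t * I))]
  · intro t _
    have h1 : HasDerivAt (fun t : ℝ => (y : ℂ) + t * I) I t := by
      simpa using ((ofRealCLM.hasDerivAt (x := t)).mul_const I).const_add (y : ℂ)
    have hs : (y : ℂ) + t * I ∈ slitPlane := Or.inl (by simpa using hy)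
    have h2 := h1.clog_real hs
    refine h2.congr_deriv ?_
    rw [div_eq_iff (slitPlane_ne_zero hs), eq_inv_mul_iff_mul_eq₀ (hne t)]
    linear_combination (-(y : ℂ)) * I_mul_I
  · exact (Continuous.inv₀ (by fun_prop) hne).intervalIntegrable _ _

theorem integral_inv_add_mul_I {y : ℝ} (hy : 0 < y) :
    ∫ t in (-(1 / 2) : ℝ)..1 / 2, ((t : ℂ) - (-y : ℝ) * I)⁻¹ =
      -(log (y + (1 / 2 : ℝ) * I) - log (y + (-(1 / 2) : ℝ) * I)) := by
  rw [← integral_inv_sub_mul_I hy, ← intervalIntegral.integral_neg]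
  have := intervalIntegral.integral_comp_neg (a := (-(1 / 2) : ℝ)) (b := 1 / 2)
    (fun t : ℝ => -((t : ℂ) - y * I)⁻¹)
  rw [neg_neg] at this
  rw [← this]
  refine intervalIntegral.integral_congr fun t _ => ?_
  rw [← inv_neg]
  congr 1
  push_cast
  ring

/-- The winding number about `G (i y)` jumps at `y = 0`. -/
theorem windingIntegral_jump (hG : IsConformalStrip G r)
    (h0 : ∀ z : ℂ, |z.im| < r → z.im ≠ 0 → windingIntegral G (G z) = 0) : False := by
  -- From `G t - G z = D (t - z)` and `G' t = D + R (t - z)` one gets `G' / (G - G z) = 1 / (t - z)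
  -- + R / D`. Here `κ` is the integral of the part continuous in `y`; the integral of `1 / (t - i
  -- y)` carries the jump.
  set κ : ℝ → ℂ := fun y => ∫ t in (-(1 / 2) : ℝ)..1 / 2,
    dividedRemainder G (y * I, t) / dividedDifference G (y * I, t) with hκ
  have hmap : ContinuousOn (fun q : ℝ × ℝ => ((q.1 : ℂ) * I, (q.2 : ℂ)))
      ({y : ℝ | |y| < r} ×ˢ Icc (-(1 / 2)) (1 / 2)) := by fun_prop
  have hmaps : MapsTo (fun q : ℝ × ℝ => ((q.1 : ℂ) * I, (q.2 : ℂ)))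
      ({y : ℝ | |y| < r} ×ˢ Icc (-(1 / 2)) (1 / 2))
      {p : ℂ × ℂ | |p.1.im| < r ∧ |p.2.im| < r} := fun q hq =>
    ⟨by simpa using hq.1, hG.abs_im_ofReal_lt _⟩
  have hquot : ContinuousOn (Function.uncurry fun (y t : ℝ) =>
      dividedRemainder G (y * I, t) / dividedDifference G (y * I, t))
      ({y : ℝ | |y| < r} ×ˢ Icc (-(1 / 2)) (1 / 2)) :=
    (hG.continuousOn_dividedRemainder.comp hmap hmaps).div
      (hG.continuousOn_dividedDifference.comp hmap hmaps)
      fun q hq => hG.dividedDifference_ne_zero hq.1 hq.2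
  have hκc : ContinuousOn κ {y : ℝ | |y| < r} :=
    continuousOn_intervalIntegral (by norm_num) hquot
  have hopen : IsOpen {y : ℝ | |y| < r} := isOpen_lt continuous_abs continuous_const
  have hκ0 : ContinuousAt κ 0 := hκc.continuousAt (hopen.mem_nhds (by simpa using hG.pos))
  have hsplit : ∀ y : ℝ, |y| < r → y ≠ 0 →
      κ y = -∫ t in (-(1 / 2) : ℝ)..1 / 2, ((t : ℂ) - y * I)⁻¹ := by
    intro y hy hy0
    have hz : |((y : ℂ) * I).im| < r := by simpa using hy
    have hN := h0 _ hz (by simpa using hy0)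
    have hne : ∀ t : ℝ, (t : ℂ) - y * I ≠ 0 := fun t h => hy0 <| by
      simpa using congrArg Complex.im h
    rw [eq_neg_iff_add_eq_zero, ← hN, windingIntegral, hκ]
    simp only
    rw [← intervalIntegral.integral_add]
    · refine intervalIntegral.integral_congr fun t ht => ?_
      rw [uIcc_of_le (by norm_num)] at ht
      have hq := hG.dividedDifference_ne_zero hy ht
      have e1 := hG.sub_mul_dividedDifference hz (hG.abs_im_ofReal_lt t)
      have e2 := hG.sub_mul_dividedRemainder hz (hG.abs_im_ofReal_lt t)
      have hn := hne t
      rw [← e1, sub_eq_iff_eq_add.1 e2.symm]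
      field_simp
    · refine ContinuousOn.intervalIntegrable ?_
      rw [uIcc_of_le (by norm_num)]
      exact hquot.comp (f := fun t : ℝ => (y, t)) (by fun_prop) fun t ht => ⟨hy, ht⟩
    · exact (Continuous.inv₀ (by fun_prop) hne).intervalIntegrable _ _
  set J : ℝ → ℂ := fun y => log (y + (1 / 2 : ℝ) * I) - log (y + (-(1 / 2) : ℝ) * I)
  have hJ : ContinuousAt J 0 := by
    refine ContinuousAt.sub (ContinuousAt.clog (by fun_prop) ?_)
      (ContinuousAt.clog (by fun_prop) ?_)
    · exact add_mul_I_mem_slitPlane 0 (by norm_num)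
    · exact add_mul_I_mem_slitPlane 0 (by norm_num)
  have hsmall : ∀ᶠ y : ℝ in 𝓝[>] 0, 0 < y ∧ |y| < r := by
    filter_upwards [self_mem_nhdsWithin,
      mem_nhdsWithin_of_mem_nhds (hopen.mem_nhds (by simpa using hG.pos))] with y h1 h2
    exact ⟨h1, h2⟩
  have l1 : κ 0 = -J 0 := by
    refine tendsto_nhds_unique (hκ0.tendsto.mono_left nhdsWithin_le_nhds)
      ((hJ.neg.tendsto.mono_left (nhdsWithin_le_nhds (s := Ioi 0))).congr' ?_)
    filter_upwards [hsmall] with y hy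
    simp only [Pi.neg_apply]
    rw [hsplit y hy.2 hy.1.ne', integral_inv_sub_mul_I hy.1]
  have l2 : κ 0 = J 0 := by
    have hκneg : Tendsto (fun y : ℝ => κ (-y)) (𝓝 0) (𝓝 (κ 0)) := by
      have : Tendsto (fun y : ℝ => -y) (𝓝 0) (𝓝 0) := by simpa using (continuous_neg.tendsto (0 : ℝ))
      exact hκ0.tendsto.comp this
    refine tendsto_nhds_unique (hκneg.mono_left nhdsWithin_le_nhds)
      ((hJ.tendsto.mono_left (nhdsWithin_le_nhds (s := Ioi 0))).congr' ?_)
    filter_upwards [hsmall] with y hy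
    rw [hsplit (-y) (by rw [abs_neg]; exact hy.2) (neg_ne_zero.2 hy.1.ne'),
      integral_inv_add_mul_I hy.1, neg_neg]
  -- The one-sided limits would give `κ 0 = -J 0` and `κ 0 = J 0`. But `J 0` is the difference of
  -- the logarithms of `i / 2` and `-i / 2`, which are distinct.
  have hJ0 : J 0 = 0 := by
    have : J 0 + J 0 = 0 := by
      nth_rewrite 1 [← l2]; rw [l1]; ring
    exact add_self_eq_zero.1 this
  simp only [J, sub_eq_zero] at hJ0
  have := congrArg exp hJ0
  rw [exp_log (slitPlane_ne_zero (add_mul_I_mem_slitPlane 0 (by norm_num))),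
    exp_log (slitPlane_ne_zero (add_mul_I_mem_slitPlane 0 (by norm_num)))] at this
  have := congrArg Complex.im this
  norm_num at this

theorem connectedComponentIn_eq_of_side (hG : IsConformalStrip G r) {S : Set ℂ}
    (hS : Convex ℝ S) (hSr : ∀ z ∈ S, |z.im| < r ∧ z.im ≠ 0) {z w : ℂ} (hz : z ∈ S) (hw : w ∈ S) :
    connectedComponentIn (range fun s : ℝ => G s)ᶜ (G z) =
      connectedComponentIn (range fun s : ℝ => G s)ᶜ (G w) := by
  have h1 : IsPreconnected (G '' S) := hS.isPreconnected.image G fun x hx =>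
    (hG.analytic x (hSr x hx).1).continuousAt.continuousWithinAt
  have h2 : G '' S ⊆ (range fun s : ℝ => G s)ᶜ := by
    rintro _ ⟨x, hx, rfl⟩
    exact (hG.notMem_range_iff (hSr x hx).1).2 (hSr x hx).2
  exact connectedComponentIn_eq
    (h1.subset_connectedComponentIn (mem_image_of_mem G hz) h2 (mem_image_of_mem G hw))

/-- Such a component is open, nonempty and not the whole plane, so it has a frontier point. This
point must lie on the curve, since otherwise its own component would meet the given one; and the
strip is a neighborhood of the curve. Consequently the complement has no components besides those of
the two sides. -/
theorem exists_mem_connectedComponentIn (hG : IsConformalStrip G r) {w : ℂ}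
    (hw : w ∈ (range fun s : ℝ => G s)ᶜ) : ∃ z : ℂ, |z.im| < r ∧ z.im ≠ 0 ∧
      G z ∈ connectedComponentIn (range fun s : ℝ => G s)ᶜ w := by
  set Γ := range fun s : ℝ => G s
  set C := connectedComponentIn Γᶜ w with hC
  have hU : IsOpen Γᶜ := hG.isCompact_range.isClosed.isOpen_compl
  have hCo : IsOpen C := hU.connectedComponentIn
  have hCne : C.Nonempty := ⟨w, mem_connectedComponentIn hw⟩
  have hCuniv : C ≠ univ := fun h => by
    have : G (0 : ℝ) ∈ C := h ▸ mem_univ _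
    exact connectedComponentIn_subset _ _ this ⟨0, rfl⟩
  obtain ⟨x, hx⟩ := nonempty_frontier_iff.2 ⟨hCne, hCuniv⟩
  rw [hCo.frontier_eq] at hx
  have hxΓ : x ∈ Γ := by
    by_contra hxΓ
    have hxo : connectedComponentIn Γᶜ x ∈ 𝓝 x :=
      hU.connectedComponentIn.mem_nhds (mem_connectedComponentIn hxΓ)
    obtain ⟨y, hy1, hy2⟩ := mem_closure_iff_nhds.1 hx.1 _ hxo
    have e1 := connectedComponentIn_eq hy1
    have e2 := connectedComponentIn_eq hy2
    apply hx.2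
    rw [hC, e2, ← e1]
    exact mem_connectedComponentIn hxΓ
  obtain ⟨s, rfl⟩ := hxΓ
  have hs := hG.abs_im_ofReal_lt s
  have hmap := (hG.analytic _ hs).hasStrictDerivAt.map_nhds_eq (hG.deriv_ne _ hs)
  have hnear : G '' {z | |z.im| < r} ∈ 𝓝 (G s) := by
    rw [← hmap]
    exact image_mem_map ((isOpen_lt continuous_im.abs continuous_const).mem_nhds hs)
  obtain ⟨_, ⟨z, hz, rfl⟩, hy2⟩ := mem_closure_iff_nhds.1 hx.1 _ hnear
  exact ⟨z, hz, (hG.notMem_range_iff hz).1 (connectedComponentIn_subset _ _ hy2), hy2⟩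

/-- A curve with a conformal strip separates the plane into a bounded side and an unbounded
side. -/
theorem bounded_side (hG : IsConformalStrip G r) : ∃ ε : ℝ, (ε = 1 ∨ ε = -1) ∧
    ∀ z : ℂ, |z.im| < r → z.im ≠ 0 →
      (Bornology.IsBounded (connectedComponentIn (range fun s : ℝ => G s)ᶜ (G z)) ↔
        0 < ε * z.im) := by
  set Γ := range fun s : ℝ => G s
  have hup : Convex ℝ {z : ℂ | 0 < z.im ∧ z.im < r} :=
    (convex_halfSpace_im_gt 0).inter (convex_halfSpace_im_lt r)
  have hdown : Convex ℝ {z : ℂ | -r < z.im ∧ z.im < 0} :=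
    (convex_halfSpace_im_gt (-r)).inter (convex_halfSpace_im_lt 0)
  have hr := hG.pos
  set z₁ : ℂ := ((r / 2 : ℝ) : ℂ) * I
  set z₂ : ℂ := ((-(r / 2) : ℝ) : ℂ) * I
  have hz₁ : z₁.im = r / 2 := by simp only [z₁, im_ofReal_mul, I_im, mul_one]
  have hz₂ : z₂.im = -(r / 2) := by simp only [z₂, im_ofReal_mul, I_im, mul_one]
  have e₁ : ∀ z : ℂ, |z.im| < r → 0 < z.im →
      connectedComponentIn Γᶜ (G z) = connectedComponentIn Γᶜ (G z₁) := fun z hz hz0 =>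
    hG.connectedComponentIn_eq_of_side hup
      (fun x hx => ⟨abs_lt.2 ⟨by linarith [hx.1], hx.2⟩, hx.1.ne'⟩)
      ⟨hz0, (abs_lt.1 hz).2⟩ ⟨by linarith, by linarith⟩
  have e₂ : ∀ z : ℂ, |z.im| < r → z.im < 0 →
      connectedComponentIn Γᶜ (G z) = connectedComponentIn Γᶜ (G z₂) := fun z hz hz0 =>
    hG.connectedComponentIn_eq_of_side hdown
      (fun x hx => ⟨abs_lt.2 ⟨hx.1, by linarith [hx.2]⟩, hx.2.ne⟩)
      ⟨(abs_lt.1 hz).1, hz0⟩ ⟨by linarith, by linarith⟩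
  -- If both were bounded, the plane would be a union of three bounded sets.
  have hnb : ¬ (Bornology.IsBounded (connectedComponentIn Γᶜ (G z₁)) ∧
      Bornology.IsBounded (connectedComponentIn Γᶜ (G z₂))) := by
    rintro ⟨h1, h2⟩
    have huniv : (univ : Set ℂ) ⊆
        Γ ∪ (connectedComponentIn Γᶜ (G z₁) ∪ connectedComponentIn Γᶜ (G z₂)) := by
      intro w _
      by_cases hw : w ∈ Γ
      · exact Or.inl hw
      · right
        obtain ⟨z, hz, hz0, hzw⟩ := hG.exists_mem_connectedComponentIn hw
        have hw' : w ∈ connectedComponentIn Γᶜ (G z) := by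
          rw [← connectedComponentIn_eq hzw]
          exact mem_connectedComponentIn hw
        rcases hz0.lt_or_gt with h | h
        · exact Or.inr (e₂ z hz h ▸ hw')
        · exact Or.inl (e₁ z hz h ▸ hw')
    have := (hG.isCompact_range.isBounded.union (h1.union h2)).subset huniv
    exact NormedSpace.unbounded_univ ℂ ℂ this
  -- If both were unbounded, the winding integral would vanish on both sides, contrary to its jump.
  have hnu : Bornology.IsBounded (connectedComponentIn Γᶜ (G z₁)) ∨
      Bornology.IsBounded (connectedComponentIn Γᶜ (G z₂)) := by
    by_contra! hcon
    refine hG.windingIntegral_jump fun z hz hz0 => ?_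
    have hzΓ := (hG.notMem_range_iff hz).2 hz0
    refine hG.windingIntegral_eq_zero hzΓ ?_
    rcases hz0.lt_or_gt with h | h
    · rw [e₂ z hz h]; exact hcon.2
    · rw [e₁ z hz h]; exact hcon.1
  by_cases h1 : Bornology.IsBounded (connectedComponentIn Γᶜ (G z₁))
  · have h2 := fun h => hnb ⟨h1, h⟩
    refine ⟨1, Or.inl rfl, fun z hz hz0 => ?_⟩
    rw [one_mul]
    rcases hz0.lt_or_gt with h | h
    · rw [e₂ z hz h]
      exact ⟨fun h' => absurd h' h2, fun h' => absurd h' h.not_gt⟩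
    · rw [e₁ z hz h]
      exact ⟨fun _ => h, fun _ => h1⟩
  · have h2 := hnu.resolve_left h1
    refine ⟨-1, Or.inr rfl, fun z hz hz0 => ?_⟩
    rw [neg_one_mul, neg_pos]
    rcases hz0.lt_or_gt with h | h
    · rw [e₂ z hz h]
      exact ⟨fun _ => h, fun _ => h2⟩
    · rw [e₁ z hz h]
      exact ⟨fun h' => absurd h' h1, fun h' => absurd h' h.not_gt⟩

theorem jordan_side (hG : IsConformalStrip G r) {γ : ℝ → Plane}
    (hγ : ∀ s : ℝ, planeToComplex (γ s) = G s) : ∃ ε : ℝ, (ε = 1 ∨ ε = -1) ∧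
    ∀ z : ℂ, |z.im| < r →
      (planeToComplex.symm (G z) ∈ jordanInterior (range γ) → 0 < ε * z.im) ∧
      (planeToComplex.symm (G z) ∈ jordanExterior (range γ) → ε * z.im < 0) := by
  obtain ⟨ε, hε, h⟩ := hG.bounded_side
  have hrange : planeToComplex.symm '' (range fun s : ℝ => G s) = range γ := by
    rw [← range_comp]
    congr 1
    funext s
    simp [← hγ]
  have hcompl : planeToComplex.symm '' (range fun s : ℝ => G s)ᶜ = (range γ)ᶜ := by
    rw [image_compl_eq planeToComplex.symm.bijective, hrange]
  have hmem : ∀ z : ℂ, |z.im| < r → planeToComplex.symm (G z) ∈ (range γ)ᶜ → z.im ≠ 0 := by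
    intro z hz hzγ
    rw [← hcompl, planeToComplex.symm.injective.mem_set_image] at hzγ
    exact (hG.notMem_range_iff hz).1 hzγ
  have hb : ∀ z : ℂ, |z.im| < r → z.im ≠ 0 →
      (Bornology.IsBounded (connectedComponentIn (range γ)ᶜ (planeToComplex.symm (G z))) ↔
        0 < ε * z.im) := by
    intro z hz hz0
    rw [← h z hz hz0]
    have := planeToComplex.symm.toHomeomorph.image_connectedComponentIn
      (show G z ∈ (range fun s : ℝ => G s)ᶜ from (hG.notMem_range_iff hz).2 hz0)
    change planeToComplex.symm '' _ =
      connectedComponentIn (planeToComplex.symm '' _) (planeToComplex.symm (G z)) at this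
    rw [hcompl] at this
    rw [← this]
    constructor
    · intro hbd
      have h1 := planeToComplex.lipschitz.isBounded_image hbd
      rw [← image_comp] at h1
      simpa using h1
    · exact fun hbd => planeToComplex.symm.lipschitz.isBounded_image hbd
  refine ⟨ε, hε, fun z hz => ⟨fun hx => ?_, fun hx => ?_⟩⟩
  · exact (hb z hz (hmem z hz hx.1)).1 hx.2
  · have hz0 := hmem z hz hx.1
    have h1 := mt (hb z hz hz0).2 hx.2
    refine lt_of_le_of_ne (not_lt.1 h1) (mul_ne_zero ?_ hz0)
    rcases hε with rfl | rfl <;> norm_num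

end IsConformalStrip

/-! ### The local solution on the plane -/

theorem IsAnalyticJordanCurve.deriv_planeToComplex {γ : ℝ → Plane} (hγ : IsAnalyticJordanCurve γ)
    (s : ℝ) : deriv (fun s => planeToComplex (γ s)) s = planeToComplex (deriv γ s) :=
  ((planeToComplex.toContinuousLinearEquiv : Plane →L[ℝ] ℂ).hasFDerivAt.comp_hasDerivAt s
    (hγ.analytic s (mem_univ s)).differentiableAt.hasDerivAt).deriv

/-- Conformal coordinates `z` near the curve `γ`, with `γ = {Im z = 0}`, and a function
`f = (Im z)² V` on the plane with `Δ f = 2 + ε (Im z)⁵ V^{5/2}`, where `ε (Im z) > 0` in the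
interior of `γ` and `ε (Im z) < 0` in its exterior. -/
structure IsLocalSolution (γ : ℝ → Plane) (G : ℂ → ℂ) (r c ε : ℝ) (V : ℂ → ℝ) (f : Plane → ℝ) :
    Prop where
  strip : IsConformalStrip G r
  curve : ∀ s : ℝ, planeToComplex (γ s) = G s
  sign : ε = 1 ∨ ε = -1
  side : ∀ z : ℂ, |z.im| < r →
      (planeToComplex.symm (G z) ∈ jordanInterior (range γ) → 0 < ε * z.im) ∧
      (planeToComplex.symm (G z) ∈ jordanExterior (range γ) → ε * z.im < 0)
  pos : 0 < c
  le : ∀ z : ℂ, c ≤ V z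
  periodic : ∀ z : ℂ, V (z + 1) = V z
  analytic : ∀ z : ℂ, |z.im| < r → AnalyticAt ℝ V z
  eq : ∀ z : ℂ, |z.im| < r → f (planeToComplex.symm (G z)) = z.im ^ 2 * V z
  analyticAt : ∀ z : ℂ, |z.im| < r → AnalyticAt ℝ f (planeToComplex.symm (G z))
  laplacian : ∀ z : ℂ, |z.im| < r → Laplacian.laplacian f (planeToComplex.symm (G z)) =
    2 + ε * z.im ^ 5 * V z ^ (5 / 2 : ℝ)

theorem exists_isLocalSolution {γ : ℝ → Plane} (hγ : IsAnalyticJordanCurve γ) :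
    ∃ G r c ε V f, IsLocalSolution γ G r c ε V f := by
  set γc : ℝ → ℂ := fun s => planeToComplex (γ s) with hγc
  have ha : AnalyticOnNhd ℝ γc univ := fun s hs =>
    ((planeToComplex.toContinuousLinearEquiv : Plane →L[ℝ] ℂ).analyticAt _).comp
      (hγ.analytic s hs)
  have hp : Function.Periodic γc 1 := fun s => by simp [hγc, hγ.periodic s]
  have hi : InjOn γc (Ico 0 1) := planeToComplex.injective.comp_injOn hγ.injOn
  have hd : ∀ s, deriv γc s ≠ 0 := fun s => by
    rw [hγ.deriv_planeToComplex]
    simpa using hγ.regular s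
  obtain ⟨r₀, hG₀⟩ := exists_isConformalStrip ha hp hi hd
  set G := holomorphicExtension γc
  have hGγ : ∀ s : ℝ, planeToComplex (γ s) = G s := fun s =>
    (holomorphicExtension_ofReal γc s).symm
  obtain ⟨ε, hε, hside⟩ := hG₀.jordan_side hGγ
  obtain ⟨r₁, hr₁, hr₁₀, c, M, hc, hm⟩ := hG₀.exists_isPicardAdmissible
  obtain ⟨r, hr, hrr₁, v, ψ, ψ', hv, hψ, h1, h2, h3⟩ := exists_complexified_solution (ε := ε)
    hc hr₁ hm (by rcases hε with rfl | rfl <;> norm_num)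
  have hG := hG₀.mono hr (hrr₁.trans hr₁₀)
  have hmem : ∀ z : ℂ, |z.im| < r → (z, starRingEnd ℂ z) ∈ diagStrip r := fun z hz =>
    ⟨hz, by simpa, by simpa using hr⟩
  -- The default value `c` makes the lower bound and the periodicity hold on all of `ℂ`.
  set V : ℂ → ℝ := fun z => if |z.im| < r then (v (z, starRingEnd ℂ z)).re else c with hV
  have hVz : ∀ z : ℂ, |z.im| < r → V z = (v (z, starRingEnd ℂ z)).re := fun z hz => by
    simp only [hV, if_pos hz]
  have hle : ∀ z, c ≤ V z := fun z => by
    by_cases hz : |z.im| < r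
    · rw [hVz z hz]; exact (hv.mem _ (hmem z hz)).2
    · simp only [hV, if_neg hz]; exact le_rfl
  have hper : ∀ z, V (z + 1) = V z := fun z => by
    have him : (z + 1).im = z.im := by simp
    by_cases hz : |z.im| < r
    · have := hv.periodic _ (hmem z hz)
      rw [hVz z hz, hVz _ (by rwa [him]), ← this]
      simp
    · simp only [hV, him, if_neg hz]
  classical
  -- Two preimages of a point differ by an integer, which changes neither `Im z` nor `V`; the choice
  -- is harmless.
  set f : Plane → ℝ := fun x =>
    if h : ∃ z : ℂ, |z.im| < r ∧ planeToComplex.symm (G z) = x then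
      h.choose.im ^ 2 * V h.choose else 0 with hf
  have hfz : ∀ z : ℂ, |z.im| < r → f (planeToComplex.symm (G z)) = z.im ^ 2 * V z := by
    intro z hz
    have h : ∃ w : ℂ, |w.im| < r ∧ planeToComplex.symm (G w) = planeToComplex.symm (G z) :=
      ⟨z, hz, rfl⟩
    obtain ⟨n, hn⟩ := hG.inj _ _ h.choose_spec.1 hz (planeToComplex.symm.injective h.choose_spec.2)
    simp only [hf, dif_pos h]
    rw [hn]
    have : V (z + n) = V z := by
      have := Function.Periodic.sub_zsmul_eq (f := V) (c := 1) hper (x := z) (-n)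
      simpa using this
    rw [this]
    simp
  have hfψ : ∀ z : ℂ, |z.im| < r →
      f (planeToComplex.symm (G z)) = (ψ (z, starRingEnd ℂ z)).re := fun z hz => by
    rw [hfz z hz, h3 z hz, hVz z hz]
  have hlap := fun z hz => laplacian_of_conformal hG hψ h1 h2 hfψ (z := z) hz
  refine ⟨G, r, c, ε, V, f, hG, hGγ, hε,
    fun z hz => hside z (hz.trans_le (hrr₁.trans hr₁₀)), hc, hle, hper, fun z hz => ?_, hfz,
    fun z hz => (hlap z hz).1, fun z hz => ?_⟩
  · have hx : conjGraph (planeToComplex.symm z) = (z, starRingEnd ℂ z) := by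
      simp [conjGraph_apply]
    have h4 : AnalyticAt ℝ (fun y => (v (conjGraph y)).re) (planeToComplex.symm z) :=
      AnalyticAt.re_comp_conjGraph (by rw [hx]; exact hv.analytic _ (hmem z hz))
    have h5 := h4.comp
      ((planeToComplex.symm.toContinuousLinearEquiv : ℂ →L[ℝ] Plane).analyticAt z)
    refine h5.congr ?_
    filter_upwards [(isOpen_lt continuous_im.abs continuous_const).mem_nhds hz] with w hw
    rw [hVz w hw]
    simp [conjGraph_apply]
  · rw [(hlap z hz).2]
    have hm0 : conformalFactor G (z, starRingEnd ℂ z) ≠ 0 := by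
      simpa [conformalFactor] using hG.deriv_ne z hz
    -- The reflection symmetry makes `v` real on the graph of conjugation, so its complex power
    -- there is the real power appearing in the equation.
    have hreal : v (z, starRingEnd ℂ z) = ((V z : ℝ) : ℂ) := by
      have := hv.symm _ (hmem z hz)
      rw [conj_conj] at this
      rw [hVz z hz]
      exact (conj_eq_iff_re.1 this.symm).symm
    have hVpos : 0 ≤ V z := hc.le.trans (hle z)
    have hy : (z - starRingEnd ℂ z) / (2 * I) = (z.im : ℂ) := by
      rw [sub_conj]
      field_simp
      push_cast
      ring
    rw [sourceTerm, hreal, ← ofReal_cpow hVpos, hy]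
    have e : (1 / 4 * conformalFactor G (z, starRingEnd ℂ z) *
        (2 + (ε : ℂ) * (z.im : ℂ) ^ 5 * ((V z ^ (5 / 2 : ℝ) : ℝ) : ℂ))) /
        conformalFactor G (z, starRingEnd ℂ z) =
        ((1 / 4 * (2 + ε * z.im ^ 5 * V z ^ (5 / 2 : ℝ)) : ℝ) : ℂ) := by
      field_simp
      push_cast
      ring
    rw [e, ofReal_re]
    ring

/-! ### Level sets of the solution and the tubular neighborhood -/

theorem analyticAt_sqrt_comp {E : Type*} [NormedAddCommGroup E] [NormedSpace ℝ E] {V : E → ℝ}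
    {x : E} (hV : AnalyticAt ℝ V x) (hpos : ∀ y, 0 < V y) :
    AnalyticAt ℝ (fun y => √(V y)) x := by
  have hlog : AnalyticAt ℝ (fun a : ℝ => Real.exp (Real.log a / 2)) (V x) :=
    ((analyticAt_id.log (hpos x)).div_const).rexp
  refine (hlog.comp hV).congr (Eventually.of_forall fun y => ?_)
  simp only [Function.comp_apply]
  rw [← Real.log_sqrt (hpos y).le, Real.exp_log (Real.sqrt_pos.2 (hpos y))]

/-- The map `(s, y) ↦ s + i y` for a function `y` of `(s, t)`. -/
noncomputable def graphPoint (Y : ℝ × ℝ → ℝ) (q : ℝ × ℝ) : ℂ := q.1 + Y q * I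

theorem graphPoint_re (Y : ℝ × ℝ → ℝ) (q : ℝ × ℝ) : (graphPoint Y q).re = q.1 := by
  simp [graphPoint]

theorem graphPoint_im (Y : ℝ × ℝ → ℝ) (q : ℝ × ℝ) : (graphPoint Y q).im = Y q := by
  simp [graphPoint]

theorem AnalyticAt.graphPoint {Y : ℝ × ℝ → ℝ} {q : ℝ × ℝ} (hY : AnalyticAt ℝ Y q) :
    AnalyticAt ℝ (graphPoint Y) q :=
  ((ofRealCLM.analyticAt _).comp analyticAt_fst).add
    (((ofRealCLM.analyticAt _).comp hY).mul analyticAt_const)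

/-- The function `Im z √V` is, on each vertical segment near the real line, a coordinate; its
level `κ t` is the graph of `Y (·, t)`. -/
theorem exists_level_coordinate {r c : ℝ} {V : ℂ → ℝ} (hr : 0 < r) (hc : 0 < c)
    (hle : ∀ z, c ≤ V z) (hper : ∀ z, V (z + 1) = V z)
    (hV : ∀ z : ℂ, |z.im| < r → AnalyticAt ℝ V z) :
    ∃ κ > 0, ∃ Y : ℝ × ℝ → ℝ, (∀ s, ∀ t ∈ Icc (-1 : ℝ) 1, AnalyticAt ℝ Y (s, t)) ∧
      (∀ s t, Y (s + 1, t) = Y (s, t)) ∧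
      (∀ s, ∀ t ∈ Icc (-1 : ℝ) 1, |Y (s, t)| < r) ∧
      (∀ s, ∀ t ∈ Icc (-1 : ℝ) 1, ∀ᶠ q in 𝓝 (s, t),
        Y q * √(V (graphPoint Y q)) = κ * q.2) := by
  have hVpos : ∀ z, 0 < V z := fun z => hc.trans_le (hle z)
  set W : ℂ → ℝ := fun z => z.im * √(V z) with hW
  have hWa : ∀ z : ℂ, |z.im| < r → AnalyticAt ℝ W z := fun z hz =>
    (imCLM.analyticAt z).mul (analyticAt_sqrt_comp (hV z hz) hVpos)
  have hWper : ∀ z, W (z + 1) = W z := fun z => by simp [hW, hper]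
  have hreal : ∀ a : ℝ, |(a : ℂ).im| < r := fun a => by simpa using hr
  -- On the real line `∂_y W = √V > 0`. By periodicity and compactness the sign persists on a strip,
  -- where `W` is therefore strictly increasing along vertical segments.
  have hW' : ∀ a : ℝ, fderiv ℝ W a I = √(V a) := fun a => by
    have h1 := (analyticAt_sqrt_comp (hV a (hreal a)) hVpos).differentiableAt.hasFDerivAt
    have h2 : HasFDerivAt W _ (a : ℂ) := imCLM.hasFDerivAt.mul h1
    rw [h2.fderiv]
    simp
  obtain ⟨r', hr', hD⟩ := exists_strip_of_eventually_single (P := fun z => 0 < fderiv ℝ W z I)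
    (fun z => by
      have h1 : fderiv ℝ W (z + 1) = fderiv ℝ W z := by
        rw [← fderiv_comp_add_right]
        simp only [hWper]
      rw [h1])
    (fun a => by
      have h1 : ContinuousAt (fun z => fderiv ℝ W z I) (a : ℂ) :=
        ((ContinuousLinearMap.apply ℝ ℝ I).continuous.continuousAt).comp
          (hWa a (hreal a)).fderiv.continuousAt
      refine h1.eventually_const_lt ?_
      simp only [hW']
      exact Real.sqrt_pos.2 (hVpos a))
  set ρ := min r r' with hρ
  have hρpos : 0 < ρ := lt_min hr hr'
  have hvert : ∀ s y : ℝ, |y| < ρ → HasDerivAt (fun y : ℝ => W (s + y * I))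
      (fderiv ℝ W (s + y * I) I) y := by
    intro s y hy
    have h1 : HasDerivAt (fun y : ℝ => (s : ℂ) + y * I) I y := by
      simpa using ((ofRealCLM.hasDerivAt (x := y)).mul_const I).const_add (s : ℂ)
    have h2 := (hWa (s + y * I) (by simpa using hy.trans_le (min_le_left _ _))).differentiableAt
    exact h2.hasFDerivAt.comp_hasDerivAt y h1
  have hconv : Convex ℝ {y : ℝ | |y| < ρ} := by
    have : {y : ℝ | |y| < ρ} = Metric.ball 0 ρ := by ext; simp
    rw [this]; exact convex_ball _ _
  have hopen : IsOpen {y : ℝ | |y| < ρ} := isOpen_lt continuous_abs continuous_const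
  have hmono : ∀ s : ℝ, StrictMonoOn (fun y : ℝ => W (s + y * I)) {y : ℝ | |y| < ρ} := by
    intro s
    refine strictMonoOn_of_deriv_pos hconv
      (fun y hy => (hvert s y hy).continuousAt.continuousWithinAt) ?_
    intro y hy
    rw [hopen.interior_eq] at hy
    rw [(hvert s y hy).deriv]
    exact hD _ (by simpa using hy.trans_le (min_le_right _ _))
  -- At heights `±ρ / 2` one has `|W| ≥ κ`, so the intermediate value theorem reaches every level `κ
  -- t` with `|t| ≤ 1`.
  set κ := ρ / 2 * √c with hκ
  have hκpos : 0 < κ := by have := Real.sqrt_pos.2 hc; positivity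
  have hex : ∀ s : ℝ, ∀ w : ℝ, |w| ≤ κ → ∃ y : ℝ, |y| < ρ ∧ W (s + y * I) = w := by
    intro s w hw
    have hcont : ContinuousOn (fun y : ℝ => W (s + y * I)) (Icc (-(ρ / 2)) (ρ / 2)) :=
      fun y hy => (hvert s y (abs_lt.2 ⟨by linarith [hy.1], by linarith [hy.2]⟩)
        ).continuousAt.continuousWithinAt
    have hs : ∀ z, √c ≤ √(V z) := fun z => Real.sqrt_le_sqrt (hle z)
    have h1 : W (s + (ρ / 2 : ℝ) * I) ≥ κ := by
      simp only [hW, add_im, ofReal_im, zero_add, im_ofReal_mul, I_im, mul_one]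
      rw [hκ]
      have := hs (s + (ρ / 2 : ℝ) * I)
      gcongr
    have h2 : W (s + (-(ρ / 2) : ℝ) * I) ≤ -κ := by
      simp only [hW, add_im, ofReal_im, zero_add, im_ofReal_mul, I_im, mul_one]
      rw [hκ, neg_mul, neg_le_neg_iff]
      have := hs (s + (-(ρ / 2) : ℝ) * I)
      gcongr
    have hw' := abs_le.1 hw
    obtain ⟨y, hy, hyw⟩ := intermediate_value_Icc (by linarith) hcont
      (show w ∈ Icc (W (s + (-(ρ / 2) : ℝ) * I)) (W (s + (ρ / 2 : ℝ) * I)) from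
        ⟨h2.trans hw'.1, hw'.2.trans h1⟩)
    exact ⟨y, abs_lt.2 ⟨by linarith [hy.1], by linarith [hy.2]⟩, hyw⟩
  classical
  set Y : ℝ × ℝ → ℝ := fun q =>
    if h : ∃ y : ℝ, |y| < ρ ∧ W (q.1 + y * I) = κ * q.2 then h.choose else 0 with hY
  have hYuniq : ∀ (q : ℝ × ℝ) (y : ℝ), |y| < ρ → W (q.1 + y * I) = κ * q.2 → Y q = y := by
    intro q y hy hyq
    have h : ∃ y : ℝ, |y| < ρ ∧ W (q.1 + y * I) = κ * q.2 := ⟨y, hy, hyq⟩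
    simp only [hY, dif_pos h]
    exact (hmono q.1).injOn h.choose_spec.1 hy (h.choose_spec.2.trans hyq.symm)
  have hYspec : ∀ s, ∀ t ∈ Icc (-1 : ℝ) 1,
      |Y (s, t)| < ρ ∧ W (s + Y (s, t) * I) = κ * t := by
    intro s t ht
    obtain ⟨y, hy, hyw⟩ := hex s (κ * t) (by
      rw [abs_mul, abs_of_pos hκpos]
      exact mul_le_of_le_one_right hκpos.le (abs_le.2 ht))
    rw [hYuniq (s, t) y hy hyw]
    exact ⟨hy, hyw⟩
  have hlocal : ∀ s, ∀ t ∈ Icc (-1 : ℝ) 1, AnalyticAt ℝ Y (s, t) ∧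
      ∀ᶠ q in 𝓝 (s, t), W (q.1 + Y q * I) = κ * q.2 := by
    intro s t ht
    obtain ⟨hy, hyw⟩ := hYspec s t ht
    set y := Y (s, t)
    set J : ℝ × ℝ →L[ℝ] ℂ := (equivRealProdCLM.symm : ℝ × ℝ →L[ℝ] ℂ)
    have hJ : ∀ q : ℝ × ℝ, J q = q.1 + q.2 * I := fun q => equivRealProdCLM_symm_apply q
    have hjr : |(J (s, y)).im| < r := by
      rw [hJ]; simpa using hy.trans_le (min_le_left _ _)
    -- The local inverse of `(s, y) ↦ (s, κ⁻¹ W (s + i y))` has second component `Y`. This gives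
    -- analyticity, and the level equation in a full neighborhood even at `t = ±1`.
    set H : ℝ × ℝ → ℝ × ℝ := fun q => (q.1, κ⁻¹ * W (J q)) with hH
    have hHa : AnalyticAt ℝ H (s, y) :=
      analyticAt_fst.prod (analyticAt_const.mul ((hWa _ hjr).comp (J.analyticAt (s, y))))
    have hHsy : H (s, y) = (s, t) := by
      simp only [hH, hJ, hyw]
      rw [inv_mul_cancel_left₀ hκpos.ne']
    have hdpos : 0 < fderiv ℝ W (s + y * I) I :=
      hD _ (by simpa using hy.trans_le (min_le_right _ _))
    have hHd : HasFDerivAt H ((ContinuousLinearMap.fst ℝ ℝ ℝ).prod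
        (κ⁻¹ • (fderiv ℝ W (J (s, y))).comp J)) (s, y) :=
      hasFDerivAt_fst.prodMk
        (((hWa _ hjr).differentiableAt.hasFDerivAt.comp (s, y) J.hasFDerivAt).const_smul κ⁻¹)
    have hinj : Function.Injective (fderiv ℝ H (s, y)) := by
      rw [injective_iff_map_eq_zero, hHd.fderiv]
      rintro ⟨a, b⟩ hab
      have h1 : a = 0 := congrArg Prod.fst hab
      have h2 : κ⁻¹ * fderiv ℝ W (J (s, y)) (J (a, b)) = 0 := congrArg Prod.snd hab
      subst h1
      have h3 : J (0, b) = b • I := by rw [hJ]; simp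
      rw [h3, map_smul, hJ, smul_eq_mul] at h2
      have h4 : b = 0 := by
        rcases mul_eq_zero.1 ((mul_eq_zero.1 h2).resolve_left (inv_ne_zero hκpos.ne')) with h | h
        · exact h
        · exact absurd h hdpos.ne'
      rw [h4]; rfl
    set i : (ℝ × ℝ) ≃L[ℝ] (ℝ × ℝ) := (LinearEquiv.ofInjectiveEndo
      (fderiv ℝ H (s, y) : ℝ × ℝ →ₗ[ℝ] ℝ × ℝ) hinj).toContinuousLinearEquiv
    have hi : fderiv ℝ H (s, y) = (i : ℝ × ℝ →L[ℝ] ℝ × ℝ) := by ext <;> rfl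
    have hstrict : HasStrictFDerivAt H (i : ℝ × ℝ →L[ℝ] ℝ × ℝ) (s, y) := by
      rw [← hi]; exact hHa.hasStrictFDerivAt
    set e := hstrict.toOpenPartialHomeomorph H
    have hesrc : (s, y) ∈ e.source := hstrict.mem_toOpenPartialHomeomorph_source
    have hee : ∀ q, e q = H q := fun q => rfl
    have hea : AnalyticAt ℝ e.symm (s, t) := by
      have := e.analyticAt_symm' (i := i) hesrc hHa hi
      rwa [hee, hHsy] at this
    have hesy : e.symm (s, t) = (s, y) := by
      rw [← hHsy, ← hee, e.left_inv hesrc]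
    have hetgt : (s, t) ∈ e.target := by
      rw [← hHsy, ← hee]; exact e.map_source hesrc
    have hnear : ∀ᶠ q in 𝓝 (s, t), |(e.symm q).2| < ρ ∧ H (e.symm q) = q := by
      have h1 : Tendsto (fun q => |(e.symm q).2|) (𝓝 (s, t)) (𝓝 |y|) := by
        have := (continuous_snd.abs.tendsto (e.symm (s, t))).comp hea.continuousAt.tendsto
        rwa [hesy] at this
      exact (h1.eventually_lt_const hy).and (e.eventually_right_inverse hetgt)
    have hsolve : ∀ᶠ q in 𝓝 (s, t), Y q = (e.symm q).2 ∧ W (q.1 + Y q * I) = κ * q.2 := by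
      filter_upwards [hnear] with q hq
      have h1 : (e.symm q).1 = q.1 := by
        have := congrArg Prod.fst hq.2; exact this
      have h2 : κ⁻¹ * W (J (e.symm q)) = q.2 := by
        have := congrArg Prod.snd hq.2; exact this
      rw [hJ, h1, inv_mul_eq_iff_eq_mul₀ hκpos.ne'] at h2
      have h3 := hYuniq q _ hq.1 h2
      exact ⟨h3, by rw [h3]; exact h2⟩
    refine ⟨?_, hsolve.mono fun q hq => hq.2⟩
    have h1 : AnalyticAt ℝ (fun q => (e.symm q).2) (s, t) := analyticAt_snd.comp hea
    exact h1.congr (hsolve.mono fun q hq => hq.1.symm)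
  refine ⟨κ, hκpos, Y, fun s t ht => (hlocal s t ht).1, fun s t => ?_,
    fun s t ht => (hYspec s t ht).1.trans_le (min_le_left _ _), fun s t ht => ?_⟩
  · have h1 : ∀ y : ℝ, W ((s + 1 : ℝ) + y * I) = W (s + y * I) := fun y => by
      rw [← hWper (s + y * I)]
      congr 1
      push_cast
      ring
    simp only [hY, h1]
  · filter_upwards [(hlocal s t ht).2] with q hq
    have h1 : W (graphPoint Y q) = κ * q.2 := hq
    simp only [hW, graphPoint_im] at h1
    exact h1

/-- The tubular neighborhood of `γ` cut out by the level sets of the coordinate. -/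
theorem isTubularNeighborhood_of_level {γ : ℝ → Plane} {G : ℂ → ℂ} {r κ : ℝ}
    {V : ℂ → ℝ} {Y : ℝ × ℝ → ℝ} (hG : IsConformalStrip G r)
    (hγ : ∀ s : ℝ, planeToComplex (γ s) = G s) (hκ : 0 < κ) (hVpos : ∀ z, 0 < V z)
    (hV : ∀ z : ℂ, |z.im| < r → AnalyticAt ℝ V z)
    (hY : ∀ s, ∀ t ∈ Icc (-1 : ℝ) 1, AnalyticAt ℝ Y (s, t))
    (hYper : ∀ s t, Y (s + 1, t) = Y (s, t))
    (hYr : ∀ s, ∀ t ∈ Icc (-1 : ℝ) 1, |Y (s, t)| < r)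
    (hYeq : ∀ s, ∀ t ∈ Icc (-1 : ℝ) 1, ∀ᶠ q in 𝓝 (s, t),
        Y q * √(V (graphPoint Y q)) = κ * q.2) :
    IsTubularNeighborhood γ
      ((fun q => planeToComplex.symm (G (graphPoint Y q))) '' (univ ×ˢ Ioo (-1) 1)) ∧
    IsOpen ((fun q => planeToComplex.symm (G (graphPoint Y q))) '' (univ ×ˢ Ioo (-1) 1)) := by
  set Φ : ℝ × ℝ → Plane := fun q => planeToComplex.symm (G (graphPoint Y q)) with hΦ
  have him : ∀ s, ∀ t ∈ Icc (-1 : ℝ) 1, |(graphPoint Y (s, t)).im| < r := fun s t ht => by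
    rw [graphPoint_im]; exact hYr s t ht
  have hYpt : ∀ s, ∀ t ∈ Icc (-1 : ℝ) 1, Y (s, t) * √(V (graphPoint Y (s, t))) = κ * t :=
    fun s t ht => (hYeq s t ht).self_of_nhds
  have hΦa : ∀ s, ∀ t ∈ Icc (-1 : ℝ) 1, AnalyticAt ℝ Φ (s, t) := fun s t ht =>
    ((planeToComplex.symm.toContinuousLinearEquiv : ℂ →L[ℝ] Plane).analyticAt _).comp
      (((hG.analytic _ (him s t ht)).restrictScalars (𝕜 := ℝ)).comp (hY s t ht).graphPoint)
  have hbij : ∀ s, ∀ t ∈ Icc (-1 : ℝ) 1, Function.Bijective (fderiv ℝ Φ (s, t)) := by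
    intro s t ht
    have hj := ((hY s t ht).graphPoint).differentiableAt.hasFDerivAt
    set j' := fderiv ℝ (graphPoint Y) (s, t)
    have hGd := (hG.analytic _ (him s t ht)).differentiableAt.hasDerivAt.hasFDerivAt.restrictScalars
      ℝ
    have hΦd := (planeToComplex.symm.toContinuousLinearEquiv : ℂ →L[ℝ] Plane).hasFDerivAt.comp
      (s, t) (hGd.comp (s, t) hj)
    have hre : ∀ v, (j' v).re = v.1 := by
      intro v
      have h1 := (reCLM.hasFDerivAt.comp (s, t) hj)
      have h2 : HasFDerivAt (reCLM ∘ graphPoint Y) (ContinuousLinearMap.fst ℝ ℝ ℝ) (s, t) :=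
        hasFDerivAt_fst.congr_of_eventuallyEq
          (Eventually.of_forall fun q => graphPoint_re Y q)
      exact congrArg (fun L => L v) (h1.unique h2)
    -- Differentiating `W (graphPoint Y q) = κ q.2` shows that a vector killed by `j'` has zero
    -- second component; `hre` handles the first.
    have hlev : ∀ v, j' v = 0 → v.2 = 0 := by
      intro v hv
      have hW : AnalyticAt ℝ (fun z : ℂ => z.im * √(V z)) (graphPoint Y (s, t)) :=
        (imCLM.analyticAt _).mul (analyticAt_sqrt_comp (hV _ (him s t ht)) hVpos)
      have h1 := hW.differentiableAt.hasFDerivAt.comp (s, t) hj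
      have h2 : HasFDerivAt ((fun z : ℂ => z.im * √(V z)) ∘ graphPoint Y)
          (κ • ContinuousLinearMap.snd ℝ ℝ ℝ) (s, t) := by
        refine (hasFDerivAt_snd.const_smul κ).congr_of_eventuallyEq ?_
        filter_upwards [hYeq s t ht] with q hq
        simp only [Function.comp_apply, graphPoint_im, hq, Pi.smul_apply, smul_eq_mul]
      have h3 := congrArg (fun L => L v) (h1.unique h2)
      simp only [ContinuousLinearMap.comp_apply, j', hv, map_zero] at h3
      have h4 : κ * v.2 = 0 := h3.symm
      exact (mul_eq_zero.1 h4).resolve_left hκ.ne'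
    have hinj : Function.Injective (fderiv ℝ Φ (s, t)) := by
      rw [injective_iff_map_eq_zero]
      intro v hv
      have h1 : planeToComplex.symm (j' v * deriv G (graphPoint Y (s, t))) = 0 := by
        have h2 : fderiv ℝ Φ (s, t) = _ := hΦd.fderiv
        rw [h2] at hv
        simpa using hv
      rw [map_eq_zero_iff _ planeToComplex.symm.injective] at h1
      have h3 := (mul_eq_zero.1 h1).resolve_right (hG.deriv_ne _ (him s t ht))
      refine Prod.ext ?_ (hlev v h3)
      rw [← hre v, h3]; rfl
    refine ⟨hinj, ?_⟩
    have hfin : Module.finrank ℝ (ℝ × ℝ) = Module.finrank ℝ Plane := by simp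
    exact (LinearMap.injective_iff_surjective_of_finrank_eq_finrank
      (f := (fderiv ℝ Φ (s, t) : ℝ × ℝ →ₗ[ℝ] Plane)) hfin).1 hinj
  refine ⟨⟨Φ, ?_, ?_, ?_, ?_, ?_, rfl⟩, ?_⟩
  · rintro ⟨s, t⟩ ⟨-, ht⟩
    exact hΦa s t ht
  · intro s t _
    have h1 : graphPoint Y (s + 1, t) = graphPoint Y (s, t) + 1 := by
      simp only [graphPoint, hYper]
      push_cast
      ring
    simp only [hΦ, h1, hG.periodic]
  · rintro ⟨s, t⟩ ⟨hs, ht⟩ ⟨s', t'⟩ ⟨hs', ht'⟩ heq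
    obtain ⟨n, hn⟩ := hG.inj _ _ (him s t ht) (him s' t' ht') (planeToComplex.symm.injective heq)
    have hre : s = s' + n := by simpa [graphPoint_re] using congrArg Complex.re hn
    have hn0 : n = 0 := by
      have h1 : (-1 : ℝ) < n := by linarith [hs.1, hs'.2]
      have h2 : (n : ℝ) < 1 := by linarith [hs.2, hs'.1]
      have h3 : -1 < n := by exact_mod_cast h1
      have h4 : n < 1 := by exact_mod_cast h2
      omega
    rw [hn0, Int.cast_zero, add_zero] at hn hre
    have hYY : Y (s, t) = Y (s', t') := by simpa [graphPoint_im] using congrArg Complex.im hn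
    have h1 := hYpt s t ht
    rw [hn, hYY, hYpt s' t' ht'] at h1
    exact Prod.ext hre (mul_left_cancel₀ hκ.ne' h1).symm
  · rintro ⟨s, t⟩ ⟨-, ht⟩
    exact hbij s t ht
  · intro s
    have h0 : (0 : ℝ) ∈ Icc (-1 : ℝ) 1 := by norm_num
    have h1 := hYpt s 0 h0
    rw [mul_zero] at h1
    have h2 := (mul_eq_zero.1 h1).resolve_right (Real.sqrt_pos.2 (hVpos _)).ne'
    simp only [hΦ, graphPoint, h2]
    simp [← hγ]
  · rw [isOpen_iff_mem_nhds]
    rintro _ ⟨⟨s, t⟩, ⟨-, ht⟩, rfl⟩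
    have hsurj := (hbij s t (Ioo_subset_Icc_self ht)).2
    rw [← (hΦa s t (Ioo_subset_Icc_self ht)).hasStrictFDerivAt.map_nhds_eq_of_surj
      (LinearMap.range_eq_top.2 hsurj)]
    exact image_mem_map ((isOpen_univ.prod isOpen_Ioo).mem_nhds ⟨mem_univ _, ht⟩)

/-! ### Topology of the domain, and radial functions -/

theorem IsConformalStrip.map_nhds {G : ℂ → ℂ} {r : ℝ} (hG : IsConformalStrip G r) {z : ℂ}
    (hz : |z.im| < r) :
    map (fun z => planeToComplex.symm (G z)) (𝓝 z) = 𝓝 (planeToComplex.symm (G z)) := by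
  have h1 := (hG.analytic z hz).hasStrictDerivAt.map_nhds_eq (hG.deriv_ne z hz)
  have h2 : map planeToComplex.symm (𝓝 (G z)) = 𝓝 (planeToComplex.symm (G z)) :=
    planeToComplex.symm.toHomeomorph.map_nhds_eq (G z)
  rw [← h2, ← h1, Filter.map_map]
  rfl

/-- A neighborhood of the curve `G (ℝ)` inside the conformal strip `G {|Im z| < r}` is not simply
connected: `exp (2 π i z)` has no continuous logarithm on it. -/
theorem IsConformalStrip.not_simplyConnectedSpace {G : ℂ → ℂ} {r : ℝ} (hG : IsConformalStrip G r)
    {Ω : Set Plane} (hΩ : IsOpen Ω) (hcurve : ∀ s : ℝ, planeToComplex.symm (G s) ∈ Ω)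
    (hsub : ∀ x ∈ Ω, ∃ z : ℂ, |z.im| < r ∧ planeToComplex.symm (G z) = x) :
    ¬ SimplyConnectedSpace Ω := by
  intro hsc
  classical
  set g : Plane → ℂ := fun x =>
    if h : ∃ z : ℂ, |z.im| < r ∧ planeToComplex.symm (G z) = x then
      exp (2 * Real.pi * I * h.choose) else 1 with hg
  have hgz : ∀ z : ℂ, |z.im| < r → g (planeToComplex.symm (G z)) = exp (2 * Real.pi * I * z) := by
    intro z hz
    have h : ∃ w : ℂ, |w.im| < r ∧ planeToComplex.symm (G w) = planeToComplex.symm (G z) :=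
      ⟨z, hz, rfl⟩
    simp only [hg, dif_pos h]
    obtain ⟨n, hn⟩ := hG.inj _ _ h.choose_spec.1 hz
      (planeToComplex.symm.injective h.choose_spec.2)
    rw [Complex.exp_eq_exp_iff_exists_int]
    exact ⟨n, by rw [hn]; ring⟩
  have hgc : ContinuousOn g Ω := by
    intro x hx
    obtain ⟨z, hz, rfl⟩ := hsub x hx
    refine ContinuousAt.continuousWithinAt ?_
    rw [ContinuousAt, ← hG.map_nhds hz, tendsto_map'_iff, hgz z hz]
    have h1 : Tendsto (fun z => exp (2 * Real.pi * I * z)) (𝓝 z) (𝓝 (exp (2 * Real.pi * I * z))) :=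
      (continuous_exp.comp (continuous_const.mul continuous_id)).tendsto z
    refine h1.congr' ?_
    filter_upwards [(isOpen_lt (continuous_abs.comp continuous_im) continuous_const).mem_nhds hz]
      with w hw
    exact (hgz w hw).symm
  have hg0 : (0 : ℂ) ∉ g '' Ω := by
    rintro ⟨x, hx, hx0⟩
    obtain ⟨z, hz, rfl⟩ := hsub x hx
    rw [hgz z hz] at hx0
    exact exp_ne_zero _ hx0
  obtain ⟨L, hLc, hL⟩ := Complex.exists_continuousOn_eqOn_exp_comp
    (show IsSimplyConnected Ω from hsc) hΩ hgc hg0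
  -- A logarithm `L` would make `a` continuous and integer-valued, although it drops by `1` over a
  -- period.
  set a : ℝ → ℝ := fun s => (L (planeToComplex.symm (G s)) / (2 * Real.pi * I)).re - s with ha
  have hac : Continuous a := by
    have h1 : Continuous fun s : ℝ => planeToComplex.symm (G s) :=
      planeToComplex.symm.continuous.comp hG.continuous_curve
    have h2 : Continuous fun s : ℝ => L (planeToComplex.symm (G s)) :=
      hLc.comp_continuous h1 hcurve
    exact (continuous_re.comp (h2.div_const _)).sub continuous_id
  have haZ : ∀ s, ∃ n : ℤ, a s = n := by
    intro s
    have h1 : exp (L (planeToComplex.symm (G s))) = exp (2 * Real.pi * I * s) := by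
      rw [← hgz s (by simpa using hG.pos)]
      exact hL (hcurve s)
    obtain ⟨n, hn⟩ := Complex.exp_eq_exp_iff_exists_int.1 h1
    refine ⟨n, ?_⟩
    have h2 : L (planeToComplex.symm (G s)) / (2 * Real.pi * I) = ((s + n : ℝ) : ℂ) := by
      rw [hn, div_eq_iff two_pi_I_ne_zero]
      push_cast
      ring
    simp only [ha, h2, ofReal_re]
    ring
  have h10 : a 1 = a 0 - 1 := by
    have h1 : G ((1 : ℝ) : ℂ) = G ((0 : ℝ) : ℂ) := by
      have := hG.periodic 0
      simpa using this
    simp only [ha, h1]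
    ring
  obtain ⟨s, hs⟩ := mem_range_of_exists_le_of_exists_ge hac (c := a 0 - 1 / 2)
    ⟨1, by rw [h10]; linarith⟩ ⟨0, by linarith⟩
  obtain ⟨n, hn⟩ := haZ s
  obtain ⟨m, hm⟩ := haZ 0
  rw [hn, hm] at hs
  have h2 : (2 * n : ℝ) = 2 * m - 1 := by linarith
  have h3 : 2 * n = 2 * m - 1 := by exact_mod_cast h2
  omega

/-- A Jordan curve contained in a circle is the circle. -/
theorem IsAnalyticJordanCurve.range_eq_sphere {γ : ℝ → Plane} (hγ : IsAnalyticJordanCurve γ)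
    {c : Plane} {ρ : ℝ} (h : ∀ s, γ s ∈ Metric.sphere c ρ) : range γ = Metric.sphere c ρ := by
  have hcont : Continuous γ := continuous_iff_continuousAt.2 fun s =>
    (hγ.analytic s (mem_univ s)).continuousAt
  have hne : γ 0 ≠ γ (1 / 2) := fun h0 => by
    have := hγ.injOn (by norm_num) (by norm_num) h0
    norm_num at this
  refine Subset.antisymm (range_subset_iff.2 h) fun p hp => ?_
  by_contra hpr
  have hpos : ρ ≠ 0 := by
    rintro rfl
    simp only [Metric.sphere_zero, mem_singleton_iff] at h
    exact hne ((h 0).trans (h _).symm)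
  have hnorm : ∀ x ∈ Metric.sphere c ρ, ‖planeToComplex x - planeToComplex c‖ = ρ := by
    intro x hx
    rw [← map_sub, LinearIsometryEquiv.norm_map, ← dist_eq_norm]
    exact hx
  have hpc : planeToComplex p - planeToComplex c ≠ 0 := by
    rw [← norm_ne_zero_iff, hnorm p hp]; exact hpos
  set w : ℝ → ℂ := fun s =>
    (planeToComplex (γ s) - planeToComplex c) / (planeToComplex p - planeToComplex c) with hw
  have hw1 : ∀ s, ‖w s‖ = 1 := fun s => by
    rw [hw, norm_div, hnorm _ (h s), hnorm p hp, div_self hpos]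
  have hwinj : ∀ s t, w s = w t → γ s = γ t := fun s t hst => by
    have := (div_left_inj' hpc).1 hst
    exact planeToComplex.injective (sub_left_injective this)
  -- Since `p` is missed, the normalized curve `w` on the unit circle avoids `1`, so `-w` avoids the
  -- cut of the argument.
  have hslit : ∀ s, -w s ∈ slitPlane := by
    intro s
    by_contra hs
    rw [mem_slitPlane_iff, not_or, not_lt, not_not, neg_re, neg_im, neg_nonpos, neg_eq_zero] at hs
    have h1 : ((w s).re : ℂ) = w s := Complex.ext (by simp) (by simp [hs.2])
    have h2 : |(w s).re| = 1 := by rw [← hw1 s, ← h1, norm_real, ofReal_re, Real.norm_eq_abs]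
    rw [abs_of_nonneg hs.1] at h2
    rw [h2, ofReal_one] at h1
    have h3 := (div_eq_one_iff_eq hpc).1 h1.symm
    exact hpr ⟨s, planeToComplex.injective (sub_left_injective h3)⟩
  set a : ℝ → ℝ := fun s => arg (-w s) with ha
  have hac : Continuous a := by
    have hwc : Continuous w :=
      ((planeToComplex.continuous.comp hcont).sub continuous_const).div_const _
    exact continuous_iff_continuousAt.2 fun s =>
      ContinuousAt.comp (f := fun s => -w s) (continuousAt_arg (hslit s)) hwc.neg.continuousAt
  have haper : a 1 = a 0 := by
    have h1 := hγ.periodic 0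
    rw [zero_add] at h1
    simp only [ha, hw, h1]
  -- Since `b (1/2) = -b 0`, some `s` in `[0, 1/2]` has `γ (s + 1/2) = γ s`, against injectivity. At
  -- `s = 1/2` periodicity turns this into `γ 0 = γ (1/2)`.
  set b : ℝ → ℝ := fun s => a (s + 1 / 2) - a s with hb
  have hbc : Continuous b := (hac.comp (continuous_id.add continuous_const)).sub hac
  have hb0 : b (1 / 2) = -b 0 := by
    have h1 : (1 / 2 + 1 / 2 : ℝ) = 1 := by norm_num
    simp only [hb, h1, zero_add, haper]
    ring
  obtain ⟨s, hs, hbs⟩ := intermediate_value_uIcc (a := 0) (b := 1 / 2) hbc.continuousOn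
    (show (0 : ℝ) ∈ uIcc (b 0) (b (1 / 2)) by
      rw [hb0, mem_uIcc]
      rcases le_total (b 0) 0 with h0 | h0
      · exact Or.inl ⟨h0, by linarith⟩
      · exact Or.inr ⟨by linarith, h0⟩)
  rw [uIcc_of_le (by norm_num)] at hs
  have h1 : γ (s + 1 / 2) = γ s := by
    refine hwinj _ _ (neg_injective (Complex.ext_norm_arg ?_ ?_))
    · rw [norm_neg, norm_neg, hw1, hw1]
    · exact sub_eq_zero.1 hbs
  rcases hs.2.lt_or_eq with hlt | rfl
  · have := hγ.injOn ⟨by linarith [hs.1], by linarith⟩ ⟨hs.1, by linarith⟩ h1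
    linarith
  · have h2 := hγ.periodic 0
    norm_num at h1 h2
    exact hne (h2.symm.trans h1 |>.trans (by norm_num))

/-- If `ψ` is radial and vanishes on a curve but not identically near any of its points, then the
curve lies on a circle about the center. -/
theorem IsRadialOn.curve_subset_sphere {ψ : Plane → ℝ} {Ω : Set Plane} (h : IsRadialOn ψ Ω)
    (hΩ : IsOpen Ω) {γ : ℝ → Plane} (hcont : Continuous γ) (hmem : ∀ s, γ s ∈ Ω)
    (hzero : ∀ s, ψ (γ s) = 0) (hne : ∀ s, ∃ᶠ x in 𝓝 (γ s), ψ x ≠ 0) :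
    ∃ c ρ, ∀ s, γ s ∈ Metric.sphere c ρ := by
  obtain ⟨c, hc⟩ := h
  refine ⟨c, dist (γ 0) c, fun s => ?_⟩
  have hdc : Continuous fun s => dist (γ s) c := hcont.dist continuous_const
  -- If the distance to the center varied along the curve, every distance near an intermediate value
  -- would be attained on the curve. A radial `ψ` would then vanish near a point of the curve.
  have key : ∀ s₁ s₂, ¬ dist (γ s₁) c < dist (γ s₂) c := by
    intro s₁ s₂ hlt
    obtain ⟨s₀, hs₀⟩ := mem_range_of_exists_le_of_exists_ge hdc
      (c := (dist (γ s₁) c + dist (γ s₂) c) / 2) ⟨s₁, by linarith⟩ ⟨s₂, by linarith⟩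
    simp only at hs₀
    have hev : ∀ᶠ x in 𝓝 (γ s₀), dist (γ s₁) c < dist x c ∧ dist x c < dist (γ s₂) c ∧ x ∈ Ω := by
      have ht : Tendsto (fun x => dist x c) (𝓝 (γ s₀)) (𝓝 (dist (γ s₀) c)) :=
        (continuous_id.dist continuous_const).tendsto _
      exact (ht.eventually_const_lt (by rw [hs₀]; linarith)).and
        ((ht.eventually_lt_const (by rw [hs₀]; linarith)).and (hΩ.mem_nhds (hmem s₀)))
    obtain ⟨x, hx0, hx1, hx2, hxΩ⟩ := ((hne s₀).and_eventually hev).exists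
    obtain ⟨t, ht⟩ := mem_range_of_exists_le_of_exists_ge hdc (c := dist x c)
      ⟨s₁, hx1.le⟩ ⟨s₂, hx2.le⟩
    exact hx0 ((hc x hxΩ (γ t) (hmem t) ht.symm).trans (hzero t))
  exact le_antisymm (not_lt.1 (key 0 s)) (not_lt.1 (key s 0))

/-! ### The equations on the two sides and the steady Euler property -/

theorem poissonBracket_eq_zero_of_fderiv_eq_smul {f g : Plane → ℝ} {x : Plane} {k : ℝ}
    (h : fderiv ℝ g x = k • fderiv ℝ f x) : poissonBracket f g x = 0 := by
  simp only [poissonBracket, partialDeriv, h, smul_apply, smul_eq_mul]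
  ring

theorem poissonBracket_eq_zero_of_fderiv_left {f g : Plane → ℝ} {x : Plane}
    (h : fderiv ℝ f x = 0) : poissonBracket f g x = 0 := by
  simp [poissonBracket, partialDeriv, h]

/-- The exponent is half an odd integer, so the power of `|y|` is odd and the sign change across the
curve can absorb the absolute value. -/
theorem rpow_sq_mul_five_halves (y : ℝ) {v : ℝ} (hv : 0 ≤ v) :
    (y ^ 2 * v) ^ (5 / 2 : ℝ) = |y| ^ 5 * v ^ (5 / 2 : ℝ) := by
  rw [Real.mul_rpow (sq_nonneg y) hv, ← sq_abs, ← Real.rpow_natCast |y| 2,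
    ← Real.rpow_mul (abs_nonneg y), ← Real.rpow_natCast |y| 5]
  norm_num

theorem eventually_im_lt {r : ℝ} {z : ℂ} (hz : |z.im| < r) :
    ∀ᶠ w in 𝓝 z, |w.im| < r :=
  (isOpen_lt (continuous_abs.comp continuous_im) continuous_const).mem_nhds hz

namespace IsLocalSolution

variable {γ : ℝ → Plane} {G : ℂ → ℂ} {r c ε : ℝ} {V : ℂ → ℝ} {f : Plane → ℝ}

theorem V_pos (h : IsLocalSolution γ G r c ε V f) (z : ℂ) : 0 < V z := h.pos.trans_le (h.le z)

theorem nonneg (h : IsLocalSolution γ G r c ε V f) {z : ℂ} (hz : |z.im| < r) :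
    0 ≤ f (planeToComplex.symm (G z)) := by
  rw [h.eq z hz]
  exact mul_nonneg (sq_nonneg _) (h.V_pos z).le

theorem curve_symm (h : IsLocalSolution γ G r c ε V f) (s : ℝ) :
    planeToComplex.symm (G s) = γ s := by simp [← h.curve]

theorem laplacian_of_nonneg (h : IsLocalSolution γ G r c ε V f) {z : ℂ} (hz : |z.im| < r)
    (hside : 0 ≤ ε * z.im) : Laplacian.laplacian f (planeToComplex.symm (G z)) =
      2 + f (planeToComplex.symm (G z)) ^ (5 / 2 : ℝ) := by
  rw [h.laplacian z hz, h.eq z hz, rpow_sq_mul_five_halves _ (h.V_pos z).le]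
  rcases h.sign with rfl | rfl
  · rw [abs_of_nonneg (by linarith)]
    ring
  · rw [abs_of_nonpos (by linarith)]
    ring

theorem laplacian_of_nonpos (h : IsLocalSolution γ G r c ε V f) {z : ℂ} (hz : |z.im| < r)
    (hside : ε * z.im ≤ 0) : Laplacian.laplacian f (planeToComplex.symm (G z)) =
      2 - f (planeToComplex.symm (G z)) ^ (5 / 2 : ℝ) := by
  rw [h.laplacian z hz, h.eq z hz, rpow_sq_mul_five_halves _ (h.V_pos z).le]
  rcases h.sign with rfl | rfl
  · rw [abs_of_nonpos (by linarith)]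
    ring
  · rw [abs_of_nonneg (by linarith)]
    ring

theorem map_nhds (h : IsLocalSolution γ G r c ε V f) {z : ℂ} (hz : |z.im| < r) :
    map (fun z => planeToComplex.symm (G z)) (𝓝 z) = 𝓝 (planeToComplex.symm (G z)) :=
  h.strip.map_nhds hz

theorem eventually_nhds (h : IsLocalSolution γ G r c ε V f) {z : ℂ} (hz : |z.im| < r)
    {P : Plane → Prop} :
    (∀ᶠ x in 𝓝 (planeToComplex.symm (G z)), P x) ↔
      ∀ᶠ w in 𝓝 z, P (planeToComplex.symm (G w)) := by
  rw [← h.map_nhds hz, eventually_map]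

theorem eq_zero_of_im (h : IsLocalSolution γ G r c ε V f) {z : ℂ} (hz : z.im = 0) :
    f (planeToComplex.symm (G z)) = 0 := by
  rw [h.eq z (by simpa [hz] using h.strip.pos), hz]
  ring

/-- Points of the curve are local minima, because `f` is nonnegative and vanishes there. -/
theorem fderiv_of_im (h : IsLocalSolution γ G r c ε V f) {z : ℂ} (hz : z.im = 0) :
    fderiv ℝ f (planeToComplex.symm (G z)) = 0 := by
  have hzr : |z.im| < r := by simpa [hz] using h.strip.pos
  refine IsLocalMin.fderiv_eq_zero ?_
  rw [IsLocalMin, IsMinFilter, h.eq_zero_of_im hz, h.eventually_nhds hzr]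
  exact (eventually_im_lt hzr).mono fun w hw => h.nonneg hw

theorem eventually_laplacian (h : IsLocalSolution γ G r c ε V f) {z : ℂ} (hz : |z.im| < r)
    (h0 : z.im ≠ 0) : ∃ σ : ℝ, ∀ᶠ x in 𝓝 (planeToComplex.symm (G z)),
      Laplacian.laplacian f x = 2 + σ * f x ^ (5 / 2 : ℝ) := by
  have hε : ε * z.im ≠ 0 := mul_ne_zero (by rcases h.sign with rfl | rfl <;> norm_num) h0
  have ht : Tendsto (fun w : ℂ => ε * w.im) (𝓝 z) (𝓝 (ε * z.im)) :=
    (continuous_const.mul continuous_im).tendsto z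
  rcases hε.lt_or_gt with hneg | hpos
  · refine ⟨-1, (h.eventually_nhds hz).2 ?_⟩
    filter_upwards [eventually_im_lt hz, ht.eventually_lt_const hneg] with w hw hw'
    rw [h.laplacian_of_nonpos hw hw'.le]
    ring
  · refine ⟨1, (h.eventually_nhds hz).2 ?_⟩
    filter_upwards [eventually_im_lt hz, ht.eventually_const_lt hpos] with w hw hw'
    rw [h.laplacian_of_nonneg hw hw'.le]
    ring

/-- Off the curve the Laplacian is locally a function of `f`, so the gradients are parallel; on the
curve the gradient of `f` vanishes. -/
theorem poissonBracket_eq_zero (h : IsLocalSolution γ G r c ε V f) {z : ℂ} (hz : |z.im| < r) :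
    poissonBracket f (Laplacian.laplacian f) (planeToComplex.symm (G z)) = 0 := by
  by_cases h0 : z.im = 0
  · exact poissonBracket_eq_zero_of_fderiv_left (h.fderiv_of_im h0)
  obtain ⟨σ, hσ⟩ := h.eventually_laplacian hz h0
  have hf : f (planeToComplex.symm (G z)) ≠ 0 := by
    rw [h.eq z hz]
    exact mul_ne_zero (pow_ne_zero 2 h0) (h.V_pos z).ne'
  have hd := (((h.analyticAt z hz).differentiableAt.hasFDerivAt.rpow_const
    (p := (5 / 2 : ℝ)) (Or.inl hf)).const_smul σ).const_add 2
  have hd' := hd.congr_of_eventuallyEq hσ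
  exact poissonBracket_eq_zero_of_fderiv_eq_smul (hd'.fderiv.trans (smul_smul _ _ _))

/-- If `f` vanished near a point of the curve, its Laplacian there would be `0` instead of `2`. -/
theorem frequently_ne_zero (h : IsLocalSolution γ G r c ε V f) (s : ℝ) :
    ∃ᶠ x in 𝓝 (γ s), f x ≠ 0 := by
  intro hev
  have hs : |(s : ℂ).im| < r := by simpa using h.strip.pos
  have hev' : f =ᶠ[𝓝 (γ s)] fun _ => 0 := hev.mono fun x hx => not_not.1 hx
  have h1 := h.laplacian s hs
  rw [h.curve_symm] at h1
  rw [(InnerProductSpace.laplacian_congr_nhds hev').self_of_nhds] at h1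
  simp at h1

end IsLocalSolution

end

/-! ### The main theorem -/

theorem theorem4p11 (γ : ℝ → Plane) (hγ : IsAnalyticJordanCurve γ) :
    ∃ (Ω : Set Plane) (ψ : Plane → ℝ),
      IsTubularNeighborhood γ Ω ∧
      AnalyticOnNhd ℝ ψ (closure Ω) ∧
      (∃ c : ℝ, ∀ x ∈ frontier Ω, ψ x = c) ∧
      (∀ x ∈ Ω, 0 ≤ ψ x) ∧
      (∀ x ∈ Ω ∩ jordanInterior (range γ), Laplacian.laplacian ψ x = 2 + ψ x ^ (5 / 2 : ℝ)) ∧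
      (∀ x ∈ Ω ∩ jordanExterior (range γ), Laplacian.laplacian ψ x = 2 - ψ x ^ (5 / 2 : ℝ)) ∧
      (∀ s, ψ (γ s) = 0 ∧ fderiv ℝ ψ (γ s) (unitNormal γ s) = 0) ∧
      -- `ψ` is a steady Euler flow on the multiply connected domain `Ω`, for which the rigidity
      -- valid on simply connected domains fails
      (∀ x ∈ Ω, poissonBracket ψ (Laplacian.laplacian ψ) x = 0) ∧
      ¬ SimplyConnectedSpace Ω ∧
      (¬ ∃ F : ℝ → ℝ, ∀ x ∈ Ω, Laplacian.laplacian ψ x = F (ψ x)) ∧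
      ((¬ ∃ (c : Plane) (r : ℝ), range γ = Metric.sphere c r) → ¬ IsRadialOn ψ Ω) := by
  obtain ⟨G, r, c, ε, V, f, h⟩ := exists_isLocalSolution hγ
  obtain ⟨κ, hκ, Y, hYa, hYper, hYr, hYeq⟩ :=
    exists_level_coordinate h.strip.pos h.pos h.le h.periodic h.analytic
  obtain ⟨htub, hopen⟩ := isTubularNeighborhood_of_level h.strip h.curve hκ h.V_pos h.analytic
    hYa hYper hYr hYeq
  set Φ : ℝ × ℝ → Plane := fun q => planeToComplex.symm (G (graphPoint Y q)) with hΦ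
  set Ω := Φ '' (univ ×ˢ Ioo (-1) 1) with hΩ
  have him : ∀ s, ∀ t ∈ Icc (-1 : ℝ) 1, |(graphPoint Y (s, t)).im| < r := fun s t ht => by
    rw [graphPoint_im]; exact hYr s t ht
  -- `f` is the square of the coordinate `y √V = κ t`, hence constant on the two boundary curves `t
  -- = ±1`.
  have hfval : ∀ s, ∀ t ∈ Icc (-1 : ℝ) 1, f (Φ (s, t)) = κ ^ 2 * t ^ 2 := by
    intro s t ht
    rw [hΦ, h.eq _ (him s t ht), graphPoint_im]
    have h1 : Y (s, t) * √(V (graphPoint Y (s, t))) = κ * t := (hYeq s t ht).self_of_nhds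
    rw [← mul_pow, ← h1, mul_pow, Real.sq_sqrt (h.V_pos _).le]
  have hmem : ∀ x ∈ Ω, ∃ z : ℂ, |z.im| < r ∧ planeToComplex.symm (G z) = x := by
    rintro _ ⟨⟨s, t⟩, ⟨-, ht⟩, rfl⟩
    exact ⟨_, him s t (Ioo_subset_Icc_self ht), rfl⟩
  have hΦper : ∀ s t, Φ (s + 1, t) = Φ (s, t) := by
    intro s t
    have h1 : graphPoint Y (s + 1, t) = graphPoint Y (s, t) + 1 := by
      simp only [graphPoint, hYper]
      push_cast
      ring
    simp only [hΦ, h1, h.strip.periodic]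
  have hclosure : closure Ω ⊆ Φ '' (Icc 0 1 ×ˢ Icc (-1) 1) := by
    refine closure_minimal ?_ (IsCompact.isClosed ?_)
    · rintro _ ⟨⟨s, t⟩, ⟨-, ht⟩, rfl⟩
      refine ⟨(Int.fract s, t), ⟨⟨Int.fract_nonneg s, (Int.fract_lt_one s).le⟩,
        Ioo_subset_Icc_self ht⟩, ?_⟩
      have hp : Function.Periodic (fun s => Φ (s, t)) 1 := fun s => hΦper s t
      have := hp.sub_int_mul_eq (x := s) ⌊s⌋
      rwa [mul_one] at this
    · refine (isCompact_Icc.prod isCompact_Icc).image_of_continuousOn ?_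
      rintro ⟨s, t⟩ ⟨-, ht⟩
      have h1 : ContinuousAt G (graphPoint Y (s, t)) := (h.strip.analytic _ (him s t ht)).continuousAt
      have h2 : ContinuousAt (graphPoint Y) (s, t) := (hYa s t ht).graphPoint.continuousAt
      exact (planeToComplex.symm.continuous.continuousAt.comp
        (ContinuousAt.comp h1 h2)).continuousWithinAt
  have hγΩ : ∀ s, γ s ∈ Ω := by
    obtain ⟨Ψ, -, -, -, -, h0, himg⟩ := htub
    intro s
    rw [← himg, ← h0]
    exact ⟨(s, 0), ⟨mem_univ _, by norm_num⟩, rfl⟩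
  have hzero : ∀ s, f (γ s) = 0 := fun s => by
    rw [← h.curve_symm s]
    exact h.eq_zero_of_im (Complex.ofReal_im s)
  refine ⟨Ω, f, htub, ?_, ⟨κ ^ 2, ?_⟩, ?_, ?_, ?_, ?_, ?_, ?_, ?_, ?_⟩
  · intro x hx
    obtain ⟨⟨s, t⟩, ⟨-, ht⟩, rfl⟩ := hclosure hx
    exact h.analyticAt _ (him s t ht)
  · intro x hx
    rw [hopen.frontier_eq] at hx
    obtain ⟨⟨s, t⟩, ⟨-, ht⟩, rfl⟩ := hclosure hx.1
    change t ∈ Icc (-1 : ℝ) 1 at ht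
    have ht' : t ∉ Ioo (-1 : ℝ) 1 := fun ht' => hx.2 ⟨(s, t), ⟨mem_univ _, ht'⟩, rfl⟩
    have ht2 : t ^ 2 = 1 := by
      rcases ht.1.eq_or_lt with h1 | h1
      · rw [← h1]; norm_num
      · have h2 : t = 1 := le_antisymm ht.2 (not_lt.1 fun h2 => ht' ⟨h1, h2⟩)
        rw [h2]; norm_num
    rw [hfval s t ht, ht2, mul_one]
  · intro x hx
    obtain ⟨z, hz, rfl⟩ := hmem x hx
    exact h.nonneg hz
  · rintro x ⟨hx, hxi⟩
    obtain ⟨z, hz, rfl⟩ := hmem x hx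
    exact h.laplacian_of_nonneg hz ((h.side z hz).1 hxi).le
  · rintro x ⟨hx, hxe⟩
    obtain ⟨z, hz, rfl⟩ := hmem x hx
    exact h.laplacian_of_nonpos hz ((h.side z hz).2 hxe).le
  · intro s
    refine ⟨hzero s, ?_⟩
    rw [← h.curve_symm s, h.fderiv_of_im (Complex.ofReal_im s)]
    rfl
  · intro x hx
    obtain ⟨z, hz, rfl⟩ := hmem x hx
    exact h.poissonBracket_eq_zero hz
  · exact h.strip.not_simplyConnectedSpace hopen (fun s => by rw [h.curve_symm]; exact hγΩ s) hmem
  · rintro ⟨F, hF⟩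
    -- At `t = ±1/2` the values of `f` agree, but `Y` has opposite signs, so the terms `ε y⁵
    -- V^{5/2}` do too and the Laplacians differ.
    have hp : (1 / 2 : ℝ) ∈ Ioo (-1 : ℝ) 1 := by norm_num
    have hm : (-(1 / 2) : ℝ) ∈ Ioo (-1 : ℝ) 1 := by norm_num
    have hfp := hfval 0 _ (Ioo_subset_Icc_self hp)
    have hfm := hfval 0 _ (Ioo_subset_Icc_self hm)
    have hsgn : ∀ t ∈ Ioo (-1 : ℝ) 1,
        Y (0, t) * √(V (graphPoint Y (0, t))) = κ * t := fun t ht =>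
      (hYeq 0 t (Ioo_subset_Icc_self ht)).self_of_nhds
    have hYp : 0 < Y (0, 1 / 2) :=
      pos_of_mul_pos_left (by rw [hsgn _ hp]; positivity) (Real.sqrt_nonneg _)
    have hYm : Y (0, -(1 / 2)) < 0 :=
      neg_of_mul_neg_left (by rw [hsgn _ hm]; linarith) (Real.sqrt_nonneg _)
    have hFp := hF _ ⟨(0, 1 / 2), ⟨mem_univ _, hp⟩, rfl⟩
    have hFm := hF _ ⟨(0, -(1 / 2)), ⟨mem_univ _, hm⟩, rfl⟩
    rw [hfp, h.laplacian _ (him 0 _ (Ioo_subset_Icc_self hp)), graphPoint_im] at hFp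
    rw [hfm, neg_sq, ← hFp, h.laplacian _ (him 0 _ (Ioo_subset_Icc_self hm)), graphPoint_im] at hFm
    have hvp := mul_pos (pow_pos hYp 5) (Real.rpow_pos_of_pos (h.V_pos (graphPoint Y (0, 1 / 2)))
      (5 / 2))
    have hvm := mul_neg_of_neg_of_pos (Odd.pow_neg (by decide : Odd 5) hYm)
      (Real.rpow_pos_of_pos (h.V_pos (graphPoint Y (0, -(1 / 2)))) (5 / 2))
    rcases h.sign with rfl | rfl <;> linarith
  · intro hsphere hrad
    have hcont : Continuous γ := continuous_iff_continuousAt.2 fun s =>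
      (hγ.analytic s (mem_univ s)).continuousAt
    obtain ⟨p, ρ, hp⟩ := hrad.curve_subset_sphere hopen hcont hγΩ hzero h.frequently_ne_zero
    exact hsphere ⟨p, ρ, hγ.range_eq_sphere hp⟩
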